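/- **Setting.** Let $f_1,\dots,f_M:\mathbb R^d\to\mathbb R$ be differentiable and $F=\frac1M\sum_i f_i$. Assume, for constants $L,G>0$ and $\sigma_g$, that for all $i$ and $w,w'$: $\|\nabla f_i(w)-\nabla f_i(w')\|\le L\|w-w'\|$, $\|\nabla f_i(w)\|\le G$, and $\frac1M\sum_i\|\nabla f_i(w)-\nabla F(w)\|^2\le\sigma_g^2$. Let $F^*=\inf F>-\infty$. **LDP-FedEXP** (local step size $\eta_l$, $\tau\ge1$ local steps, clipping threshold $C=\eta_l\tau G$, $T\ge 1$ rounds, initial point $w^{(0)}$). In round $t=1,\dots,T$ client $i$ runs $\tau$ steps of gradient descent on $f_i$ with step size $\eta_l$ from $w^{(t-1)}$, obtaining the displacement $\tilde\Delta_i^{(t)}$, clips it to $\Delta_i^{(t)}=\min\{C/\|\tilde\Delta_i^{(t)}\|,1\}\tilde\Delta_i^{(t)}$, and sends a randomized message $c_i^{(t)}$ (independently over clients, given the past). The server puts $\bar c^{(t)}=\frac1M\sum_i c_i^{(t)}$ and $w^{(t)}=w^{(t-1)}+\eta_g^{(t)}\bar c^{(t)}$. *Gaussian mechanism:* $c_i^{(t)}\sim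 N(\Delta_i^{(t)},\sigma^2I_d)$, $\sigma>0$, and $\eta_g^{(t)}=\max\{1,(\frac1M\sum_i\|c_i^{(t)}\|^2-d\sigma^2)/\|\bar c^{(t)}\|^2\}$. *PrivUnit* ($d\ge2$; $\varepsilon_0,\varepsilon_1,\varepsilon_2>0$): $c_i^{(t)}=\hat r\,z$ with independent $\hat r\sim\mathrm{ScalarDP}(\|\Delta_i^{(t)}\|;\varepsilon_2)$ and $z\sim\mathrm{PrivUnit}(\Delta_i^{(t)}/\|\Delta_i^{(t)}\|;\varepsilon_0,\varepsilon_1)$ (if $\Delta_i^{(t)}=0$, its direction is replaced by a fixed unit vector). - $\mathrm{PrivUnit}(u;\varepsilon_0,\varepsilon_1)$: let $p=e^{\varepsilon_0}/(1+e^{\varepsilon_0})$. A threshold $\gamma\in[0,1)$ is admissible if $\gamma\le\frac{e^{\varepsilon_1}-1}{e^{\varepsilon_1}+1}\sqrt{\frac{\pi}{2(d-1)}}$, or if $\frac12\log d+\log6-\frac{d-1}2\log(1-\gamma^2)+\log\gamma\le\varepsilon_1$ and $\gamma\ge\sqrt{2/d}$. An admissible $\gamma$ is fixed with $\gamma\ge\theta\gamma'$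 for every admissible $\gamma'$, where $\theta>0$ is a constant. Draw $V$ uniformly from $\{v\in\mathbb S^{d-1}:\langle v,u\rangle\ge\gamma\}$ with probability $p$, and uniformly from $\{v\in\mathbb S^{d-1}:\langle v,u\rangle<\gamma\}$ otherwise. Return $V/m$, where, with $\alpha=\frac{d-1}2$, $s=\frac{1+\gamma}2$, $B(x;\alpha,\alpha)=\int_0^x y^{\alpha-1}(1-y)^{\alpha-1}dy$ and $B(\alpha,\alpha)=B(1;\alpha,\alpha)$, $$m=\frac{(1-\gamma^2)^\alpha}{2^{d-2}(d-1)}\Big[\frac p{B(\alpha,\alpha)-B(s;\alpha,\alpha)}-\frac{1-p}{B(s;\alpha,\alpha)}\Big].$$ - $\mathrm{ScalarDP}(r;\varepsilon_2)$: let $k=\lceil e^{\varepsilon_2/3}\rceil$, $x=kr/C$. Let $J=\lfloor x\rfloor$ with probability $\lceil x\rceil-x$ and $J=\lceil x\rceil$ otherwise; let $\hat J=J$ with probability $\frac{e^{\varepsilon_2}}{e^{\varepsilon_2}+k}$ and $\hat J$ uniform on $\{0,\dots,k\}\setminus\{J\}$ otherwise. Return $a(\hat J-b)$, where $a=\frac{e^{\varepsilon_2}+k}{e^{\varepsilon_2}-1}\cdot\frac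 Ck$ and $b=\frac{k(k+1)}{2(e^{\varepsilon_2}+k)}$. - Step size: from a message $c$ the server computes $\tilde r=m\|c\|$, $\hat r=\tilde r$ if $\tilde r/a+b\in\mathbb Z$ and $\hat r=-\tilde r$ otherwise, and $\hat s=\frac{\hat r^2-c_2\hat r-c_3}{1+c_1}$ with $c_1=\frac{k+1}{e^{\varepsilon_2}-1}$, $c_2=-c_1C$, $c_3=(c_1+1)\frac{C^2}{4k^2}+c_1C^2\Big[\frac{(2k+1)(e^{\varepsilon_2}+k)}{6k(e^{\varepsilon_2}-1)}-\frac{k+1}{4(e^{\varepsilon_2}-1)}\Big]$. Then $\eta_g^{(t)}=\max\{1,\frac1M\sum_i\hat s_i/\|\bar c^{(t)}\|^2\}$. - Here $\sigma^2:=C^2\max\{\frac1{\varepsilon_1},\frac1{(e^{\varepsilon_1}-1)^2}\}$. **Theorem.** (a) There is a numerical constant $c>0$ such that for each $\kappa>0$ there is a constant $K$, depending only on $\kappa$, with the following property. If $\frac{\kappa}{L\tau}\le\eta_l<\frac1{24L\tau}$, then for every $q\in[1,\sqrt M]$, LDP-FedEXP with the Gaussian mechanism satisfies, with probability at least $1-Te^{-cq^2}$,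 $$\min_{0\le t\le T-1}\|\nabla F(w^{(t)})\|^2\le K\Big(\frac{F(w^{(0)})-F^*}{\sum_{t=1}^T\eta_g^{(t)}\eta_l\tau}+\eta_l^2L^2\tau(\tau-1)\sigma_g^2+\eta_lL\tau\sigma_g^2+\frac{L\sigma^2q^2}{\eta_l\tau}\Big[\frac dM+\sqrt{\frac dM}\Big]\Big).$$ (b) There is a numerical constant $c>0$ such that for all $\kappa,\kappa',\theta>0$ there is a constant $K$, depending only on these, with the following property. If $\frac{\kappa}{L\tau}\le\eta_l<\frac1{24L\tau}$, $\kappa'\le\varepsilon_1\le d$, $\kappa'\le\varepsilon_2$ and $\frac{k(k+1)}{e^{\varepsilon_2}+k}\notin\mathbb Z$, then for every $q\in[1,\sqrt M]$, LDP-FedEXP with PrivUnit satisfies, with probability at least $1-Te^{-cq^2}$, the same inequality with the last bracket replaced by $\big[\frac dM+\sqrt{\frac1M}\big]$. -/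

import Mathlib

open MeasureTheory

noncomputable section

namespace FedEXP

/-- The parameter space `ℝ^d` with its Euclidean norm. -/
abbrev Vec (d : ℕ) : Type := EuclideanSpace ℝ (Fin d)

/-- The average of `M` vectors. -/
def mean {d M : ℕ} (v : Fin M → Vec d) : Vec d :=
  (1 / (M : ℝ)) • ∑ i, v i

/-- The average of `M` real numbers. -/
def average {M : ℕ} (x : Fin M → ℝ) : ℝ :=
  (1 / (M : ℝ)) * ∑ i, x i

/-- The global objective `F = (1/M) ∑ f_i`. -/
def objective {d M : ℕ} (f : Fin M → Vec d → ℝ) (w : Vec d) : ℝ :=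
  average fun i => f i w

/-- Every client loss is differentiable, `L`-smooth and `G`-Lipschitz, and the gradient diversity
is bounded by `σg ^ 2`. -/
structure ClientAssumptions {d M : ℕ} (f : Fin M → Vec d → ℝ) (L G σg : ℝ) : Prop where
  L_pos : 0 < L
  G_pos : 0 < G
  differentiable : ∀ i, Differentiable ℝ (f i)
  smooth : ∀ i w w', ‖gradient (f i) w - gradient (f i) w'‖ ≤ L * ‖w - w'‖
  lipschitz : ∀ i w, ‖gradient (f i) w‖ ≤ G
  diversity : ∀ w,
    average (fun i => ‖gradient (f i) w - gradient (objective f) w‖ ^ 2) ≤ σg ^ 2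

/-! ### Local computation of a client -/

/-- `k` steps of gradient descent on `g` with step size `η`, started at `w`. -/
def localIterate {d : ℕ} (g : Vec d → ℝ) (η : ℝ) (w : Vec d) : ℕ → Vec d
  | 0 => w
  | k + 1 => localIterate g η w k - η • gradient g (localIterate g η w k)

/-- Clipping to norm at most `C`. -/
def clip {d : ℕ} (C : ℝ) (v : Vec d) : Vec d :=
  min (C / ‖v‖) 1 • v

/-- The clipped local update of a client with loss `g` after `τ` local steps from `w`. -/
def localUpdate {d : ℕ} (g : Vec d → ℝ) (η : ℝ) (τ : ℕ) (C : ℝ) (w : Vec d) : Vec d :=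
  clip C (localIterate g η w τ - w)

/-! ### LDP-FedEXP for a local randomizer `R` and a rule `step` for the global step size

A transcript `c : ℕ → Fin M → ℝ^d` records in `c t` the messages which the clients send in round
`t + 1`, that is, in the round that leads from `w^(t)` to `w^(t+1)`. -/

/-- The global model `w^(t)` as a function of the transcript. -/
def model {d M : ℕ} (step : (Fin M → Vec d) → ℝ) (w0 : Vec d) (c : ℕ → Fin M → Vec d) :
    ℕ → Vec d
  | 0 => w0
  | t + 1 => model step w0 c t + step (c t) • mean (c t)

/-- The law of the transcript of the first `T` rounds (entries of later rounds are `0`). In each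
round the clients compute their local updates at the current model, and randomize them by `R`,
independently of each other given the past. -/
def transcriptLaw {d M : ℕ} (f : Fin M → Vec d → ℝ) (η : ℝ) (τ : ℕ) (C : ℝ)
    (R : Vec d → Measure (Vec d)) (step : (Fin M → Vec d) → ℝ) (w0 : Vec d) :
    ℕ → Measure (ℕ → Fin M → Vec d)
  | 0 => Measure.dirac 0
  | t + 1 => (transcriptLaw f η τ C R step w0 t).bind fun c =>
      (Measure.pi fun i => R (localUpdate (f i) η τ C (model step w0 c t))).map
        (Function.update c t)

/-! ### Gaussian mechanism -/

/-- The law of `Δ + ε` with `ε ∼ N(0, σ² I_d)`. -/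
def gaussianMechanism {d : ℕ} (σ : ℝ) (Δ : Vec d) : Measure (Vec d) :=
  (ProbabilityTheory.stdGaussian (Vec d)).map fun ε => Δ + σ • ε

/-- The global step size for the Gaussian mechanism. -/
def gaussianStep {d M : ℕ} (σ : ℝ) (c : Fin M → Vec d) : ℝ :=
  max 1 ((average (fun i => ‖c i‖ ^ 2) - d * σ ^ 2) / ‖mean c‖ ^ 2)

/-! ### PrivUnit: randomization of the direction -/

/-- The threshold `γ` is admissible for the privacy parameter `ε₁`. -/
def AdmissibleThreshold (d : ℕ) (ε₁ γ : ℝ) : Prop :=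
  0 ≤ γ ∧ γ < 1 ∧
    (γ ≤ (Real.exp ε₁ - 1) / (Real.exp ε₁ + 1) * √(Real.pi / (2 * ((d : ℝ) - 1))) ∨
      (1 / 2 * Real.log d + Real.log 6 - ((d : ℝ) - 1) / 2 * Real.log (1 - γ ^ 2)
          + Real.log γ ≤ ε₁ ∧
        √(2 / (d : ℝ)) ≤ γ))

/-- `p = e^ε₀ / (1 + e^ε₀)`. -/
def capProb (ε₀ : ℝ) : ℝ := Real.exp ε₀ / (1 + Real.exp ε₀)

/-- The incomplete beta function `B(x; α, β)`; `B(α, β) = B(1; α, β)`. -/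
def incBeta (x α β : ℝ) : ℝ := ∫ s in (0 : ℝ)..x, s ^ (α - 1) * (1 - s) ^ (β - 1)

/-- The normalizing constant `m`. -/
def privUnitScale (d : ℕ) (ε₀ γ : ℝ) : ℝ :=
  let α : ℝ := ((d : ℝ) - 1) / 2
  let θ : ℝ := (1 + γ) / 2
  (1 - γ ^ 2) ^ α / (2 ^ ((d : ℝ) - 2) * ((d : ℝ) - 1)) *
    (capProb ε₀ / (incBeta 1 α α - incBeta θ α α) - (1 - capProb ε₀) / incBeta θ α α)

/-- The uniform distribution on the part `S` of the unit sphere, as a measure on `ℝ^d`. -/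
def uniformOnSphere {d : ℕ} (S : Set (Metric.sphere (0 : Vec d) 1)) : Measure (Vec d) :=
  (ProbabilityTheory.cond (volume : Measure (Vec d)).toSphere S).map Subtype.val

/-- The law of `PrivUnit(u; ε₀, ε₁)` with threshold `γ`, for a unit vector `u`: a vector that is
uniform on the cap `⟨v, u⟩ ≥ γ` with probability `p` and uniform on its complement otherwise, is
divided by `m`. -/
def privUnit {d : ℕ} (ε₀ γ : ℝ) (u : Vec d) : Measure (Vec d) :=
  (ENNReal.ofReal (capProb ε₀) • uniformOnSphere {v | γ ≤ inner ℝ (v : Vec d) u}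
    + ENNReal.ofReal (1 - capProb ε₀) • uniformOnSphere {v | inner ℝ (v : Vec d) u < γ}).map
      fun v => (1 / privUnitScale d ε₀ γ) • v

/-! ### ScalarDP: randomization of the norm -/

/-- `k = ⌈e^(ε₂ / 3)⌉`. -/
def scalarK (ε₂ : ℝ) : ℕ := ⌈Real.exp (ε₂ / 3)⌉₊

def scalarA (C ε₂ : ℝ) : ℝ :=
  (Real.exp ε₂ + scalarK ε₂) / (Real.exp ε₂ - 1) * (C / scalarK ε₂)

def scalarB (ε₂ : ℝ) : ℝ :=
  (scalarK ε₂ : ℝ) * (scalarK ε₂ + 1) / (2 * (Real.exp ε₂ + scalarK ε₂))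

/-- The probability that randomized rounding of `x ≥ 0` yields `j`: `⌊x⌋` has probability
`⌈x⌉ - x`, and otherwise the result is `⌈x⌉`. -/
def roundingProb (x : ℝ) (j : ℕ) : ℝ :=
  (if j = ⌊x⌋₊ then (⌈x⌉₊ : ℝ) - x else 0) + (if j = ⌈x⌉₊ then 1 - ((⌈x⌉₊ : ℝ) - x) else 0)

/-- The probability that randomized response on `{0, …, k}` turns `j` into `l`. -/
def responseProb (ε₂ : ℝ) (j l : ℕ) : ℝ :=
  if l = j then Real.exp ε₂ / (Real.exp ε₂ + scalarK ε₂)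
  else (1 - Real.exp ε₂ / (Real.exp ε₂ + scalarK ε₂)) / scalarK ε₂

/-- The law of `ScalarDP(r; ε₂)` for `r ∈ [0, C]`. -/
def scalarDP (C ε₂ r : ℝ) : Measure ℝ :=
  ∑ j ∈ Finset.range (scalarK ε₂ + 1), ∑ l ∈ Finset.range (scalarK ε₂ + 1),
    ENNReal.ofReal (roundingProb (scalarK ε₂ * r / C) j * responseProb ε₂ j l) •
      Measure.dirac (scalarA C ε₂ * ((l : ℝ) - scalarB ε₂))

/-! ### The PrivUnit mechanism and its step size -/

open Classical in
/-- The direction of `Δ`; the zero vector, which has none, is given the direction `e`. -/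
def direction {d : ℕ} (e Δ : Vec d) : Vec d :=
  if Δ = 0 then e else (1 / ‖Δ‖) • Δ

/-- The law of `r̂ z` for independent `r̂ ∼ ScalarDP(‖Δ‖; ε₂)` and
`z ∼ PrivUnit(Δ / ‖Δ‖; ε₀, ε₁)`. -/
def privUnitMechanism {d : ℕ} (C ε₀ γ ε₂ : ℝ) (e Δ : Vec d) : Measure (Vec d) :=
  ((scalarDP C ε₂ ‖Δ‖).prod (privUnit ε₀ γ (direction e Δ))).map fun x => x.1 • x.2

def normC₁ (ε₂ : ℝ) : ℝ := ((scalarK ε₂ : ℝ) + 1) / (Real.exp ε₂ - 1)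

def normC₂ (C ε₂ : ℝ) : ℝ := -normC₁ ε₂ * C

def normC₃ (C ε₂ : ℝ) : ℝ :=
  (normC₁ ε₂ + 1) * (C ^ 2 / (4 * (scalarK ε₂ : ℝ) ^ 2)) +
    normC₁ ε₂ * C ^ 2 *
      ((2 * (scalarK ε₂ : ℝ) + 1) * (Real.exp ε₂ + scalarK ε₂) /
          (6 * scalarK ε₂ * (Real.exp ε₂ - 1))
        - ((scalarK ε₂ : ℝ) + 1) / (4 * (Real.exp ε₂ - 1)))

open Classical in
/-- The server's reconstruction of `r̂` from a message `c = r̂ z`. -/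
def recoveredNorm {d : ℕ} (C ε₀ γ ε₂ : ℝ) (c : Vec d) : ℝ :=
  let r := privUnitScale d ε₀ γ * ‖c‖
  if ∃ n : ℤ, (n : ℝ) = r / scalarA C ε₂ + scalarB ε₂ then r else -r

/-- The estimate `ŝ` of the squared norm of an update, computed from the message `c`. -/
def sqNormEstimate {d : ℕ} (C ε₀ γ ε₂ : ℝ) (c : Vec d) : ℝ :=
  1 / (1 + normC₁ ε₂) *
    (recoveredNorm C ε₀ γ ε₂ c ^ 2 - normC₂ C ε₂ * recoveredNorm C ε₀ γ ε₂ c - normC₃ C ε₂)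

/-- The global step size for PrivUnit. -/
def privUnitStep {d M : ℕ} (C ε₀ γ ε₂ : ℝ) (c : Fin M → Vec d) : ℝ :=
  max 1 (average (fun i => sqNormEstimate C ε₀ γ ε₂ (c i)) / ‖mean c‖ ^ 2)

/-- The noise level `σ² = C² (1/ε₁ ∨ 1/(e^ε₁ - 1)²)` of PrivUnit. -/
def privUnitVariance (C ε₁ : ℝ) : ℝ :=
  C ^ 2 * max (1 / ε₁) (1 / (Real.exp ε₁ - 1) ^ 2)

end FedEXP

end

/-!
The clipping threshold `C = η τ G` is never active, and since `η L τ < 1/24` the update `Δ_i` of a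
client is `-η τ ∇f_i(w)` up to a relative error `η L τ`. Write `c̄` for the average of the messages
of a round. The global step size has the form `s = max 1 (a / ‖c̄‖²)`, where `a` estimates the
average of `‖Δ_i‖²`. Suppose that in every round `‖c̄ - mean Δ‖² ≤ N` and
`a ≤ 2 average ‖Δ_i‖² + N'`. Then `s ‖c̄‖² = max ‖c̄‖² a` is bounded by the average of `‖Δ_i‖²`
and by `N + N'`, up to constants, so that the quadratic term of the descent lemma is `s` times an
admissible error, however large `s` is. The decrease of the objective is therefore
`s η τ (‖∇F(w)‖² / 4 - E)` at least (`objective_step_le`), and summation over the rounds gives the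
claim (`iInf_le_of_descent`). The lower bound for `η` enters through `1 / (η τ) ≤ L / κ`.

It remains to bound the probability of the two events in one round by `e^{-2 q²}` each, uniformly in
the model at the start of the round; `convergence_of_round_bounds` does the rest, with a union bound
over the rounds and `2 e^{-2 q²} ≤ e^{-q²}`. The noise is controlled by the potential
`exp (‖∑ ξ_i‖² / (2 D A))` with `A` increasing by one with each summand
(`lintegral_exp_norm_add_sum_le`), which treats Gaussian and bounded noise alike. The bound for `a`
is a Chernoff bound in both cases.

For the Gaussian mechanism both exponential moments are explicit. For PrivUnit there are three
points. The message is unbiased: by symmetry the mean of PrivUnit is a multiple of `u`, and `m` is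
that multiple, because the marginal of the sphere along `u` is `cos φ` with density proportional to
`sin φ ^ (d - 2)` and the substitution `s = (1 + cos φ) / 2` turns the incomplete beta functions
into integrals of this density (`integral_privUnit`). The message is bounded by a multiple of
`√d σ`: `m` is at least `γ / 16` (`le_privUnitScale`), and `γ` is at least of order `√(ε₁ / d)`
because explicit thresholds of this order are admissible (`sq_threshold_ge`). Finally, the
non-integrality hypothesis lets the server recover `r̂` exactly (`sign_recovery`), and `ŝ` has
exponential moments of the right size (`scalarExp_exp_le`).
-/

namespace FedEXP

/-! ### Averages, and the gradient of the global objective -/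

section Average

variable {d M : ℕ}

lemma average_mono {x y : Fin M → ℝ} (h : ∀ i, x i ≤ y i) : average x ≤ average y := by
  unfold average
  gcongr with i _
  exact h i

lemma average_nonneg {x : Fin M → ℝ} (h : ∀ i, 0 ≤ x i) : 0 ≤ average x :=
  mul_nonneg (by positivity) (Finset.sum_nonneg fun i _ => h i)

lemma average_add (x y : Fin M → ℝ) :
    average (fun i => x i + y i) = average x + average y := by
  simp only [average, Finset.sum_add_distrib, mul_add]

lemma average_const_mul (a : ℝ) (x : Fin M → ℝ) :
    average (fun i => a * x i) = a * average x := by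
  simp only [average, ← Finset.mul_sum]
  ring

lemma average_const (hM : 0 < M) (a : ℝ) : average (fun _ : Fin M => a) = a := by
  have : (M : ℝ) ≠ 0 := by positivity
  simp [average]
  field_simp

lemma mean_add (v w : Fin M → Vec d) : mean (fun i => v i + w i) = mean v + mean w := by
  simp only [mean, Finset.sum_add_distrib, smul_add]

lemma mean_sub (v w : Fin M → Vec d) : mean (fun i => v i - w i) = mean v - mean w := by
  simp only [mean, Finset.sum_sub_distrib, smul_sub]

lemma mean_const_smul (a : ℝ) (v : Fin M → Vec d) :
    mean (fun i => a • v i) = a • mean v := by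
  simp only [mean, ← Finset.smul_sum]
  rw [smul_comm]

lemma norm_mean_le (v : Fin M → Vec d) : ‖mean v‖ ≤ average fun i => ‖v i‖ := by
  unfold mean average
  rw [norm_smul, Real.norm_of_nonneg (by positivity)]
  gcongr
  exact norm_sum_le _ _

lemma average_sq_le (x : Fin M → ℝ) : average x ^ 2 ≤ average fun i => x i ^ 2 := by
  rcases Nat.eq_zero_or_pos M with rfl | hM
  · simp [average]
  have hM' : (0 : ℝ) < M := by positivity
  have h := sq_sum_le_card_mul_sum_sq (s := Finset.univ) (f := x)
  simp only [Finset.card_univ, Fintype.card_fin] at h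
  simp only [average, mul_pow]
  calc (1 / (M : ℝ)) ^ 2 * (∑ i, x i) ^ 2 ≤ (1 / (M : ℝ)) ^ 2 * (M * ∑ i, x i ^ 2) := by gcongr
    _ = _ := by field_simp

lemma norm_mean_sq_le (v : Fin M → Vec d) : ‖mean v‖ ^ 2 ≤ average fun i => ‖v i‖ ^ 2 :=
  (pow_le_pow_left₀ (norm_nonneg _) (norm_mean_le v) 2).trans (average_sq_le _)

lemma measurable_mean : Measurable (mean : (Fin M → Vec d) → Vec d) := by
  unfold mean
  fun_prop

lemma hasGradientAt_objective {f : Fin M → Vec d → ℝ} (hf : ∀ i, Differentiable ℝ (f i))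
    (w : Vec d) : HasGradientAt (objective f) (mean fun i => gradient (f i) w) w := by
  rw [hasGradientAt_iff_hasFDerivAt]
  have h : ∀ i ∈ Finset.univ, HasFDerivAt (f i)
      (InnerProductSpace.toDual ℝ (Vec d) (gradient (f i) w)) w :=
    fun i _ => (hasGradientAt_iff_hasFDerivAt).1 (hf i w).hasGradientAt
  have h2 := (HasFDerivAt.fun_sum h).const_mul (1 / (M : ℝ))
  unfold mean objective average
  rw [map_smul, map_sum]
  exact h2

lemma gradient_objective {f : Fin M → Vec d → ℝ} (hf : ∀ i, Differentiable ℝ (f i))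
    (w : Vec d) : gradient (objective f) w = mean fun i => gradient (f i) w :=
  (hasGradientAt_objective hf w).gradient

end Average

/-- The descent lemma for a function with `L`-Lipschitz gradient. -/
lemma descent_of_lipschitz_gradient {d : ℕ} {F : Vec d → ℝ} {L : ℝ} (hF : Differentiable ℝ F)
    (hL : ∀ w w', ‖gradient F w - gradient F w'‖ ≤ L * ‖w - w'‖) (w v : Vec d) :
    F (w + v) ≤ F w + inner ℝ (gradient F w) v + L / 2 * ‖v‖ ^ 2 := by
  set h : ℝ → ℝ := fun s => F (w + s • v) - s * inner ℝ (gradient F w) v - L / 2 * s ^ 2 * ‖v‖ ^ 2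
  have hd : ∀ s : ℝ, HasDerivAt h
      (inner ℝ (gradient F (w + s • v)) v - inner ℝ (gradient F w) v - L * s * ‖v‖ ^ 2) s := by
    intro s
    have h1 : HasDerivAt (fun s : ℝ => w + s • v) v s := by
      simpa using ((hasDerivAt_id s).smul_const v).const_add w
    have h2 := ((hF (w + s • v)).hasGradientAt.hasFDerivAt).comp_hasDerivAt s h1
    have h3 := (h2.sub ((hasDerivAt_id s).mul_const (inner ℝ (gradient F w) v))).sub
      ((((hasDerivAt_id s).pow 2).const_mul (L / 2)).mul_const (‖v‖ ^ 2))
    refine h3.congr_deriv ?_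
    simp only [InnerProductSpace.toDual_apply_apply, id, Nat.cast_ofNat]
    ring
  have hanti : AntitoneOn h (Set.Icc 0 1) := by
    refine antitoneOn_of_deriv_nonpos (convex_Icc 0 1)
      (fun s _ => (hd s).continuousAt.continuousWithinAt)
      (fun s _ => (hd s).differentiableAt.differentiableWithinAt) fun s hs => ?_
    rw [interior_Icc] at hs
    rw [(hd s).deriv, ← inner_sub_left]
    have h1 := real_inner_le_norm (gradient F (w + s • v) - gradient F w) v
    have h2 := hL (w + s • v) w
    rw [add_sub_cancel_left, norm_smul, Real.norm_of_nonneg hs.1.le] at h2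
    have h3 := mul_le_mul_of_nonneg_right h2 (norm_nonneg v)
    nlinarith
  have := hanti (by simp : (0 : ℝ) ∈ Set.Icc (0 : ℝ) 1) (by simp : (1 : ℝ) ∈ Set.Icc (0 : ℝ) 1)
    zero_le_one
  simp only [h, one_smul, zero_smul, add_zero] at this
  linarith

/-! ### The local updates -/

section LocalUpdate

variable {d : ℕ} {g : Vec d → ℝ} {η L G : ℝ}

lemma norm_localIterate_sub_le_of_lipschitz (hη : 0 ≤ η) (hG : ∀ w, ‖gradient g w‖ ≤ G)
    (w : Vec d) (k : ℕ) : ‖localIterate g η w k - w‖ ≤ η * k * G := by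
  induction k with
  | zero => simp [localIterate]
  | succ k ih =>
    have h : localIterate g η w (k + 1) - w
        = (localIterate g η w k - w) - η • gradient g (localIterate g η w k) := by
      simp only [localIterate]; abel
    rw [h]
    refine (norm_sub_le _ _).trans ?_
    rw [norm_smul, Real.norm_of_nonneg hη]
    have := mul_le_mul_of_nonneg_left (hG (localIterate g η w k)) hη
    push_cast
    linarith

lemma clip_eq_self {C : ℝ} {v : Vec d} (h : ‖v‖ ≤ C) : clip C v = v := by
  by_cases hv : v = 0
  · simp [clip, hv]
  · have : 0 < ‖v‖ := norm_pos_iff.2 hv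
    rw [clip, min_eq_right ((one_le_div this).2 h), one_smul]

/-- With the threshold `η τ G`, clipping is inactive. -/
lemma localUpdate_eq (hη : 0 ≤ η) (hG : ∀ w, ‖gradient g w‖ ≤ G) (τ : ℕ) (w : Vec d) :
    localUpdate g η τ (η * τ * G) w = localIterate g η w τ - w :=
  clip_eq_self (norm_localIterate_sub_le_of_lipschitz hη hG w τ)

lemma norm_localIterate_sub_le (hη : 0 ≤ η) (hL : 0 ≤ L)
    (hs : ∀ w w', ‖gradient g w - gradient g w'‖ ≤ L * ‖w - w'‖) {τ : ℕ}
    (hητ : η * L * τ ≤ 1 / 2) (w : Vec d) {k : ℕ} (hk : k ≤ τ) :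
    ‖localIterate g η w k - w‖ ≤ 2 * η * k * ‖gradient g w‖ ∧
      ‖localIterate g η w k - w + (η * k) • gradient g w‖ ≤ η * L * (η * k ^ 2) * ‖gradient g w‖ := by
  induction k with
  | zero => simp [localIterate]
  | succ k ih =>
    obtain ⟨ih1, ih2⟩ := ih (by omega)
    set x := localIterate g η w k with hx
    set b := ‖gradient g w‖ with hb
    have hb0 : 0 ≤ b := norm_nonneg _
    have hk' : η * L * k ≤ 1 / 2 := by
      refine le_trans ?_ hητ
      have : (k : ℝ) ≤ τ := by exact_mod_cast (by omega : k ≤ τ)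
      gcongr
    have h0 : ‖η • (gradient g x - gradient g w)‖ ≤ η * L * (2 * η * k * b) := by
      rw [norm_smul, Real.norm_of_nonneg hη, mul_assoc]
      gcongr
      exact (hs x w).trans (by gcongr)
    constructor
    · have h : localIterate g η w (k + 1) - w
          = (x - w) - η • (gradient g x - gradient g w) - η • gradient g w := by
        simp only [localIterate, ← hx, smul_sub]; abel
      rw [h]
      refine (norm_sub_le _ _).trans ((add_le_add_left (norm_sub_le _ _) _).trans ?_)
      rw [norm_smul η (gradient g w), Real.norm_of_nonneg hη, ← hb]
      have h1 : η * L * (2 * η * k * b) ≤ η * b := by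
        have := mul_le_mul_of_nonneg_right hk' (by positivity : 0 ≤ 2 * η * b)
        nlinarith
      push_cast
      nlinarith
    · have h : localIterate g η w (k + 1) - w + (η * ((k + 1 : ℕ) : ℝ)) • gradient g w
          = (x - w + (η * k) • gradient g w) - η • (gradient g x - gradient g w) := by
        simp only [localIterate, ← hx, smul_sub]
        push_cast
        rw [mul_add, add_smul, mul_one]; abel
      rw [h]
      refine (norm_sub_le _ _).trans ((add_le_add ih2 h0).trans ?_)
      have : 0 ≤ η * L * η * b := by positivity
      push_cast
      nlinarith

lemma continuous_gradient_of_lipschitz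
    (hs : ∀ w w', ‖gradient g w - gradient g w'‖ ≤ L * ‖w - w'‖) : Continuous (gradient g) := by
  refine (LipschitzWith.of_dist_le_mul (K := L.toNNReal) fun x y => ?_).continuous
  rw [dist_eq_norm, dist_eq_norm]
  exact (hs x y).trans (by gcongr; exact Real.le_coe_toNNReal L)

lemma continuous_localIterate (hc : Continuous (gradient g)) (k : ℕ) :
    Continuous fun w => localIterate g η w k := by
  induction k with
  | zero => exact continuous_id
  | succ k ih => exact ih.sub ((hc.comp ih).const_smul η)

end LocalUpdate

/-! ### One round of the algorithm, on the event that the noise is small -/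

lemma step_bound_aux {L r ρ a b B N N' i q : ℝ} (hr : 0 < r) (hL : 0 < L) (hρ0 : 0 < ρ)
    (hρ1 : ρ ≤ 1 / 24) (hρ : r * L = ρ) (ha : 0 ≤ a) (hb : 0 ≤ b) (hN' : 0 ≤ N')
    (hi : i ≤ -r * (3 / 4) * a + r * (4 * ρ ^ 2) * (a + b) + B * N)
    (hq : q ≤ 2 * (r ^ 2 * (25 / 24) ^ 2 * (2 * a + 2 * b)) + 2 * N + N') :
    i + L / 2 * q ≤ -r * (a / 4 - 5 * (ρ * b)) + B * N + L * (N + N') := by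
  have h1 := mul_le_mul_of_nonneg_left hq (by linarith : 0 ≤ L / 2)
  have h2 : L / 2 * (2 * (r ^ 2 * (25 / 24) ^ 2 * (2 * a + 2 * b)) + 2 * N + N')
      = r * (2 * (25 / 24) ^ 2 * ρ) * (a + b) + L * N + L * N' / 2 := by
    rw [← hρ]; ring
  have h5 : 4 * ρ ^ 2 + 2 * (25 / 24) ^ 2 * ρ ≤ 5 * ρ := by nlinarith
  have h6 := mul_le_mul_of_nonneg_left h5 (by positivity : 0 ≤ r * b)
  have h7 := mul_le_mul_of_nonneg_left (h5.trans (by linarith : 5 * ρ ≤ 1 / 2))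
    (by positivity : 0 ≤ r * a)
  have h8 : 0 ≤ L * N' := by positivity
  linarith

/-- The decrease of the objective in a round in which the averaged noise has square at most `N`
and the estimate `a` of the mean square of the updates is too large by at most `N'`, up to the
factor two. The step size `s = 1 ∨ a / ‖c̄‖²` cancels one factor `‖c̄‖²` of the quadratic
term of the descent lemma, so that every error term is proportional to `s`. -/
lemma objective_step_le {d M τ : ℕ} (hM : 0 < M) (hτ : 1 ≤ τ) {f : Fin M → Vec d → ℝ}
    {L G σg η κ N N' a : ℝ} (hA : ClientAssumptions f L G σg) (hκ : 0 < κ)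
    (hη1 : κ / (L * τ) ≤ η) (hη2 : η < 1 / (24 * L * τ)) (hN' : 0 ≤ N') (w c : Vec d)
    (hN : ‖c - mean fun i => localUpdate (f i) η τ (η * τ * G) w‖ ^ 2 ≤ N)
    (ha : a ≤ 2 * average (fun i => ‖localUpdate (f i) η τ (η * τ * G) w‖ ^ 2) + N') :
    objective f (w + max 1 (a / ‖c‖ ^ 2) • c) ≤ objective f w
      - max 1 (a / ‖c‖ ^ 2) * (η * τ) * (‖gradient (objective f) w‖ ^ 2 / 4
        - (5 * (η * L * τ * σg ^ 2) + L / (η * τ) * ((2 / κ + 1) * (N + N')))) := by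
  have hL := hA.L_pos
  have hτ' : (0 : ℝ) < τ := by exact_mod_cast hτ
  have hη : 0 < η := lt_of_lt_of_le (by positivity) hη1
  set ρ := η * L * τ with hρ
  have hρ0 : 0 < ρ := by positivity
  have hρ1 : ρ ≤ 1 / 24 := by
    rw [lt_div_iff₀ (by positivity)] at hη2
    rw [hρ]; linarith
  have hρκ : κ ≤ ρ := by
    rw [div_le_iff₀ (by positivity)] at hη1
    rw [hρ]; linarith
  set Δ := fun i => localUpdate (f i) η τ (η * τ * G) w with hΔ
  set gi := fun i => gradient (f i) w with hgi
  set g := gradient (objective f) w with hg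
  have hgmean : g = mean gi := gradient_objective hA.differentiable w
  have hdiffF : Differentiable ℝ (objective f) :=
    fun w => (hasGradientAt_objective hA.differentiable w).differentiableAt
  have hsm : ∀ w w', ‖gradient (objective f) w - gradient (objective f) w'‖ ≤ L * ‖w - w'‖ := by
    intro w w'
    rw [gradient_objective hA.differentiable, gradient_objective hA.differentiable, ← mean_sub]
    refine (norm_mean_le _).trans ((average_mono fun i => hA.smooth i w w').trans ?_)
    rw [average_const hM]
  -- the mean square of the client gradients
  have hQ : average (fun i => ‖gi i‖ ^ 2) ≤ 2 * ‖g‖ ^ 2 + 2 * σg ^ 2 := by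
    have h1 : ∀ i, ‖gi i‖ ^ 2 ≤ 2 * ‖g‖ ^ 2 + 2 * ‖gi i - g‖ ^ 2 := by
      intro i
      have h := norm_add_le g (gi i - g)
      rw [add_sub_cancel] at h
      nlinarith [sq_nonneg (‖g‖ - ‖gi i - g‖), norm_nonneg (gi i)]
    refine (average_mono h1).trans ?_
    rw [average_add, average_const hM, average_const_mul]
    have := hA.diversity w
    simp only [hgi, hg]
    linarith
  have hclose : ∀ i, ‖Δ i + (η * τ) • gi i‖ ≤ η * τ * ρ * ‖gi i‖ := by
    intro i
    have h := (norm_localIterate_sub_le hη.le hL.le (hA.smooth i) (τ := τ)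
      (by linarith : η * L * τ ≤ 1 / 2) w le_rfl).2
    simp only [hΔ, localUpdate_eq hη.le (hA.lipschitz i)]
    refine h.trans (le_of_eq ?_)
    rw [hρ, hgi]; ring
  have hΔsq : average (fun i => ‖Δ i‖ ^ 2)
      ≤ (η * τ) ^ 2 * (25 / 24) ^ 2 * (2 * ‖g‖ ^ 2 + 2 * σg ^ 2) := by
    have h1 : ∀ i, ‖Δ i‖ ^ 2 ≤ (η * τ) ^ 2 * (25 / 24) ^ 2 * ‖gi i‖ ^ 2 := by
      intro i
      have h := norm_sub_le (Δ i + (η * τ) • gi i) ((η * τ) • gi i)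
      rw [add_sub_cancel_right, norm_smul, Real.norm_of_nonneg (by positivity)] at h
      have h2 : ‖Δ i‖ ≤ (η * τ) * (25 / 24) * ‖gi i‖ := by
        have : η * τ * ρ * ‖gi i‖ ≤ η * τ * (1 / 24) * ‖gi i‖ := by gcongr
        linarith [hclose i]
      calc ‖Δ i‖ ^ 2 ≤ ((η * τ) * (25 / 24) * ‖gi i‖) ^ 2 := by gcongr
        _ = _ := by ring
    refine (average_mono h1).trans ?_
    rw [average_const_mul]
    gcongr
  -- the inner product of the gradient with the averaged update
  set e := mean Δ + (η * τ) • g with he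
  have he2 : ‖e‖ ^ 2 ≤ (η * τ) ^ 2 * ρ ^ 2 * (2 * ‖g‖ ^ 2 + 2 * σg ^ 2) := by
    have h1 : e = mean fun i => Δ i + (η * τ) • gi i := by
      rw [mean_add, mean_const_smul, ← hgmean]
    rw [h1]
    refine (norm_mean_sq_le _).trans ?_
    have h2 : ∀ i, ‖Δ i + (η * τ) • gi i‖ ^ 2 ≤ (η * τ) ^ 2 * ρ ^ 2 * ‖gi i‖ ^ 2 := by
      intro i
      calc _ ≤ (η * τ * ρ * ‖gi i‖) ^ 2 := by gcongr; exact hclose i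
        _ = _ := by ring
    refine (average_mono h2).trans ?_
    rw [average_const_mul]
    gcongr
  set ξ := c - mean Δ with hξ
  have hyoung : ∀ v : Vec d, inner ℝ g v ≤ η * τ / 8 * ‖g‖ ^ 2 + 2 / (η * τ) * ‖v‖ ^ 2 := by
    intro v
    have h1 := real_inner_le_norm g v
    have h2 : η * τ / 8 * ‖g‖ ^ 2 + 2 / (η * τ) * ‖v‖ ^ 2 - ‖g‖ * ‖v‖
        = 2 / (η * τ) * (η * τ / 4 * ‖g‖ - ‖v‖) ^ 2 := by
      field_simp; ring
    have h3 : 0 ≤ 2 / (η * τ) * (η * τ / 4 * ‖g‖ - ‖v‖) ^ 2 := by positivity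
    linarith
  have hinner : inner ℝ g c ≤ -(η * τ) * (3 / 4) * ‖g‖ ^ 2
      + η * τ * (4 * ρ ^ 2) * (‖g‖ ^ 2 + σg ^ 2) + 2 * L / κ * N := by
    have hc : c = -((η * τ) • g) + e + ξ := by rw [he, hξ]; abel
    have h1 : inner ℝ g c = -(η * τ) * ‖g‖ ^ 2 + inner ℝ g e + inner ℝ g ξ := by
      rw [hc, inner_add_right, inner_add_right, inner_neg_right, real_inner_smul_right,
        real_inner_self_eq_norm_sq]
      ring
    have h2 : 2 / (η * τ) * ‖e‖ ^ 2 ≤ η * τ * (4 * ρ ^ 2) * (‖g‖ ^ 2 + σg ^ 2) := by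
      calc 2 / (η * τ) * ‖e‖ ^ 2
          ≤ 2 / (η * τ) * ((η * τ) ^ 2 * ρ ^ 2 * (2 * ‖g‖ ^ 2 + 2 * σg ^ 2)) := by gcongr
        _ = _ := by field_simp; ring
    have h3 : 2 / (η * τ) * ‖ξ‖ ^ 2 ≤ 2 * L / κ * N := by
      have : 2 / (η * τ) ≤ 2 * L / κ := by
        rw [div_le_div_iff₀ (by positivity) hκ]
        rw [hρ] at hρκ
        linarith
      calc _ ≤ 2 * L / κ * ‖ξ‖ ^ 2 := by gcongr
        _ ≤ _ := by gcongr
    rw [h1]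
    linarith [hyoung e, hyoung ξ]
  set s := max 1 (a / ‖c‖ ^ 2) with hs
  have hs1 : 1 ≤ s := le_max_left _ _
  have hNN : 0 ≤ N := (sq_nonneg _).trans hN
  -- the quadratic term
  have hquad : s * ‖c‖ ^ 2 ≤ 2 * average (fun i => ‖Δ i‖ ^ 2) + 2 * N + N' := by
    have hav : 0 ≤ average (fun i => ‖Δ i‖ ^ 2) := average_nonneg fun i => sq_nonneg _
    have hcc : ‖c‖ ^ 2 ≤ 2 * average (fun i => ‖Δ i‖ ^ 2) + 2 * N := by
      have h := norm_add_le (mean Δ) ξ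
      rw [hξ, add_sub_cancel, ← hξ] at h
      have h2 := norm_mean_sq_le Δ
      nlinarith [sq_nonneg (‖mean Δ‖ - ‖ξ‖), norm_nonneg c]
    by_cases hc0 : ‖c‖ ^ 2 = 0
    · rw [hc0, mul_zero]; positivity
    · have : 0 < ‖c‖ ^ 2 := lt_of_le_of_ne (sq_nonneg _) (Ne.symm hc0)
      rw [hs, max_mul_of_nonneg _ _ this.le, div_mul_cancel₀ _ hc0]
      exact max_le (by linarith) (by linarith)
  have hdesc := descent_of_lipschitz_gradient hdiffF hsm w (s • c)
  rw [real_inner_smul_right, norm_smul, Real.norm_of_nonneg (by linarith)] at hdesc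
  have hfin : inner ℝ g c + L / 2 * (s * ‖c‖ ^ 2) ≤ -(η * τ) * (‖g‖ ^ 2 / 4
        - (5 * (ρ * σg ^ 2) + L / (η * τ) * ((2 / κ + 1) * (N + N')))) := by
    have h3 : η * τ * (L / (η * τ) * ((2 / κ + 1) * (N + N')))
        = 2 * L / κ * (N + N') + L * (N + N') := by field_simp
    have h4 : 0 ≤ 2 * L / κ * N' := by positivity
    have h := step_bound_aux (r := η * τ) (by positivity) hL hρ0 hρ1 (by rw [hρ]; ring)
      (sq_nonneg ‖g‖) (sq_nonneg σg) hN' hinner (hquad.trans (by linarith [hΔsq]))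
    linarith
  have := mul_le_mul_of_nonneg_left hfin (by linarith : 0 ≤ s)
  linarith

/-- If every round decreases the objective by `s_t ρ (‖∇F(w_t)‖² / 4 - E)`, then some iterate has
a small gradient. -/
lemma iInf_le_of_descent {T : ℕ} (hT : 1 ≤ T) {φ g s : ℕ → ℝ} {ρ E φs : ℝ} (hρ : 0 < ρ)
    (hs : ∀ t, 1 ≤ s t) (hg : ∀ t, 0 ≤ g t) (hφ : φs ≤ φ T)
    (h : ∀ t < T, φ (t + 1) ≤ φ t - s t * ρ * (g t / 4 - E)) :
    (⨅ t : Fin T, g t) ≤ 4 * ((φ 0 - φs) / ((∑ t ∈ Finset.range T, s t) * ρ) + E) := by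
  set m := ⨅ t : Fin T, g t
  have hm : ∀ t < T, m ≤ g t := fun t ht =>
    ciInf_le (f := fun t : Fin T => g t) ⟨0, by rintro _ ⟨t, rfl⟩; exact hg t⟩ ⟨t, ht⟩
  have hsum : ∀ n ≤ T, φ n ≤ φ 0 - (∑ t ∈ Finset.range n, s t) * ρ * (m / 4 - E) := by
    intro n hn
    induction n with
    | zero => simp
    | succ n ih =>
      rw [Finset.sum_range_succ]
      have h1 := ih (by omega)
      have h2 := h n (by omega)
      have h3 : s n * ρ * (m / 4 - E) ≤ s n * ρ * (g n / 4 - E) := by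
        have := hs n
        have := hm n (by omega)
        gcongr
      linarith
  have hS : 0 < (∑ t ∈ Finset.range T, s t) * ρ := by
    refine mul_pos (Finset.sum_pos (fun t _ => by linarith [hs t]) ?_) hρ
    exact ⟨0, Finset.mem_range.2 (by omega)⟩
  have h4 := hsum T le_rfl
  have h5 : m / 4 - E ≤ (φ 0 - φs) / ((∑ t ∈ Finset.range T, s t) * ρ) := by
    rw [le_div_iff₀ hS]; linarith
  linarith

/-! ### The law of the transcript -/

lemma measurable_measure_pi {ι α β : Type*} [Fintype ι] [MeasurableSpace α] [MeasurableSpace β]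
    {κ : ι → α → Measure β} (hκ : ∀ i, Measurable (κ i))
    [∀ i a, IsProbabilityMeasure (κ i a)] :
    Measurable fun a => Measure.pi fun i => κ i a := by
  refine Measurable.measure_of_isPiSystem_of_isProbabilityMeasure generateFrom_pi.symm isPiSystem_pi ?_
  rintro _ ⟨t, ht, rfl⟩
  simp only [Set.mem_pi, Set.mem_univ, true_implies, Set.mem_ofPred_eq] at ht
  simp_rw [Measure.pi_pi]
  exact Finset.measurable_prod _ fun i _ => (Measure.measurable_coe (ht i)).comp (hκ i)

lemma measurable_measure_prod {α β γ : Type*} [MeasurableSpace α] [MeasurableSpace β]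
    [MeasurableSpace γ] {μ : α → Measure β} {ν : α → Measure γ} (hμ : Measurable μ)
    (hν : Measurable ν) [∀ a, IsProbabilityMeasure (μ a)] [∀ a, IsProbabilityMeasure (ν a)] :
    Measurable fun a => (μ a).prod (ν a) := by
  refine Measurable.measure_of_isPiSystem_of_isProbabilityMeasure generateFrom_prod.symm
    isPiSystem_prod ?_
  rintro _ ⟨s, hs, t, ht, rfl⟩
  simp only [Set.mem_ofPred_eq] at hs ht
  simp_rw [Measure.prod_prod]
  exact ((Measure.measurable_coe hs).comp hμ).mul ((Measure.measurable_coe ht).comp hν)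

section Transcript

variable {d M : ℕ} {step : (Fin M → Vec d) → ℝ} {w0 : Vec d}

lemma measurable_model (hstep : Measurable step) (t : ℕ) :
    Measurable fun c : ℕ → Fin M → Vec d => model step w0 c t := by
  induction t with
  | zero => exact measurable_const
  | succ t ih =>
    exact ih.add ((hstep.comp (measurable_pi_apply t)).smul
      (measurable_mean.comp (measurable_pi_apply t)))

lemma model_update_of_le (c : ℕ → Fin M → Vec d) {s t : ℕ} (h : s ≤ t) (x : Fin M → Vec d) :
    model step w0 (Function.update c t x) s = model step w0 c s := by
  induction s with
  | zero => rfl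
  | succ s ih =>
    simp only [model]
    rw [ih (by omega), Function.update_of_ne (by omega)]

variable {f : Fin M → Vec d → ℝ} {η C : ℝ} {τ : ℕ} {R : Vec d → Measure (Vec d)}

lemma measurable_round (hstep : Measurable step)
    (hR : ∀ i, Measurable fun w => R (localUpdate (f i) η τ C w))
    (hprob : ∀ i w, IsProbabilityMeasure (R (localUpdate (f i) η τ C w))) (t : ℕ) :
    Measurable fun c : ℕ → Fin M → Vec d =>
      (Measure.pi fun i => R (localUpdate (f i) η τ C (model step w0 c t))).map
        (Function.update c t) := by
  have h1 := measurable_measure_pi (κ := fun i (c : ℕ → Fin M → Vec d) =>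
    R (localUpdate (f i) η τ C (model step w0 c t)))
    fun i => (hR i).comp (measurable_model hstep t)
  have h2 := measurable_measure_prod (Measure.measurable_dirac (α := ℕ → Fin M → Vec d)) h1
  have hm : Measurable fun p : (ℕ → Fin M → Vec d) × (Fin M → Vec d) =>
      Function.update p.1 t p.2 := by
    rw [measurable_pi_iff]
    intro s
    rcases eq_or_ne s t with rfl | h
    · simpa using measurable_snd
    · simp only [Function.update_of_ne h]
      exact (measurable_pi_apply s).comp measurable_fst
  have h3 := (Measure.measurable_map _ hm).comp h2
  convert h3 using 1
  ext1 c
  simp only [Function.comp]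
  rw [Measure.dirac_prod, Measure.map_map hm (by fun_prop)]
  rfl

lemma isProbabilityMeasure_transcriptLaw (hstep : Measurable step)
    (hR : ∀ i, Measurable fun w => R (localUpdate (f i) η τ C w))
    (hprob : ∀ i w, IsProbabilityMeasure (R (localUpdate (f i) η τ C w))) (T : ℕ) :
    IsProbabilityMeasure (transcriptLaw f η τ C R step w0 T) := by
  induction T with
  | zero => exact inferInstanceAs (IsProbabilityMeasure (Measure.dirac 0))
  | succ T ih =>
    refine ⟨?_⟩
    rw [transcriptLaw, Measure.bind_apply .univ (measurable_round hstep hR hprob T).aemeasurable]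
    have : ∀ c : ℕ → Fin M → Vec d,
        ((Measure.pi fun i => R (localUpdate (f i) η τ C (model step w0 c T))).map
        (Function.update c T)) Set.univ = 1 := by
      intro c
      rw [Measure.map_apply (measurable_update c) .univ]
      simp
    simp [this]

/-- A union bound over the rounds: an event that has probability at most `δ` in each round, given
the model at the start of the round, occurs in some round with probability at most `T δ`. -/
lemma transcriptLaw_exists_le (hstep : Measurable step)
    (hR : ∀ i, Measurable fun w => R (localUpdate (f i) η τ C w))
    (hprob : ∀ i w, IsProbabilityMeasure (R (localUpdate (f i) η τ C w)))
    {B : Set (Vec d × (Fin M → Vec d))} (hB : MeasurableSet B) {δ : ENNReal}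
    (hδ : ∀ w, (Measure.pi fun i => R (localUpdate (f i) η τ C w)) {x | (w, x) ∈ B} ≤ δ) (T : ℕ) :
    transcriptLaw f η τ C R step w0 T {c | ∃ t < T, (model step w0 c t, c t) ∈ B} ≤ T * δ := by
  have hmeas : ∀ T, MeasurableSet {c : ℕ → Fin M → Vec d |
      ∃ t < T, (model step w0 c t, c t) ∈ B} := by
    intro T
    have : {c : ℕ → Fin M → Vec d | ∃ t < T, (model step w0 c t, c t) ∈ B}
        = ⋃ t ∈ Finset.range T, {c | (model step w0 c t, c t) ∈ B} := by
      ext; simp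
    rw [this]
    exact Finset.measurableSet_biUnion _ fun t _ =>
      ((measurable_model hstep t).prodMk (measurable_pi_apply t)) hB
  induction T with
  | zero => simp
  | succ T ih =>
    have := isProbabilityMeasure_transcriptLaw (w0 := w0) hstep hR hprob T
    rw [transcriptLaw, Measure.bind_apply (hmeas _)
      (measurable_round hstep hR hprob T).aemeasurable]
    set A := {c : ℕ → Fin M → Vec d | ∃ t < T, (model step w0 c t, c t) ∈ B} with hA
    have hle : ∀ c : ℕ → Fin M → Vec d,
        ((Measure.pi fun i => R (localUpdate (f i) η τ C (model step w0 c T))).map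
        (Function.update c T)) {c | ∃ t < T + 1, (model step w0 c t, c t) ∈ B}
        ≤ A.indicator 1 c + δ := by
      intro c
      rw [Measure.map_apply (measurable_update c) (hmeas _)]
      by_cases hc : c ∈ A
      · rw [Set.indicator_of_mem hc]
        exact prob_le_one.trans (by simp)
      · rw [Set.indicator_of_notMem hc, zero_add]
        refine (measure_mono ?_).trans (hδ (model step w0 c T))
        rintro x ⟨t, ht, hx⟩
        rw [model_update_of_le c (by omega)] at hx
        rcases eq_or_ne t T with rfl | h
        · simpa using hx
        · rw [Function.update_of_ne h] at hx
          exact absurd ⟨t, by omega, hx⟩ hc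
    refine (lintegral_mono hle).trans ?_
    rw [lintegral_add_right _ measurable_const, lintegral_indicator_one (hmeas T),
      lintegral_const, measure_univ, mul_one]
    push_cast
    rw [add_mul, one_mul]
    gcongr

end Transcript

/-- Conditions on one round (a bound on the averaged noise and an upper bound for the estimate
`a` of the mean square of the updates, both with high probability) which imply the convergence
of the algorithm with step size `1 ∨ a / ‖c̄‖²`. -/
lemma convergence_of_round_bounds {d M τ T : ℕ} (hM : 0 < M) (hτ : 1 ≤ τ) (hT : 1 ≤ T)
    {f : Fin M → Vec d → ℝ} {L G σg η κ N N' Fstar : ℝ} (hA : ClientAssumptions f L G σg)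
    (hF : IsGLB (Set.range (objective f)) Fstar) (hκ : 0 < κ)
    (hη1 : κ / (L * τ) ≤ η) (hη2 : η < 1 / (24 * L * τ)) (hN' : 0 ≤ N')
    {a : (Fin M → Vec d) → ℝ} (ha : Measurable a) {R : Vec d → Measure (Vec d)}
    (hR : ∀ h : Vec d → Vec d, Measurable h → (∀ w, ‖h w‖ ≤ η * τ * G) →
      Measurable fun w => R (h w))
    (hprob : ∀ Δ, ‖Δ‖ ≤ η * τ * G → IsProbabilityMeasure (R Δ)) {δ : ℝ} (hδ : 0 ≤ δ)
    (hmean : ∀ Δ : Fin M → Vec d, (∀ i, ‖Δ i‖ ≤ η * τ * G) →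
      (Measure.pi fun i => R (Δ i)) {x | N < ‖mean x - mean Δ‖ ^ 2} ≤ ENNReal.ofReal δ)
    (hsq : ∀ Δ : Fin M → Vec d, (∀ i, ‖Δ i‖ ≤ η * τ * G) →
      (Measure.pi fun i => R (Δ i)) {x | 2 * average (fun i => ‖Δ i‖ ^ 2) + N' < a x}
        ≤ ENNReal.ofReal δ)
    {step : (Fin M → Vec d) → ℝ} (hstep : step = fun c => max 1 (a c / ‖mean c‖ ^ 2))
    (w0 : Vec d) {bound : (ℕ → Fin M → Vec d) → ℝ}
    (hbound : ∀ m : ℕ → Fin M → Vec d,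
      4 * ((objective f w0 - Fstar) / ((∑ t ∈ Finset.range T, step (m t)) * (η * τ))
        + (5 * (η * L * τ * σg ^ 2) + L / (η * τ) * ((2 / κ + 1) * (N + N')))) ≤ bound m) :
    1 - T * (2 * δ) ≤ (transcriptLaw f η τ (η * τ * G) R step w0 T).real
      {m | (⨅ t : Fin T, ‖gradient (objective f) (model step w0 m t)‖ ^ 2) ≤ bound m} := by
  have hL := hA.L_pos
  have hτ' : (0 : ℝ) < τ := by exact_mod_cast hτ
  have hη : 0 < η := lt_of_lt_of_le (by positivity) hη1
  have hstepm : Measurable step := by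
    rw [hstep]
    exact measurable_const.max (ha.div ((measurable_mean.norm).pow_const 2))
  have hU : ∀ i w, localUpdate (f i) η τ (η * τ * G) w = localIterate (f i) η w τ - w :=
    fun i w => localUpdate_eq hη.le (hA.lipschitz i) τ w
  have hUle : ∀ i w, ‖localUpdate (f i) η τ (η * τ * G) w‖ ≤ η * τ * G := fun i w => by
    rw [hU]; exact norm_localIterate_sub_le_of_lipschitz hη.le (hA.lipschitz i) w τ
  have hUm : ∀ i, Measurable fun w => localUpdate (f i) η τ (η * τ * G) w := fun i => by
    simp_rw [hU]
    exact ((continuous_localIterate (continuous_gradient_of_lipschitz (hA.smooth i)) τ).sub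
      continuous_id).measurable
  have hRm := fun i => hR _ (hUm i) (hUle i)
  have hRp := fun i w => hprob _ (hUle i w)
  set U : Vec d → Fin M → Vec d := fun w i => localUpdate (f i) η τ (η * τ * G) w with hUdef
  set B : Set (Vec d × (Fin M → Vec d)) := {p | N < ‖mean p.2 - mean (U p.1)‖ ^ 2}
    ∪ {p | 2 * average (fun i => ‖U p.1 i‖ ^ 2) + N' < a p.2} with hBdef
  have hUm' : Measurable fun p : Vec d × (Fin M → Vec d) => U p.1 :=
    measurable_pi_iff.2 fun i => (hUm i).comp measurable_fst
  have hB : MeasurableSet B := by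
    refine MeasurableSet.union (measurableSet_lt measurable_const ?_)
      (measurableSet_lt ?_ (ha.comp measurable_snd))
    · exact (((measurable_mean.comp measurable_snd).sub
        (measurable_mean.comp hUm')).norm).pow_const 2
    · exact (((Finset.measurable_fun_sum Finset.univ fun i _ =>
        (((hUm i).comp measurable_fst).norm.pow_const 2)).const_mul _).const_mul 2).add_const N'
  have hBδ : ∀ w, (Measure.pi fun i => R (localUpdate (f i) η τ (η * τ * G) w)) {x | (w, x) ∈ B}
      ≤ ENNReal.ofReal (2 * δ) := by
    intro w
    have : {x | (w, x) ∈ B} = {x | N < ‖mean x - mean (U w)‖ ^ 2}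
      ∪ {x | 2 * average (fun i => ‖U w i‖ ^ 2) + N' < a x} := rfl
    rw [this, two_mul δ, ENNReal.ofReal_add hδ hδ]
    exact (measure_union_le _ _).trans (add_le_add (hmean _ fun i => hUle i w)
      (hsq _ fun i => hUle i w))
  have hbad := transcriptLaw_exists_le (w0 := w0) hstepm hRm hRp hB hBδ T
  have := isProbabilityMeasure_transcriptLaw (w0 := w0) hstepm hRm hRp T
  set P := transcriptLaw f η τ (η * τ * G) R step w0 T
  set bad := {c : ℕ → Fin M → Vec d | ∃ t < T, (model step w0 c t, c t) ∈ B}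
  have hbadr : P.real bad ≤ T * (2 * δ) := by
    rw [measureReal_def]
    refine ENNReal.toReal_le_of_le_ofReal (by positivity) (hbad.trans (le_of_eq ?_))
    rw [ENNReal.ofReal_mul (p := (T : ℝ)) (by positivity), ENNReal.ofReal_natCast]
  have hcompl : 1 - P.real bad ≤ P.real badᶜ := by
    have h := measureReal_union_le (μ := P) bad badᶜ
    rw [Set.union_compl_self, probReal_univ] at h
    linarith
  refine (sub_le_sub_left hbadr 1).trans (hcompl.trans (measureReal_mono ?_))
  intro c hc
  have hgood : ∀ t < T, ‖mean (c t) - mean (U (model step w0 c t))‖ ^ 2 ≤ N ∧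
      a (c t) ≤ 2 * average (fun i => ‖U (model step w0 c t) i‖ ^ 2) + N' := by
    intro t ht
    have h : (model step w0 c t, c t) ∉ B := fun h => hc ⟨t, ht, h⟩
    rw [hBdef, Set.mem_union, not_or] at h
    exact ⟨not_lt.1 h.1, not_lt.1 h.2⟩
  refine le_trans ?_ (hbound c)
  refine iInf_le_of_descent (φ := fun t => objective f (model step w0 c t))
    (g := fun t => ‖gradient (objective f) (model step w0 c t)‖ ^ 2) (s := fun t => step (c t)) hT
    (by positivity) (fun t => ?_) (fun t => sq_nonneg _) (hF.1 ⟨_, rfl⟩) fun t ht => ?_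
  · rw [hstep]; exact le_max_left _ _
  · have h := objective_step_le hM hτ hA hκ hη1 hη2 hN' (model step w0 c t) (mean (c t))
      (hgood t ht).1 (hgood t ht).2
    simp only [model]
    convert h using 3 <;> rw [hstep]

/-! ### Concentration for independent messages -/

section Concentration

lemma lintegral_pi_fin_succ {n : ℕ} {β : Type*} [MeasurableSpace β] (μ : Fin (n + 1) → Measure β)
    [∀ i, SigmaFinite (μ i)] {F : (Fin (n + 1) → β) → ENNReal} (hF : Measurable F) :
    ∫⁻ x, F x ∂Measure.pi μ
      = ∫⁻ a, ∫⁻ y, F (Fin.cons a y) ∂(Measure.pi fun i => μ i.succ) ∂μ 0 := by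
  have h := (measurePreserving_piFinSuccAbove μ 0).symm
  rw [← h.lintegral_comp hF, lintegral_prod]
  · simp [MeasurableEquiv.piFinSuccAbove, Fin.insertNthEquiv]
  · exact (hF.comp h.measurable).aemeasurable

lemma lintegral_pi_prod {n : ℕ} {β : Type*} [MeasurableSpace β] (μ : Fin n → Measure β)
    [∀ i, SigmaFinite (μ i)] {F : Fin n → β → ENNReal} (hF : ∀ i, Measurable (F i)) :
    ∫⁻ x, ∏ i, F i (x i) ∂Measure.pi μ = ∏ i, ∫⁻ a, F i a ∂μ i := by
  induction n with
  | zero => simp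
  | succ n ih =>
    rw [lintegral_pi_fin_succ μ (by fun_prop), Fin.prod_univ_succ]
    simp_rw [Fin.prod_univ_succ, Fin.cons_zero, Fin.cons_succ]
    have h : ∀ a, ∫⁻ y, F 0 a * ∏ i : Fin n, F i.succ (y i) ∂(Measure.pi fun i => μ i.succ)
        = F 0 a * ∏ i : Fin n, ∫⁻ a, F i.succ a ∂μ i.succ := by
      intro a
      rw [lintegral_const_mul _ (by fun_prop), ih (fun i => μ i.succ) fun i => hF i.succ]
    simp_rw [h]
    rw [lintegral_mul_const _ (hF 0)]

/-- The Chernoff bound. -/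
lemma measure_lt_le_of_lintegral_exp {α : Type*} [MeasurableSpace α] {μ : Measure α} {Y : α → ℝ}
    (hY : Measurable Y) {b : ℝ} (h : ∫⁻ x, ENNReal.ofReal (Real.exp (Y x)) ∂μ
      ≤ ENNReal.ofReal (Real.exp b)) (t : ℝ) :
    μ {x | b + t < Y x} ≤ ENNReal.ofReal (Real.exp (-t)) := by
  have h1 := mul_meas_ge_le_lintegral (μ := μ) (f := fun x => ENNReal.ofReal (Real.exp (Y x)))
    (by fun_prop) (ENNReal.ofReal (Real.exp (b + t)))
  have h2 : μ {x | b + t < Y x}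
      ≤ μ {x | ENNReal.ofReal (Real.exp (b + t)) ≤ ENNReal.ofReal (Real.exp (Y x))} :=
    measure_mono fun x hx => ENNReal.ofReal_le_ofReal (Real.exp_le_exp.2 (le_of_lt hx))
  have h3 : ENNReal.ofReal (Real.exp (b + t)) * μ {x | b + t < Y x}
      ≤ ENNReal.ofReal (Real.exp (b + t)) * ENNReal.ofReal (Real.exp (-t)) := by
    rw [← ENNReal.ofReal_mul (Real.exp_pos _).le, ← Real.exp_add]
    rw [show b + t + -t = b by ring]
    exact (mul_le_mul_right h2 _).trans (h1.trans h)
  exact (ENNReal.mul_le_mul_iff_right (by simp [Real.exp_pos]) (by simp)).1 h3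

variable {d n : ℕ}

/-- If one step `s ↦ s + (x - m)` maps the potential `exp (‖s‖² / (2 D (A + 1)))` to at most
`exp (c / A) exp (‖s‖² / (2 D A))` in expectation, then these bounds telescope over independent
summands. There is no union bound over coordinates, so that the result depends on the dimension
only through `c`. -/
lemma lintegral_exp_norm_add_sum_le {D c : ℝ} (hc : 0 ≤ c)
    (μ : Fin n → Measure (Vec d)) [∀ i, IsProbabilityMeasure (μ i)] (m : Fin n → Vec d)
    (h : ∀ i s A, 0 < A → ∫⁻ x, ENNReal.ofReal (Real.exp (‖s + (x - m i)‖ ^ 2 / (2 * D * (A + 1))))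
      ∂μ i ≤ ENNReal.ofReal (Real.exp (c / A + ‖s‖ ^ 2 / (2 * D * A))))
    (s : Vec d) {A : ℝ} (hA : 0 < A) :
    ∫⁻ x, ENNReal.ofReal (Real.exp (‖s + ∑ i, (x i - m i)‖ ^ 2 / (2 * D * (A + n))))
      ∂Measure.pi μ ≤ ENNReal.ofReal (Real.exp (n * c / A + ‖s‖ ^ 2 / (2 * D * A))) := by
  induction n generalizing s A with
  | zero => simp
  | succ n ih =>
    rw [lintegral_pi_fin_succ μ (by fun_prop)]
    simp_rw [Fin.sum_univ_succ, Fin.cons_zero, Fin.cons_succ, ← add_assoc]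
    have h1 : ∀ a, ∫⁻ y : Fin n → Vec d, ENNReal.ofReal (Real.exp (‖s + (a - m 0) +
        ∑ i, (y i - m i.succ)‖ ^ 2 / (2 * D * (A + ((n + 1 : ℕ) : ℝ)))))
          ∂(Measure.pi fun i => μ i.succ)
        ≤ ENNReal.ofReal (Real.exp (n * c / A))
          * ENNReal.ofReal (Real.exp (‖s + (a - m 0)‖ ^ 2 / (2 * D * (A + 1)))) := by
      intro a
      have := ih (fun i => μ i.succ) (fun i => m i.succ) (fun i => h i.succ) (s + (a - m 0))
        (A := A + 1) (by positivity)
      rw [show A + 1 + (n : ℝ) = A + ((n + 1 : ℕ) : ℝ) by push_cast; ring] at this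
      refine this.trans ?_
      rw [← ENNReal.ofReal_mul (Real.exp_pos _).le, ← Real.exp_add]
      gcongr
      linarith
    refine (lintegral_mono h1).trans ?_
    rw [lintegral_const_mul _ (by fun_prop)]
    refine (mul_le_mul_right (h 0 s A hA) _).trans (le_of_eq ?_)
    rw [← ENNReal.ofReal_mul (Real.exp_pos _).le, ← Real.exp_add]
    congr 2
    push_cast
    ring

lemma measure_norm_mean_sub_le {M : ℕ} (hM : 0 < M) {D c : ℝ} (hD : 0 < D) (hc : 0 ≤ c)
    (μ : Fin M → Measure (Vec d)) [∀ i, IsProbabilityMeasure (μ i)] (m : Fin M → Vec d)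
    (h : ∀ i s A, 0 < A → ∫⁻ x, ENNReal.ofReal (Real.exp (‖s + (x - m i)‖ ^ 2 / (2 * D * (A + 1))))
      ∂μ i ≤ ENNReal.ofReal (Real.exp (c / A + ‖s‖ ^ 2 / (2 * D * A)))) (t : ℝ) :
    Measure.pi μ {x | 4 * D * (c + t) / M < ‖mean x - mean m‖ ^ 2}
      ≤ ENNReal.ofReal (Real.exp (-t)) := by
  have hM' : (0 : ℝ) < M := by positivity
  have h1 := lintegral_exp_norm_add_sum_le hc μ m h 0 hM'
  have h2 : (M : ℝ) * c / M + ‖(0 : Vec d)‖ ^ 2 / (2 * D * M) = c := by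
    simp; field_simp
  rw [h2] at h1
  refine le_trans (measure_mono ?_) (measure_lt_le_of_lintegral_exp (by fun_prop) h1 t)
  intro x hx
  have h3 : mean x - mean m = (1 / (M : ℝ)) • (0 + ∑ i, (x i - m i)) := by
    rw [← mean_sub, zero_add]; rfl
  simp only [Set.mem_ofPred_eq] at hx ⊢
  rw [h3, norm_smul, mul_pow, Real.norm_of_nonneg (by positivity)] at hx
  rw [lt_div_iff₀ (by positivity)]
  rw [div_lt_iff₀ hM'] at hx
  have h4 : (1 / (M : ℝ)) ^ 2 * ‖0 + ∑ i, (x i - m i)‖ ^ 2 * M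
      = ‖0 + ∑ i, (x i - m i)‖ ^ 2 / M := by field_simp
  rw [h4, lt_div_iff₀ hM'] at hx
  linarith

end Concentration

/-! ### The Gaussian mechanism -/

section Gaussian

open ProbabilityTheory

lemma lintegral_exp_sq_gaussianReal {a σ : ℝ} (h : 2 * a * σ ^ 2 < 1) (s : ℝ) :
    ∫⁻ g, ENNReal.ofReal (Real.exp (a * (s + σ * g) ^ 2)) ∂gaussianReal 0 1
      = ENNReal.ofReal (√(1 / (1 - 2 * a * σ ^ 2))
          * Real.exp (a * (1 / (1 - 2 * a * σ ^ 2)) * s ^ 2)) := by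
  set u := 1 - 2 * a * σ ^ 2 with hu
  have hu0 : 0 < u := by rw [hu]; linarith
  set v : NNReal := ⟨1 / u, by positivity⟩ with hv
  have hvr : (v : ℝ) = 1 / u := rfl
  have hv0 : v ≠ 0 := by
    rw [← NNReal.coe_ne_zero, hvr]; positivity
  rw [gaussianReal_of_var_ne_zero _ one_ne_zero,
    lintegral_withDensity_eq_lintegral_mul _ (measurable_gaussianPDF _ _) (by fun_prop)]
  -- completing the square turns the integrand into a multiple of another Gaussian density
  have key : ∀ g, (gaussianPDF 0 1 * fun g => ENNReal.ofReal (Real.exp (a * (s + σ * g) ^ 2))) g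
      = ENNReal.ofReal (√(1 / u) * Real.exp (a * (1 / u) * s ^ 2))
        * gaussianPDF (2 * a * σ * s / u) v g := by
    intro g
    rw [Pi.mul_apply, gaussianPDF, gaussianPDF, ← ENNReal.ofReal_mul (gaussianPDFReal_nonneg _ _ _),
      ← ENNReal.ofReal_mul (by positivity)]
    congr 1
    simp only [gaussianPDFReal, hvr, NNReal.coe_one]
    have h1 : √(2 * Real.pi * (1 / u)) = √(2 * Real.pi) * √(1 / u) :=
      Real.sqrt_mul (by positivity) _
    have h2 : 0 < √(1 / u) := by positivity
    rw [h1, mul_assoc, ← Real.exp_add]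
    have h3 : ∀ x y : ℝ, √(1 / u) * Real.exp x * ((√(2 * Real.pi) * √(1 / u))⁻¹ * Real.exp y)
        = (√(2 * Real.pi))⁻¹ * Real.exp (x + y) := by
      intro x y
      rw [Real.exp_add]
      field_simp
    rw [h3, mul_one]
    congr 2
    field_simp
    rw [hu]
    ring
  simp_rw [key]
  rw [lintegral_const_mul _ (measurable_gaussianPDF _ _), lintegral_gaussianPDF_eq_one _ hv0,
    mul_one]

lemma lintegral_exp_norm_sq_stdGaussian {d : ℕ} {a σ : ℝ} (h : 2 * a * σ ^ 2 < 1) (s : Vec d) :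
    ∫⁻ ε, ENNReal.ofReal (Real.exp (a * ‖s + σ • ε‖ ^ 2)) ∂stdGaussian (Vec d)
      = ENNReal.ofReal (√(1 / (1 - 2 * a * σ ^ 2)) ^ d
          * Real.exp (a * (1 / (1 - 2 * a * σ ^ 2)) * ‖s‖ ^ 2)) := by
  rw [← map_pi_eq_stdGaussian, lintegral_map (by fun_prop) (by fun_prop)]
  have h1 : ∀ x : Fin d → ℝ,
      ENNReal.ofReal (Real.exp (a * ‖s + σ • (WithLp.toLp 2 x : Vec d)‖ ^ 2))
        = ∏ i, ENNReal.ofReal (Real.exp (a * (s i + σ * x i) ^ 2)) := by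
    intro x
    rw [← ENNReal.ofReal_prod_of_nonneg fun i _ => (Real.exp_pos _).le, ← Real.exp_sum,
      EuclideanSpace.real_norm_sq_eq, Finset.mul_sum]
    simp
  simp_rw [h1]
  rw [lintegral_pi_prod (fun _ : Fin d => gaussianReal 0 1)
    (F := fun i g => ENNReal.ofReal (Real.exp (a * (s i + σ * g) ^ 2))) fun i => by fun_prop]
  simp_rw [lintegral_exp_sq_gaussianReal h]
  rw [← ENNReal.ofReal_prod_of_nonneg fun i _ => by positivity, Finset.prod_mul_distrib,
    Finset.prod_const, Finset.card_univ, Fintype.card_fin, ← Real.exp_sum, ← Finset.mul_sum,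
    ← EuclideanSpace.real_norm_sq_eq]

variable {d M : ℕ} {σ : ℝ}

instance isProbabilityMeasure_gaussianMechanism (Δ : Vec d) :
    IsProbabilityMeasure (gaussianMechanism σ Δ) :=
  Measure.isProbabilityMeasure_map (by fun_prop)

lemma measurable_gaussianMechanism : Measurable (gaussianMechanism σ : Vec d → Measure (Vec d)) := by
  have h1 : Measurable fun Δ : Vec d => (Measure.dirac Δ).prod (stdGaussian (Vec d)) :=
    measurable_measure_prod Measure.measurable_dirac measurable_const
  have hm : Measurable fun p : Vec d × Vec d => p.1 + σ • p.2 := by fun_prop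
  convert (Measure.measurable_map _ hm).comp h1 using 1
  ext1 Δ
  simp only [Function.comp]
  rw [Measure.dirac_prod, Measure.map_map hm (by fun_prop)]
  rfl

lemma gaussianMechanism_mean (hM : 0 < M) (hσ : 0 < σ) (Δ : Fin M → Vec d) {t : ℝ}
    (ht : 1 ≤ t) :
    Measure.pi (fun i => gaussianMechanism σ (Δ i))
      {x | 6 * σ ^ 2 * t * (d / M) < ‖mean x - mean Δ‖ ^ 2} ≤ ENNReal.ofReal (Real.exp (-t)) := by
  rcases Nat.eq_zero_or_pos d with rfl | hd
  · have : {x : Fin M → Vec 0 | 6 * σ ^ 2 * t * (((0 : ℕ) : ℝ) / M) < ‖mean x - mean Δ‖ ^ 2} = ∅ := by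
      ext x
      simp [Subsingleton.elim (mean x - mean Δ) 0]
    rw [this]; simp
  have hM' : (0 : ℝ) < M := by positivity
  have hd' : (1 : ℝ) ≤ d := by exact_mod_cast hd
  refine (measure_mono ?_).trans (measure_norm_mean_sub_le hM (D := σ ^ 2) (c := d / 2)
    (by positivity) (by positivity) (fun i => gaussianMechanism σ (Δ i)) Δ ?_ t)
  · intro x hx
    simp only [Set.mem_ofPred_eq] at hx ⊢
    refine lt_of_le_of_lt ?_ hx
    have h1 : (0 : ℝ) ≤ 6 * d * t - 4 * (d / 2 + t) := by nlinarith
    have h2 := mul_nonneg (sq_nonneg σ) h1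
    rw [← mul_div_assoc]
    exact div_le_div_of_nonneg_right (by linarith) hM'.le
  · intro i s A hA
    rw [gaussianMechanism, lintegral_map (by fun_prop) (by fun_prop)]
    simp only [add_sub_cancel_left, div_eq_inv_mul _ (2 * σ ^ 2 * (A + 1))]
    have e : 2 * (2 * σ ^ 2 * (A + 1))⁻¹ * σ ^ 2 = 1 / (A + 1) := by field_simp
    have e2 : 1 / (1 - 1 / (A + 1)) = (A + 1) / A := by
      rw [one_sub_div (by positivity), add_sub_cancel_right, one_div_div]
    rw [lintegral_exp_norm_sq_stdGaussian (by rw [e, div_lt_one (by positivity)]; linarith), e, e2]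
    refine ENNReal.ofReal_le_ofReal ?_
    rw [Real.exp_add]
    have e3 : (2 * σ ^ 2 * (A + 1))⁻¹ * ((A + 1) / A) * ‖s‖ ^ 2 = ‖s‖ ^ 2 / (2 * σ ^ 2 * A) := by
      field_simp
    rw [e3]
    gcongr
    have e4 : √((A + 1) / A) ≤ Real.exp (1 / A / 2) := by
      rw [Real.exp_half]
      apply Real.sqrt_le_sqrt
      rw [add_div, div_self hA.ne', add_comm]
      exact Real.add_one_le_exp _
    calc √((A + 1) / A) ^ d ≤ Real.exp (1 / A / 2) ^ d := by gcongr
      _ = Real.exp (d / 2 / A) := by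
        rw [← Real.exp_nat_mul]; congr 1; ring

lemma one_div_one_sub_le_exp {y : ℝ} (h0 : 0 ≤ y) (h1 : y ≤ 1 / 4) :
    1 / (1 - y) ≤ Real.exp (y + y ^ 2) := by
  rw [div_le_iff₀ (by linarith)]
  have h2 := Real.quadratic_le_exp_of_nonneg (x := y + y ^ 2) (by positivity)
  have h3 : 1 ≤ (1 + (y + y ^ 2) + (y + y ^ 2) ^ 2 / 2) * (1 - y) := by
    nlinarith [pow_nonneg h0 2, pow_nonneg h0 3, pow_nonneg h0 4,
      mul_nonneg (pow_nonneg h0 2) (by linarith : 0 ≤ 1 / 4 - y),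
      mul_nonneg (pow_nonneg h0 3) (by linarith : 0 ≤ 1 / 4 - y),
      mul_nonneg (pow_nonneg h0 4) (by linarith : 0 ≤ 1 / 4 - y)]
  refine h3.trans ?_
  gcongr
  linarith

lemma gaussianMechanism_sq (hM : 0 < M) (hσ : 0 < σ) (Δ : Fin M → Vec d) {t : ℝ}
    (ht : 1 ≤ t) :
    Measure.pi (fun i => gaussianMechanism σ (Δ i))
      {x | 2 * average (fun i => ‖Δ i‖ ^ 2) + 16 * t * σ ^ 2 * √(d / M)
        < average (fun i => ‖x i‖ ^ 2) - d * σ ^ 2} ≤ ENNReal.ofReal (Real.exp (-t)) := by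
  rcases Nat.eq_zero_or_pos d with rfl | hd
  · have : {x : Fin M → Vec 0 | 2 * average (fun i => ‖Δ i‖ ^ 2) + 16 * t * σ ^ 2
        * √(((0 : ℕ) : ℝ) / M) < average (fun i => ‖x i‖ ^ 2) - ((0 : ℕ) : ℝ) * σ ^ 2} = ∅ := by
      ext x
      simp [Subsingleton.elim _ (0 : Vec 0), average]
    rw [this]; simp
  have hM1 : (1 : ℝ) ≤ M := by exact_mod_cast hM
  have hM' : (0 : ℝ) < M := by positivity
  have hd1 : (1 : ℝ) ≤ d := by exact_mod_cast hd
  have hd' : (0 : ℝ) < d := by positivity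
  set r := √((M : ℝ) * d) with hr
  have hr1 : 1 ≤ r := by
    rw [hr, Real.one_le_sqrt]; nlinarith
  have hr2 : r ^ 2 = M * d := Real.sq_sqrt (by positivity)
  have hrM : √((d : ℝ) / M) = r / M := by
    rw [hr, show (d : ℝ) / M = M * d / M ^ 2 by field_simp, Real.sqrt_div (by positivity),
      Real.sqrt_sq hM'.le]
  -- the exponent of the Chernoff bound is `l`; this `m` balances its two terms
  set m := 1 / (8 * r) with hm
  have hm0 : 0 < m := by positivity
  have hm1 : m ≤ 1 / 8 := by
    rw [hm]; apply one_div_le_one_div_of_le <;> linarith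
  set l := m / σ ^ 2 with hl
  have hlσ : 2 * l * σ ^ 2 = 2 * m := by rw [hl]; field_simp
  have hone : ∀ i, ∫⁻ x, ENNReal.ofReal (Real.exp (l * (‖x‖ ^ 2 - d * σ ^ 2 - 2 * ‖Δ i‖ ^ 2)))
      ∂gaussianMechanism σ (Δ i) ≤ ENNReal.ofReal (Real.exp (d * (2 * m ^ 2))) := by
    intro i
    rw [gaussianMechanism, lintegral_map (by fun_prop) (by fun_prop)]
    have h1 : ∀ ε : Vec d, ENNReal.ofReal (Real.exp (l * (‖Δ i + σ • ε‖ ^ 2 - d * σ ^ 2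
        - 2 * ‖Δ i‖ ^ 2))) = ENNReal.ofReal (Real.exp (-(d * m) - 2 * l * ‖Δ i‖ ^ 2))
          * ENNReal.ofReal (Real.exp (l * ‖Δ i + σ • ε‖ ^ 2)) := by
      intro ε
      rw [← ENNReal.ofReal_mul (Real.exp_pos _).le, ← Real.exp_add]
      congr 2
      linear_combination (-(d : ℝ) / 2) * hlσ
    simp_rw [h1]
    rw [lintegral_const_mul _ (by fun_prop), lintegral_exp_norm_sq_stdGaussian (by
      rw [hlσ]; linarith), hlσ, ← ENNReal.ofReal_mul (Real.exp_pos _).le]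
    refine ENNReal.ofReal_le_ofReal ?_
    have h2 := one_div_one_sub_le_exp (y := 2 * m) (by linarith) (by linarith)
    have h3 : √(1 / (1 - 2 * m)) ^ d ≤ Real.exp (d * (m + 2 * m ^ 2)) := by
      have : √(1 / (1 - 2 * m)) ≤ Real.exp (m + 2 * m ^ 2) := by
        rw [show m + 2 * m ^ 2 = (2 * m + (2 * m) ^ 2) / 2 by ring, Real.exp_half]
        exact Real.sqrt_le_sqrt h2
      calc _ ≤ Real.exp (m + 2 * m ^ 2) ^ d := by gcongr
        _ = _ := by rw [← Real.exp_nat_mul]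
    have h4 : 1 / (1 - 2 * m) ≤ 2 := by
      rw [div_le_iff₀ (by linarith)]; linarith
    have h5 : l * (1 / (1 - 2 * m)) * ‖Δ i‖ ^ 2 ≤ 2 * l * ‖Δ i‖ ^ 2 := by
      have hl0 : 0 ≤ l := by positivity
      have := mul_le_mul_of_nonneg_left h4 hl0
      have := mul_le_mul_of_nonneg_right this (sq_nonneg ‖Δ i‖)
      linarith
    calc _ ≤ Real.exp (-(d * m) - 2 * l * ‖Δ i‖ ^ 2)
          * (Real.exp (d * (m + 2 * m ^ 2)) * Real.exp (2 * l * ‖Δ i‖ ^ 2)) := by gcongr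
      _ = _ := by
        rw [← Real.exp_add, ← Real.exp_add]; congr 1; ring
  have hall : ∫⁻ x, ENNReal.ofReal (Real.exp (∑ i, l * (‖x i‖ ^ 2 - d * σ ^ 2 - 2 * ‖Δ i‖ ^ 2)))
      ∂Measure.pi (fun i => gaussianMechanism σ (Δ i)) ≤ ENNReal.ofReal (Real.exp (1 / 32)) := by
    simp_rw [Real.exp_sum, ENNReal.ofReal_prod_of_nonneg fun i _ => (Real.exp_pos _).le]
    rw [lintegral_pi_prod (fun i => gaussianMechanism σ (Δ i)) (F := fun i x =>
      ENNReal.ofReal (Real.exp (l * (‖x‖ ^ 2 - d * σ ^ 2 - 2 * ‖Δ i‖ ^ 2)))) fun i => by fun_prop]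
    refine (Finset.prod_le_prod' fun i _ => hone i).trans (le_of_eq ?_)
    rw [Finset.prod_const, Finset.card_univ, Fintype.card_fin, ← ENNReal.ofReal_pow
      (Real.exp_pos _).le, ← Real.exp_nat_mul]
    congr 2
    rw [hm, div_pow, mul_pow, hr2]
    field_simp
    norm_num
  refine (measure_mono ?_).trans (measure_lt_le_of_lintegral_exp (by fun_prop) hall t)
  intro x hx
  simp only [Set.mem_ofPred_eq] at hx ⊢
  have hsum : ∑ i, l * (‖x i‖ ^ 2 - d * σ ^ 2 - 2 * ‖Δ i‖ ^ 2)
      = l * M * (average (fun i => ‖x i‖ ^ 2) - d * σ ^ 2 - 2 * average (fun i => ‖Δ i‖ ^ 2)) := by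
    simp only [average, ← Finset.mul_sum, Finset.sum_sub_distrib, Finset.sum_const,
      Finset.card_univ, Fintype.card_fin, nsmul_eq_mul]
    field_simp
  rw [hsum]
  have h1 : l * M * (16 * t * σ ^ 2 * √(d / M)) = 2 * t := by
    rw [hrM, hl, hm]; field_simp; norm_num
  have h2 : 0 < l * M := by positivity
  have h3 := mul_lt_mul_of_pos_left (by linarith : 16 * t * σ ^ 2 * √(d / M)
    < average (fun i => ‖x i‖ ^ 2) - d * σ ^ 2 - 2 * average (fun i => ‖Δ i‖ ^ 2)) h2
  linarith

end Gaussian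

lemma two_mul_exp_le {q : ℝ} (hq : 1 ≤ q) :
    2 * Real.exp (-(2 * q ^ 2)) ≤ Real.exp (-1 * q ^ 2) := by
  have h1 : Real.exp (-(2 * q ^ 2)) = Real.exp (-1 * q ^ 2) * Real.exp (-q ^ 2) := by
    rw [← Real.exp_add]; congr 1; ring
  have h2 : Real.exp (-q ^ 2) ≤ 1 / 2 := by
    have h3 : (2 : ℝ) ≤ Real.exp (q ^ 2) := by
      have := Real.add_one_le_exp (q ^ 2)
      nlinarith
    rw [Real.exp_neg, ← one_div]
    exact one_div_le_one_div_of_le (by norm_num) h3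
  rw [h1]
  nlinarith [Real.exp_pos (-1 * q ^ 2)]

/-- The error bound of `convergence_of_round_bounds`, brought into the form of the theorem. The
term with `τ (τ - 1)` is only of lower order here, because `η L τ < 1` makes it smaller than
`η L τ σ_g²`. -/
lemma convergence_bound_le {L η κ σg K₀ K₁ N N' A S ν v b : ℝ} {τ : ℕ} (hτ : 1 ≤ τ) (hL : 0 < L)
    (hη : 0 < η) (hκ : 0 < κ) (hA : 0 ≤ A) (hS : 0 ≤ S) (hv : v = S * η * τ) (hN : N ≤ K₀ * ν * b)
    (hN' : N' ≤ K₁ * ν * b) (hK₀ : 0 ≤ K₀) (hK₁ : 0 ≤ K₁) (hν : 0 ≤ ν) (hb : 0 ≤ b) :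
    4 * (A / (S * (η * τ))
        + (5 * (η * L * τ * σg ^ 2) + L / (η * τ) * ((2 / κ + 1) * (N + N'))))
      ≤ (20 + 4 * (2 / κ + 1) * (K₀ + K₁)) * (A / v
        + η ^ 2 * L ^ 2 * τ * ((τ : ℝ) - 1) * σg ^ 2 + η * L * τ * σg ^ 2
        + L * ν / (η * τ) * b) := by
  have hτ' : (1 : ℝ) ≤ τ := by exact_mod_cast hτ
  have hτ0 : (0 : ℝ) < τ := by linarith
  set K := 4 * (2 / κ + 1) * (K₀ + K₁) with hK
  have hK0 : 0 ≤ K := by positivity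
  have h1 : A / (S * (η * τ)) = A / v := by rw [hv, mul_assoc]
  have h2 : 0 ≤ A / v := by rw [hv]; positivity
  have h3 : 0 ≤ η ^ 2 * L ^ 2 * τ * ((τ : ℝ) - 1) * σg ^ 2 := by
    have : 0 ≤ (τ : ℝ) - 1 := by linarith
    positivity
  have h4 : 0 ≤ η * L * τ * σg ^ 2 := by positivity
  have h5 : 0 ≤ L * ν / (η * τ) * b := by positivity
  have h6 : 4 * (L / (η * τ) * ((2 / κ + 1) * (N + N'))) ≤ K * (L * ν / (η * τ) * b) := by
    calc _ ≤ 4 * (L / (η * τ) * ((2 / κ + 1) * (K₀ * ν * b + K₁ * ν * b))) := by gcongr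
      _ = _ := by rw [hK]; ring
  rw [h1]
  have h7 := mul_nonneg hK0 h2
  have h8 := mul_nonneg hK0 h3
  have h9 := mul_nonneg hK0 h4
  linarith

/-- Convergence with the Gaussian mechanism: `N` is of order `q² σ² d / M`, and `N'` of order
`q² σ² √(d / M)`. -/
theorem gaussian_convergence : ∃ c : ℝ, 0 < c ∧ ∀ κ : ℝ, 0 < κ → ∃ K : ℝ, 0 < K ∧
      ∀ (d M τ T : ℕ) (f : Fin M → FedEXP.Vec d → ℝ) (L G σg Fstar η σ q : ℝ)
        (w0 : FedEXP.Vec d),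
        1 ≤ τ → 1 ≤ T →
        FedEXP.ClientAssumptions f L G σg →
        IsGLB (Set.range (FedEXP.objective f)) Fstar →
        κ / (L * τ) ≤ η → η < 1 / (24 * L * τ) →
        0 < σ → 1 ≤ q → q ≤ √(M : ℝ) →
        1 - T * Real.exp (-c * q ^ 2) ≤
          (FedEXP.transcriptLaw f η τ (η * τ * G) (FedEXP.gaussianMechanism σ)
              (FedEXP.gaussianStep σ) w0 T).real
            {m | (⨅ t : Fin T, ‖gradient (FedEXP.objective f)
                    (FedEXP.model (FedEXP.gaussianStep σ) w0 m t)‖ ^ 2) ≤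
                K * ((FedEXP.objective f w0 - Fstar) /
                      ((∑ t ∈ Finset.range T, FedEXP.gaussianStep σ (m t)) * η * τ)
                  + η ^ 2 * L ^ 2 * τ * ((τ : ℝ) - 1) * σg ^ 2
                  + η * L * τ * σg ^ 2
                  + L * σ ^ 2 * q ^ 2 / (η * τ) * ((d : ℝ) / M + √((d : ℝ) / M)))} := by
  refine ⟨1, one_pos, fun κ hκ => ⟨20 + 4 * (2 / κ + 1) * (12 + 32), by positivity, ?_⟩⟩
  intro d M τ T f L G σg Fstar η σ q w0 hτ hT hA hF hη1 hη2 hσ hq hqM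
  have hL := hA.L_pos
  have hτ' : (0 : ℝ) < τ := by exact_mod_cast hτ
  have hη : 0 < η := lt_of_lt_of_le (by positivity) hη1
  have hM : 0 < M := by
    rcases Nat.eq_zero_or_pos M with rfl | h
    · simp at hqM; linarith
    · exact h
  have ht : 1 ≤ 2 * q ^ 2 := by nlinarith
  refine le_trans ?_ (convergence_of_round_bounds (R := gaussianMechanism σ)
    (a := fun c => average (fun i => ‖c i‖ ^ 2) - d * σ ^ 2) (step := gaussianStep σ)
    hM hτ hT hA hF hκ hη1 hη2
    (N := 6 * σ ^ 2 * (2 * q ^ 2) * (d / M)) (N' := 16 * (2 * q ^ 2) * σ ^ 2 * √(d / M))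
    (by positivity) (by unfold average; fun_prop)
    (fun h hh _ => measurable_gaussianMechanism.comp hh) (fun Δ _ => inferInstance)
    (Real.exp_pos (-(2 * q ^ 2))).le (fun Δ _ => gaussianMechanism_mean hM hσ Δ ht)
    (fun Δ _ => gaussianMechanism_sq hM hσ Δ ht) rfl w0 (fun m => by
      have := convergence_bound_le (σg := σg) (K₀ := 12) (K₁ := 32) (κ := κ)
        (N := 6 * σ ^ 2 * (2 * q ^ 2) * (d / M)) (N' := 16 * (2 * q ^ 2) * σ ^ 2 * √(d / M))
        (A := objective f w0 - Fstar) (S := ∑ t ∈ Finset.range T, gaussianStep σ (m t))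
        (ν := σ ^ 2 * q ^ 2) (b := (d : ℝ) / M + √((d : ℝ) / M)) hτ hL hη hκ
        (sub_nonneg.2 (hF.1 ⟨_, rfl⟩))
        (Finset.sum_nonneg fun t _ => zero_le_one.trans (le_max_left _ _)) rfl
        (by
          have : 0 ≤ σ ^ 2 * q ^ 2 * √((d : ℝ) / M) := by positivity
          linarith)
        (by
          have : 0 ≤ σ ^ 2 * q ^ 2 * ((d : ℝ) / M) := by positivity
          linarith) (by norm_num) (by norm_num) (by positivity) (by positivity)
      rw [← mul_assoc L] at this
      exact this))
  have := mul_le_mul_of_nonneg_left (two_mul_exp_le hq) (by positivity : (0 : ℝ) ≤ T)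
  linarith

/-! ### ScalarDP -/

section Scalar

lemma exp_pos_sub_one {ε : ℝ} (h : 0 < ε) : 0 < Real.exp ε - 1 := by
  have := Real.add_one_lt_exp h.ne'
  linarith

lemma one_le_scalarK {ε : ℝ} : 1 ≤ scalarK ε :=
  Nat.one_le_ceil_iff.2 (Real.exp_pos _)

lemma scalarK_le {ε : ℝ} (h : 0 < ε) : (scalarK ε : ℝ) ≤ 2 * Real.exp (ε / 3) := by
  have h1 := Nat.ceil_lt_add_one (Real.exp_pos (ε / 3)).le
  have h2 : 1 ≤ Real.exp (ε / 3) := Real.one_le_exp (by positivity)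
  unfold scalarK
  linarith

lemma normC₁_pos {ε : ℝ} (h : 0 < ε) : 0 < normC₁ ε := by
  have := exp_pos_sub_one h
  unfold normC₁
  positivity

/-- An upper bound for `2 + 3 c₁`, uniform in `ε₂ ≥ κ`. -/
noncomputable def scalarBound (κ : ℝ) : ℝ := 2 + 9 * (Real.exp κ / (Real.exp κ - 1))

lemma normC₁_le {κ ε : ℝ} (hκ : 0 < κ) (h : κ ≤ ε) : 2 + 3 * normC₁ ε ≤ scalarBound κ := by
  have h0 : 0 < ε := hκ.trans_le h
  have h1 := scalarK_le h0
  have h2 : 1 ≤ Real.exp (ε / 3) := Real.one_le_exp (by positivity)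
  have h3 : Real.exp (ε / 3) ≤ Real.exp ε := Real.exp_le_exp.2 (by linarith)
  have h4 := exp_pos_sub_one h0
  have h5 := exp_pos_sub_one hκ
  have h6 : Real.exp κ ≤ Real.exp ε := Real.exp_le_exp.2 h
  have h7 : normC₁ ε ≤ 3 * (Real.exp ε / (Real.exp ε - 1)) := by
    unfold normC₁
    rw [← mul_div_assoc]
    exact div_le_div_of_nonneg_right (by linarith) h4.le
  have h8 : Real.exp ε / (Real.exp ε - 1) ≤ Real.exp κ / (Real.exp κ - 1) := by
    rw [div_le_div_iff₀ h4 h5]; linarith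
  unfold scalarBound
  linarith

lemma scalarBound_pos {κ : ℝ} (hκ : 0 < κ) : 0 < scalarBound κ := by
  have := exp_pos_sub_one hκ
  unfold scalarBound
  positivity

/-- The weight with which `ScalarDP(r; ε₂)` returns `a (l - b)` after rounding to `j`. -/
noncomputable def scalarWeight (C ε r : ℝ) (j l : ℕ) : ℝ :=
  roundingProb (scalarK ε * r / C) j * responseProb ε j l

/-- The expectation of `h l` when `ScalarDP(r; ε₂)` returns `a (l - b)`. -/
noncomputable def scalarExp (C ε r : ℝ) (h : ℕ → ℝ) : ℝ :=
  ∑ j ∈ Finset.range (scalarK ε + 1), ∑ l ∈ Finset.range (scalarK ε + 1),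
    scalarWeight C ε r j l * h l

lemma roundingProb_nonneg {x : ℝ} (hx : 0 ≤ x) (j : ℕ) : 0 ≤ roundingProb x j := by
  have h1 := Nat.le_ceil x
  have h2 := Nat.ceil_lt_add_one hx
  unfold roundingProb
  refine add_nonneg ?_ ?_ <;> split_ifs <;> linarith

lemma responseProb_nonneg (ε : ℝ) (j l : ℕ) : 0 ≤ responseProb ε j l := by
  have h1 : Real.exp ε / (Real.exp ε + scalarK ε) ≤ 1 := by
    rw [div_le_one (by positivity)]
    have : (0 : ℝ) ≤ scalarK ε := by positivity
    linarith
  unfold responseProb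
  split_ifs
  · positivity
  · exact div_nonneg (by linarith) (by positivity)

variable {C ε r : ℝ}

lemma scalarWeight_nonneg (hC : 0 < C) (hr : 0 ≤ r) (j l : ℕ) : 0 ≤ scalarWeight C ε r j l :=
  mul_nonneg (roundingProb_nonneg (by positivity) j) (responseProb_nonneg ε j l)

lemma sum_responseProb {j : ℕ} (hj : j ≤ scalarK ε) (h : ℕ → ℝ) :
    ∑ l ∈ Finset.range (scalarK ε + 1), responseProb ε j l * h l
      = ((Real.exp ε - 1) * h j + ∑ l ∈ Finset.range (scalarK ε + 1), h l)
        / (Real.exp ε + scalarK ε) := by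
  have hk : (0 : ℝ) < scalarK ε := by exact_mod_cast one_le_scalarK
  have he := Real.exp_pos ε
  have h1 : ∀ l, responseProb ε j l * h l
      = (if l = j then (Real.exp ε - 1) / (Real.exp ε + scalarK ε) * h l else 0)
        + h l / (Real.exp ε + scalarK ε) := by
    intro l
    unfold responseProb
    split_ifs
    · field_simp; ring
    · field_simp; ring
  simp_rw [h1]
  rw [Finset.sum_add_distrib, Finset.sum_ite_eq', if_pos (Finset.mem_range.2 (by omega)),
    ← Finset.sum_div]
  ring

lemma scalarExp_eq (hC : 0 < C) (hrC : r ≤ C) (h : ℕ → ℝ) :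
    scalarExp C ε r h = ((Real.exp ε - 1)
        * (((⌈scalarK ε * r / C⌉₊ : ℝ) - scalarK ε * r / C) * h ⌊scalarK ε * r / C⌋₊
          + (1 - ((⌈scalarK ε * r / C⌉₊ : ℝ) - scalarK ε * r / C)) * h ⌈scalarK ε * r / C⌉₊)
        + ∑ l ∈ Finset.range (scalarK ε + 1), h l) / (Real.exp ε + scalarK ε) := by
  have hx : scalarK ε * r / C ≤ scalarK ε := by
    rw [div_le_iff₀ hC]; gcongr
  have hN : ⌈scalarK ε * r / C⌉₊ ≤ scalarK ε := Nat.ceil_le.2 hx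
  have hn : ⌊scalarK ε * r / C⌋₊ ≤ scalarK ε := (Nat.floor_le_ceil _).trans hN
  set x := scalarK ε * r / C
  have h1 : ∀ j ∈ Finset.range (scalarK ε + 1),
      ∑ l ∈ Finset.range (scalarK ε + 1), scalarWeight C ε r j l * h l
      = roundingProb x j * (((Real.exp ε - 1) * h j + ∑ l ∈ Finset.range (scalarK ε + 1), h l)
        / (Real.exp ε + scalarK ε)) := by
    intro j hj
    rw [← sum_responseProb (by have := Finset.mem_range.1 hj; omega), Finset.mul_sum]
    exact Finset.sum_congr rfl fun l _ => by rw [scalarWeight]; ring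
  rw [scalarExp, Finset.sum_congr rfl h1]
  simp_rw [roundingProb, add_mul, ite_mul, zero_mul]
  rw [Finset.sum_add_distrib, Finset.sum_ite_eq', Finset.sum_ite_eq',
    if_pos (Finset.mem_range.2 (by omega)), if_pos (Finset.mem_range.2 (by omega))]
  ring

lemma scalarExp_one (hC : 0 < C) (hrC : r ≤ C) :
    scalarExp C ε r (fun _ => 1) = 1 := by
  rw [scalarExp_eq hC hrC]
  have : 0 < Real.exp ε + scalarK ε := by positivity
  rw [div_eq_one_iff_eq this.ne']
  simp

lemma scalarExp_const_mul (a : ℝ) (h : ℕ → ℝ) :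
    scalarExp C ε r (fun l => a * h l) = a * scalarExp C ε r h := by
  simp only [scalarExp, Finset.mul_sum]
  exact Finset.sum_congr rfl fun j _ => Finset.sum_congr rfl fun l _ => by ring

lemma scalarExp_add (g h : ℕ → ℝ) :
    scalarExp C ε r (fun l => g l + h l) = scalarExp C ε r g + scalarExp C ε r h := by
  simp only [scalarExp, ← Finset.sum_add_distrib]
  exact Finset.sum_congr rfl fun j _ => Finset.sum_congr rfl fun l _ => by ring

lemma scalarExp_mono (hC : 0 < C) (hr : 0 ≤ r) {g h : ℕ → ℝ} (hgh : ∀ l ≤ scalarK ε, g l ≤ h l) :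
    scalarExp C ε r g ≤ scalarExp C ε r h :=
  Finset.sum_le_sum fun j _ => Finset.sum_le_sum fun l hl =>
    mul_le_mul_of_nonneg_left (hgh l (by have := Finset.mem_range.1 hl; omega))
      (scalarWeight_nonneg hC hr j l)

lemma sum_range_cast (k : ℕ) : ∑ l ∈ Finset.range (k + 1), (l : ℝ) = k * (k + 1) / 2 := by
  induction k with
  | zero => simp
  | succ k ih => rw [Finset.sum_range_succ, ih]; push_cast; ring

lemma sum_range_cast_sq (k : ℕ) :
    ∑ l ∈ Finset.range (k + 1), (l : ℝ) ^ 2 = k * (k + 1) * (2 * k + 1) / 6 := by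
  induction k with
  | zero => simp
  | succ k ih => rw [Finset.sum_range_succ, ih]; push_cast; ring

/-- `ScalarDP` is unbiased. -/
lemma scalarExp_value (hε : 0 < ε) (hC : 0 < C) (hr : 0 ≤ r) (hrC : r ≤ C) :
    scalarExp C ε r (fun l => scalarA C ε * ((l : ℝ) - scalarB ε)) = r := by
  have hk : (0 : ℝ) < scalarK ε := by exact_mod_cast one_le_scalarK
  have he := exp_pos_sub_one hε
  have he' := Real.exp_pos ε
  rw [scalarExp_const_mul, scalarExp_eq hC hrC, Finset.sum_sub_distrib, sum_range_cast]
  have hJ : ((⌈scalarK ε * r / C⌉₊ : ℝ) - scalarK ε * r / C) * (⌊scalarK ε * r / C⌋₊ : ℝ)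
      + (1 - ((⌈scalarK ε * r / C⌉₊ : ℝ) - scalarK ε * r / C)) * (⌈scalarK ε * r / C⌉₊ : ℝ)
      = scalarK ε * r / C := by
    have h0 : 0 ≤ scalarK ε * r / C := by positivity
    set x := scalarK ε * r / C
    rcases (Nat.ceil_le_floor_add_one x).lt_or_eq with h | h
    · have h1 : ⌈x⌉₊ = ⌊x⌋₊ := le_antisymm (by omega) (Nat.floor_le_ceil x)
      have h2 : (⌊x⌋₊ : ℝ) = x :=
        le_antisymm (Nat.floor_le h0) (by rw [← h1]; exact Nat.le_ceil x)
      rw [h1, h2]; ring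
    · rw [h]; push_cast; ring
  set x := scalarK ε * r / C with hx
  set n : ℝ := (⌊x⌋₊ : ℝ)
  set N : ℝ := (⌈x⌉₊ : ℝ)
  have e1 : (N - x) * (n - scalarB ε) + (1 - (N - x)) * (N - scalarB ε) = x - scalarB ε := by
    linear_combination hJ
  rw [e1, Finset.sum_const, Finset.card_range, nsmul_eq_mul, hx, scalarA, scalarB]
  push_cast
  field_simp
  ring

/-- The estimate `ŝ` of the squared norm as a function of `r̂`. -/
noncomputable def sqEstimate (C ε ρ : ℝ) : ℝ :=
  1 / (1 + normC₁ ε) * (ρ ^ 2 - normC₂ C ε * ρ - normC₃ C ε)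

/-- The estimate `ŝ` has mean `r² - (C/k)² (1/2 - f)²`, where `f` is the fractional part of
`k r / C`. As `f ≤ k r / C`, this mean is below `2 r²` by a margin of order `(C/k)²`. -/
lemma scalarExp_sqEstimate_le (hε : 0 < ε) (hC : 0 < C) (hr : 0 ≤ r) (hrC : r ≤ C) :
    scalarExp C ε r (fun l => sqEstimate C ε (scalarA C ε * ((l : ℝ) - scalarB ε)))
      ≤ 2 * r ^ 2 - C ^ 2 / (8 * (scalarK ε : ℝ) ^ 2) := by
  have hk : (0 : ℝ) < scalarK ε := by exact_mod_cast one_le_scalarK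
  have he := exp_pos_sub_one hε
  have he' := Real.exp_pos ε
  have hx0 : 0 ≤ scalarK ε * r / C := by positivity
  have hxr : r = C * (scalarK ε * r / C) / scalarK ε := by field_simp
  have hJ : ((⌈scalarK ε * r / C⌉₊ : ℝ) - scalarK ε * r / C) * (⌊scalarK ε * r / C⌋₊ : ℝ)
      + (1 - ((⌈scalarK ε * r / C⌉₊ : ℝ) - scalarK ε * r / C)) * (⌈scalarK ε * r / C⌉₊ : ℝ)
      = scalarK ε * r / C ∧
      ((⌈scalarK ε * r / C⌉₊ : ℝ) - scalarK ε * r / C) * (⌊scalarK ε * r / C⌋₊ : ℝ) ^ 2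
      + (1 - ((⌈scalarK ε * r / C⌉₊ : ℝ) - scalarK ε * r / C)) * (⌈scalarK ε * r / C⌉₊ : ℝ) ^ 2
      ≤ 2 * (scalarK ε * r / C) ^ 2 + 1 / 8 := by
    set x := scalarK ε * r / C
    rcases (Nat.ceil_le_floor_add_one x).lt_or_eq with h | h
    · have h1 : ⌈x⌉₊ = ⌊x⌋₊ := le_antisymm (by omega) (Nat.floor_le_ceil x)
      have h2 : (⌊x⌋₊ : ℝ) = x :=
        le_antisymm (Nat.floor_le hx0) (by rw [← h1]; exact Nat.le_ceil x)
      rw [h1, h2]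
      constructor <;> nlinarith [sq_nonneg x]
    · rw [h]
      push_cast
      have h1 := Nat.floor_le hx0
      have h2 := Nat.lt_floor_add_one x
      have h3 : (0 : ℝ) ≤ (⌊x⌋₊ : ℝ) := by positivity
      set n : ℝ := (⌊x⌋₊ : ℝ)
      constructor
      · ring
      · nlinarith [sq_nonneg (x - n - 1 / 4), mul_nonneg h3 (sub_nonneg.2 h1), mul_nonneg h3 h3]
  obtain ⟨hJ1, hJ2⟩ := hJ
  rw [scalarExp_eq hC hrC]
  set x := scalarK ε * r / C with hx
  set n : ℝ := (⌊x⌋₊ : ℝ)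
  set N : ℝ := (⌈x⌉₊ : ℝ)
  set k : ℝ := (scalarK ε : ℝ) with hkdef
  -- the estimate is a quadratic polynomial `α l² + β l + ζ` in `l`
  obtain ⟨α, hα⟩ : ∃ α, α = 1 / (1 + normC₁ ε) * scalarA C ε ^ 2 := ⟨_, rfl⟩
  obtain ⟨β, hβ⟩ : ∃ β, β = 1 / (1 + normC₁ ε) * (-2 * scalarA C ε ^ 2 * scalarB ε
    - normC₂ C ε * scalarA C ε) := ⟨_, rfl⟩
  obtain ⟨ζ, hζ⟩ : ∃ ζ, ζ = 1 / (1 + normC₁ ε) * ((scalarA C ε * scalarB ε) ^ 2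
    + normC₂ C ε * scalarA C ε * scalarB ε - normC₃ C ε) := ⟨_, rfl⟩
  have hquad : ∀ l : ℝ, sqEstimate C ε (scalarA C ε * (l - scalarB ε)) = α * l ^ 2 + β * l + ζ := by
    intro l
    rw [hα, hβ, hζ, sqEstimate]; ring
  simp_rw [hquad]
  rw [Finset.sum_add_distrib, Finset.sum_add_distrib, ← Finset.mul_sum, ← Finset.mul_sum,
    sum_range_cast, sum_range_cast_sq, Finset.sum_const, Finset.card_range, nsmul_eq_mul]
  set m2 := (N - x) * n ^ 2 + (1 - (N - x)) * N ^ 2 with hm2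
  have e1 : (N - x) * (α * n ^ 2 + β * n + ζ) + (1 - (N - x)) * (α * N ^ 2 + β * N + ζ)
      = α * m2 + β * x + ζ := by
    rw [hm2]; linear_combination β * hJ1
  rw [e1]
  push_cast
  rw [← hkdef]
  have hmean : ((Real.exp ε - 1) * (α * m2 + β * x + ζ) + (α * (k * (k + 1) * (2 * k + 1) / 6)
      + β * (k * (k + 1) / 2) + (k + 1) * ζ)) / (Real.exp ε + k) = C ^ 2 / k ^ 2 * (m2 - 1 / 4) := by
    have h1 : 1 + normC₁ ε = (Real.exp ε + k) / (Real.exp ε - 1) := by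
      rw [normC₁, ← hkdef]; field_simp; ring
    rw [hα, hβ, hζ, h1]
    rw [normC₃, normC₂, scalarA, scalarB, normC₁, ← hkdef]
    field_simp
    ring
  rw [hmean, hxr]
  have h2 : C ^ 2 / k ^ 2 * (m2 - 1 / 4) ≤ C ^ 2 / k ^ 2 * (2 * x ^ 2 + 1 / 8 - 1 / 4) := by
    gcongr
  refine h2.trans (le_of_eq ?_)
  field_simp
  ring

/-- The exponential moment of `ŝ` at this rate does not exceed that of the constant `2 r²`. A
Bernstein bound is needed here: the variance of `ŝ` is of order `C⁴ / k²`, although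
`|ŝ|` may be of order `C²`. The margin of order `C² / k²` of the mean absorbs the variance. -/
lemma scalarExp_exp_le {κ : ℝ} (hκ : 0 < κ) (hε : κ ≤ ε) (hC : 0 < C) (hr : 0 ≤ r)
    (hrC : r ≤ C) :
    scalarExp C ε r (fun l => Real.exp (1 / (104 * scalarBound κ ^ 2 * C ^ 2)
      * (sqEstimate C ε (scalarA C ε * ((l : ℝ) - scalarB ε)) - 2 * r ^ 2))) ≤ 1 := by
  have hε0 : 0 < ε := hκ.trans_le hε
  have hk1 : (1 : ℝ) ≤ scalarK ε := by exact_mod_cast one_le_scalarK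
  have hk : (0 : ℝ) < scalarK ε := by linarith
  have he := exp_pos_sub_one hε0
  have he' := Real.exp_pos ε
  have hmean := scalarExp_sqEstimate_le hε0 hC hr hrC
  set H := scalarBound κ with hH
  have hH1 := normC₁_le hκ hε
  have hc1 := normC₁_pos hε0
  have hHpos : 2 ≤ H := by linarith
  set l₀ := 1 / (104 * H ^ 2 * C ^ 2) with hl₀
  have hl₀pos : 0 < l₀ := by positivity
  set φ : ℕ → ℝ := fun l => sqEstimate C ε (scalarA C ε * ((l : ℝ) - scalarB ε)) with hφ
  set n := ⌊scalarK ε * r / C⌋₊ with hn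
  have hnk : n ≤ scalarK ε := by
    refine Nat.floor_le_of_le ?_
    rw [div_le_iff₀ hC]; gcongr
  set k : ℝ := (scalarK ε : ℝ) with hkdef
  have hb : 0 ≤ scalarB ε ∧ scalarB ε ≤ k := by
    constructor
    · unfold scalarB; positivity
    · rw [scalarB, ← hkdef, div_le_iff₀ (by positivity)]
      nlinarith
  have ha : scalarA C ε = (1 + normC₁ ε) * (C / k) := by
    rw [scalarA, normC₁, ← hkdef]; field_simp; ring
  have hdiff : ∀ l ≤ scalarK ε, |φ l - φ n| ≤ H * (C ^ 2 / k) * |(l : ℝ) - n| := by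
    intro l hl
    have e1 : φ l - φ n = ((l : ℝ) - n) * (C / k * ((1 + normC₁ ε) * (C / k)
        * ((l : ℝ) + n - 2 * scalarB ε) + normC₁ ε * C)) := by
      simp only [hφ, sqEstimate, normC₂, ha]
      field_simp
      ring
    have hl' : (l : ℝ) ≤ k := (Nat.cast_le (α := ℝ)).2 hl
    have hn' : (n : ℝ) ≤ k := (Nat.cast_le (α := ℝ)).2 hnk
    have hl0 : (0 : ℝ) ≤ l := by positivity
    have hn0 : (0 : ℝ) ≤ n := by positivity
    have e2 : |(1 + normC₁ ε) * (C / k) * ((l : ℝ) + n - 2 * scalarB ε) + normC₁ ε * C| ≤ H * C := by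
      refine (abs_add_le _ _).trans ?_
      rw [abs_mul, abs_of_pos (by positivity : 0 < (1 + normC₁ ε) * (C / k)),
        abs_of_pos (by positivity : 0 < normC₁ ε * C)]
      have e3 : |(l : ℝ) + n - 2 * scalarB ε| ≤ 2 * k := by
        rw [abs_le]; constructor <;> linarith [hb.1, hb.2]
      calc _ ≤ (1 + normC₁ ε) * (C / k) * (2 * k) + normC₁ ε * C := by gcongr
        _ = (2 + 3 * normC₁ ε) * C := by field_simp; ring
        _ ≤ _ := by gcongr
    rw [e1, abs_mul, abs_mul, abs_of_pos (by positivity : 0 < C / k)]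
    calc |(l : ℝ) - n| * (C / k * _) ≤ |(l : ℝ) - n| * (C / k * (H * C)) := by gcongr
      _ = _ := by ring
  have hvar : scalarExp C ε r (fun l => (φ l - φ n) ^ 2) ≤ 13 * H ^ 2 * (C ^ 4 / k ^ 2) := by
    have h1 : scalarExp C ε r (fun l => ((l : ℝ) - n) ^ 2) ≤ 13 := by
      rw [scalarExp_eq hC hrC]
      have hN := Nat.ceil_le_floor_add_one (scalarK ε * r / C)
      have hN2 := Nat.floor_le_ceil (scalarK ε * r / C)
      have hN3 := Nat.le_ceil (scalarK ε * r / C)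
      have hN4 := Nat.ceil_lt_add_one (by positivity : 0 ≤ scalarK ε * r / C)
      rw [← hn] at hN hN2 ⊢
      rw [← hkdef] at hN3 hN4 hN hN2 ⊢
      have hNn : ((⌈k * r / C⌉₊ : ℝ) - n) ^ 2 ≤ 1 := by
        have a1 : (⌈k * r / C⌉₊ : ℝ) ≤ n + 1 := by exact_mod_cast hN
        have a2 : (n : ℝ) ≤ (⌈k * r / C⌉₊ : ℝ) := by exact_mod_cast hN2
        nlinarith
      have hround : ((⌈k * r / C⌉₊ : ℝ) - k * r / C) * ((n : ℝ) - n) ^ 2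
          + (1 - ((⌈k * r / C⌉₊ : ℝ) - k * r / C)) * ((⌈k * r / C⌉₊ : ℝ) - n) ^ 2 ≤ 1 := by
        rw [sub_self]
        nlinarith [sq_nonneg ((⌈k * r / C⌉₊ : ℝ) - n)]
      have hsum : ∑ l ∈ Finset.range (scalarK ε + 1), ((l : ℝ) - n) ^ 2 ≤ (k + 1) * k ^ 2 := by
        have : ∀ l ∈ Finset.range (scalarK ε + 1), ((l : ℝ) - n) ^ 2 ≤ k ^ 2 := by
          intro l hl
          have hl' : (l : ℝ) ≤ k := by
            have := Finset.mem_range.1 hl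
            exact (Nat.cast_le (α := ℝ)).2 (by omega : l ≤ scalarK ε)
          have hn' : (n : ℝ) ≤ k := (Nat.cast_le (α := ℝ)).2 hnk
          have hl0 : (0 : ℝ) ≤ l := by positivity
          have hn0 : (0 : ℝ) ≤ n := by positivity
          exact sq_le_sq' (by linarith) (by linarith)
        refine (Finset.sum_le_sum this).trans (le_of_eq ?_)
        rw [Finset.sum_const, Finset.card_range, nsmul_eq_mul]
        push_cast
        rw [← hkdef]
      have hcube : (k + 1) * k ^ 2 ≤ 12 * Real.exp ε := by
        have a1 := scalarK_le hε0
        rw [← hkdef] at a1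
        have a2 : 1 ≤ Real.exp (ε / 3) := Real.one_le_exp (by positivity)
        have a3 : Real.exp ε = Real.exp (ε / 3) ^ 3 := by
          rw [← Real.exp_nat_mul]; congr 1; push_cast; ring
        rw [a3]
        calc (k + 1) * k ^ 2 ≤ (3 * Real.exp (ε / 3)) * (2 * Real.exp (ε / 3)) ^ 2 := by
              gcongr; linarith
          _ = _ := by ring
      rw [div_le_iff₀ (by positivity)]
      have := mul_le_mul_of_nonneg_left hround he.le
      linarith
    calc scalarExp C ε r (fun l => (φ l - φ n) ^ 2)
        ≤ scalarExp C ε r (fun l => (H * (C ^ 2 / k)) ^ 2 * ((l : ℝ) - n) ^ 2) := by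
          refine scalarExp_mono hC hr fun l hl => ?_
          rw [← sq_abs (φ l - φ n), ← sq_abs ((l : ℝ) - n), ← mul_pow]
          exact pow_le_pow_left₀ (abs_nonneg _) (hdiff l hl) 2
      _ = (H * (C ^ 2 / k)) ^ 2 * scalarExp C ε r (fun l => ((l : ℝ) - n) ^ 2) :=
          scalarExp_const_mul _ _
      _ ≤ (H * (C ^ 2 / k)) ^ 2 * 13 := by gcongr
      _ = _ := by ring
  have hexp : ∀ l ≤ scalarK ε, Real.exp (l₀ * (φ l - 2 * r ^ 2))
      ≤ Real.exp (l₀ * (φ n - 2 * r ^ 2))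
        * (1 + (l₀ * (φ l - φ n) + l₀ ^ 2 * (φ l - φ n) ^ 2)) := by
    intro l hl
    have h1 : l₀ * (φ l - 2 * r ^ 2) = l₀ * (φ n - 2 * r ^ 2) + l₀ * (φ l - φ n) := by ring
    rw [h1, Real.exp_add]
    gcongr
    have h2 : |l₀ * (φ l - φ n)| ≤ 1 := by
      rw [abs_mul, abs_of_pos hl₀pos]
      have h3 : |(l : ℝ) - n| ≤ k := by
        have hl' : (l : ℝ) ≤ k := (Nat.cast_le (α := ℝ)).2 hl
        have hn' : (n : ℝ) ≤ k := (Nat.cast_le (α := ℝ)).2 hnk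
        have hl0 : (0 : ℝ) ≤ l := by positivity
        have hn0 : (0 : ℝ) ≤ n := by positivity
        rw [abs_le]; constructor <;> linarith
      calc l₀ * |φ l - φ n| ≤ l₀ * (H * (C ^ 2 / k) * k) := by
            gcongr
            exact (hdiff l hl).trans (by gcongr)
        _ = 1 / (104 * H) := by rw [hl₀]; field_simp
        _ ≤ 1 := by rw [div_le_one (by positivity)]; linarith
    have h4 := Real.abs_exp_sub_one_sub_id_le h2
    have := (abs_le.1 h4).2
    rw [mul_pow] at this
    linarith
  refine (scalarExp_mono hC hr hexp).trans ?_
  rw [scalarExp_const_mul, scalarExp_add, scalarExp_add, scalarExp_one hC hrC,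
    scalarExp_const_mul, scalarExp_const_mul]
  have hlin : scalarExp C ε r (fun l => φ l - φ n) = scalarExp C ε r φ - φ n := by
    have := scalarExp_add (C := C) (ε := ε) (r := r) φ (fun _ => -φ n * 1)
    rw [scalarExp_const_mul, scalarExp_one hC hrC] at this
    simpa [sub_eq_add_neg] using this
  rw [hlin]
  have h5 : 1 + (l₀ * (scalarExp C ε r φ - φ n) + l₀ ^ 2 * scalarExp C ε r fun l => (φ l - φ n) ^ 2)
      ≤ Real.exp (l₀ * (2 * r ^ 2 - φ n)) := by
    refine le_trans ?_ (Real.add_one_le_exp _)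
    have h6 := mul_le_mul_of_nonneg_left hmean hl₀pos.le
    have h7 := mul_le_mul_of_nonneg_left hvar (sq_nonneg l₀)
    have h8 : l₀ ^ 2 * (13 * H ^ 2 * (C ^ 4 / k ^ 2)) = l₀ * (C ^ 2 / (8 * k ^ 2)) := by
      rw [hl₀]; field_simp; norm_num
    linarith
  calc _ ≤ Real.exp (l₀ * (φ n - 2 * r ^ 2)) * Real.exp (l₀ * (2 * r ^ 2 - φ n)) := by gcongr
    _ = 1 := by rw [← Real.exp_add]; ring_nf; exact Real.exp_zero

lemma lintegral_scalarDP (F : ℝ → ENNReal) (hF : Measurable F) :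
    ∫⁻ ρ, F ρ ∂scalarDP C ε r = ∑ j ∈ Finset.range (scalarK ε + 1),
      ∑ l ∈ Finset.range (scalarK ε + 1), ENNReal.ofReal (scalarWeight C ε r j l)
        * F (scalarA C ε * ((l : ℝ) - scalarB ε)) := by
  simp only [scalarDP, lintegral_finsetSum_measure, lintegral_smul_measure, lintegral_dirac' _ hF,
    smul_eq_mul]
  rfl

lemma lintegral_ofReal_scalarDP (hC : 0 < C) (hr : 0 ≤ r) {h : ℝ → ℝ} (hm : Measurable h)
    (h0 : ∀ x, 0 ≤ h x) :
    ∫⁻ ρ, ENNReal.ofReal (h ρ) ∂scalarDP C ε r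
      = ENNReal.ofReal (scalarExp C ε r fun l => h (scalarA C ε * ((l : ℝ) - scalarB ε))) := by
  rw [lintegral_scalarDP _ (by fun_prop), scalarExp, ENNReal.ofReal_sum_of_nonneg fun j _ =>
    Finset.sum_nonneg fun l _ => mul_nonneg (scalarWeight_nonneg hC hr j l) (h0 _)]
  refine Finset.sum_congr rfl fun j _ => ?_
  rw [ENNReal.ofReal_sum_of_nonneg fun l _ => mul_nonneg (scalarWeight_nonneg hC hr j l) (h0 _)]
  exact Finset.sum_congr rfl fun l _ => (ENNReal.ofReal_mul (scalarWeight_nonneg hC hr j l)).symm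

lemma isProbabilityMeasure_scalarDP (hC : 0 < C) (hr : 0 ≤ r) (hrC : r ≤ C) :
    IsProbabilityMeasure (scalarDP C ε r) := by
  refine ⟨?_⟩
  have := lintegral_ofReal_scalarDP (ε := ε) hC hr (h := fun _ => 1) measurable_const
    fun _ => zero_le_one
  rw [scalarExp_one hC hrC] at this
  simpa using this

lemma integral_scalarDP (hC : 0 < C) (hr : 0 ≤ r) (h : ℝ → ℝ) :
    ∫ ρ, h ρ ∂scalarDP C ε r = scalarExp C ε r fun l => h (scalarA C ε * ((l : ℝ) - scalarB ε)) := by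
  have hi : ∀ j l, Integrable h (ENNReal.ofReal (scalarWeight C ε r j l) •
      Measure.dirac (scalarA C ε * ((l : ℝ) - scalarB ε))) := fun j l =>
    (integrable_dirac (by simp)).smul_measure ENNReal.ofReal_ne_top
  have hdef : scalarDP C ε r = ∑ j ∈ Finset.range (scalarK ε + 1),
      ∑ l ∈ Finset.range (scalarK ε + 1), ENNReal.ofReal (scalarWeight C ε r j l) •
        Measure.dirac (scalarA C ε * ((l : ℝ) - scalarB ε)) := rfl
  rw [hdef, integral_finsetSum_measure fun j _ => integrable_finsetSum_measure.2 fun l _ => hi j l]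
  refine Finset.sum_congr rfl fun j _ => ?_
  rw [integral_finsetSum_measure fun l _ => hi j l]
  refine Finset.sum_congr rfl fun l _ => ?_
  rw [integral_smul_measure, integral_dirac, smul_eq_mul]
  congr 1
  exact ENNReal.toReal_ofReal (scalarWeight_nonneg hC hr j l)

lemma ae_scalarDP {p : ℝ → Prop}
    (hp : ∀ l ≤ scalarK ε, p (scalarA C ε * ((l : ℝ) - scalarB ε))) :
    ∀ᵐ ρ ∂scalarDP C ε r, p ρ := by
  simp only [scalarDP, Filter.Eventually, mem_ae_iff, Measure.coe_finsetSum, Finset.sum_apply,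
    Finset.sum_eq_zero_iff]
  intro j _ l hl
  have hl' : l ≤ scalarK ε := by have := Finset.mem_range.1 hl; omega
  rw [Measure.smul_apply, Measure.dirac_apply, Set.indicator_of_notMem, smul_zero]
  simpa using hp l hl'

lemma abs_scalar_value_le (hε : 0 < ε) (hC : 0 < C) {l : ℕ} (hl : l ≤ scalarK ε) :
    |scalarA C ε * ((l : ℝ) - scalarB ε)| ≤ (1 + normC₁ ε) * C := by
  have hk1 : (1 : ℝ) ≤ scalarK ε := by exact_mod_cast one_le_scalarK
  have hk : (0 : ℝ) < scalarK ε := by linarith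
  have he := exp_pos_sub_one hε
  have he' := Real.exp_pos ε
  set k : ℝ := (scalarK ε : ℝ) with hkdef
  have hb : 0 ≤ scalarB ε ∧ scalarB ε ≤ k := by
    constructor
    · unfold scalarB; positivity
    · rw [scalarB, ← hkdef, div_le_iff₀ (by positivity)]
      nlinarith
  have ha : scalarA C ε = (1 + normC₁ ε) * (C / k) := by
    rw [scalarA, normC₁, ← hkdef]; field_simp; ring
  have hc1 := normC₁_pos hε
  have hl' : (l : ℝ) ≤ k := (Nat.cast_le (α := ℝ)).2 hl
  have hl0 : (0 : ℝ) ≤ l := by positivity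
  rw [ha, abs_mul, abs_of_pos (by positivity)]
  calc _ ≤ (1 + normC₁ ε) * (C / k) * k := by
        gcongr
        rw [abs_le]; constructor <;> linarith [hb.1, hb.2]
    _ = _ := by field_simp

lemma measurable_scalarDP : Measurable (scalarDP C ε) := by
  have hround : ∀ j, Measurable fun x : ℝ => roundingProb x j := by
    intro j
    unfold roundingProb
    refine Measurable.add (Measurable.ite ?_ ?_ measurable_const)
      (Measurable.ite ?_ ?_ measurable_const)
    · exact measurableSet_eq_fun measurable_const Nat.measurable_floor
    · exact (measurable_from_nat.comp Nat.measurable_ceil).sub measurable_id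
    · exact measurableSet_eq_fun measurable_const Nat.measurable_ceil
    · exact measurable_const.sub ((measurable_from_nat.comp Nat.measurable_ceil).sub measurable_id)
  refine Measure.measurable_of_measurable_coe _ fun s hs => ?_
  simp only [scalarDP, Measure.coe_finsetSum, Finset.sum_apply, Measure.smul_apply, smul_eq_mul]
  refine Finset.measurable_fun_sum _ fun j _ => Finset.measurable_fun_sum _ fun l _ => ?_
  refine Measurable.mul_const ?_ _
  refine (Measurable.mul_const ((hround j).comp ?_) _).ennreal_ofReal
  fun_prop

/-- If `2 b` is not an integer, then the sign of `r̂ = a (l - b)` is determined by whether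
`|r̂| / a + b` is an integer. -/
lemma sign_recovery (hε : 0 < ε) (hC : 0 < C)
    (hb : ∀ n : ℤ, (scalarK ε : ℝ) * (scalarK ε + 1) / (Real.exp ε + scalarK ε) ≠ n) (l : ℕ) :
    (∃ n : ℤ, (n : ℝ) = |scalarA C ε * ((l : ℝ) - scalarB ε)| / scalarA C ε + scalarB ε)
      ↔ 0 ≤ scalarA C ε * ((l : ℝ) - scalarB ε) := by
  have hk : (0 : ℝ) < scalarK ε := by exact_mod_cast one_le_scalarK
  have he := exp_pos_sub_one hε
  have ha : 0 < scalarA C ε := by unfold scalarA; positivity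
  rcases le_or_gt 0 (scalarA C ε * ((l : ℝ) - scalarB ε)) with h | h
  · refine iff_of_true ⟨l, ?_⟩ h
    rw [abs_of_nonneg h]
    field_simp
    push_cast
    ring
  · refine iff_of_false ?_ (not_le.2 h)
    rintro ⟨n, hn⟩
    rw [abs_of_neg h] at hn
    apply hb (n + l)
    have h1 : -(scalarA C ε * ((l : ℝ) - scalarB ε)) / scalarA C ε = scalarB ε - l := by
      field_simp; ring
    rw [h1] at hn
    have h2 : (scalarK ε : ℝ) * (scalarK ε + 1) / (Real.exp ε + scalarK ε) = 2 * scalarB ε := by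
      rw [scalarB]; field_simp
    rw [h2]
    push_cast
    linarith

end Scalar

/-! ### The uniform distribution on the sphere -/

section Sphere

open Module

/-- Integration in polar coordinates. -/
lemma lintegral_eq_lintegral_toSphere {E : Type*} [NormedAddCommGroup E] [NormedSpace ℝ E]
    [MeasurableSpace E] [BorelSpace E] [FiniteDimensional ℝ E] [Nontrivial E] (μ : Measure E)
    [μ.IsAddHaarMeasure] {F : E → ENNReal} (hF : Measurable F) :
    ∫⁻ x, F x ∂μ = ∫⁻ v, (∫⁻ r in Set.Ioi (0 : ℝ),
      ENNReal.ofReal (r ^ (finrank ℝ E - 1)) * F (r • (v : E))) ∂μ.toSphere := by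
  have h1 : ∫⁻ x, F x ∂μ = ∫⁻ x : ({0}ᶜ : Set E), F x.1 ∂(μ.comap (↑)) := by
    rw [lintegral_subtype_comap (measurableSet_singleton _).compl, restrict_compl_singleton]
  have h2 : ∀ x : ({0}ᶜ : Set E), F x.1
      = (fun p : Metric.sphere (0 : E) 1 × Set.Ioi (0 : ℝ) => F (p.2.1 • (p.1 : E)))
        (homeomorphUnitSphereProd E x) := by
    intro x
    have hx : ‖x.1‖ ≠ 0 := norm_ne_zero_iff.2 x.2
    simp [smul_smul, hx]
  have hm : Measurable fun p : Metric.sphere (0 : E) 1 × Set.Ioi (0 : ℝ) =>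
      F (p.2.1 • (p.1 : E)) := by fun_prop
  rw [h1]
  simp_rw [h2]
  rw [(μ.measurePreserving_homeomorphUnitSphereProd).lintegral_comp hm, lintegral_prod _
    hm.aemeasurable]
  refine lintegral_congr fun v => ?_
  rw [Measure.volumeIoiPow, lintegral_withDensity_eq_lintegral_mul _ (by fun_prop) (by fun_prop)]
  exact lintegral_subtype_comap measurableSet_Ioi
    fun r => ENNReal.ofReal (r ^ (finrank ℝ E - 1)) * F (r • (v : E))

/-- The mass of a radial slice of the unit ball. -/
noncomputable def radialMass (n : ℕ) : ENNReal :=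
  ∫⁻ r in Set.Ioi (0 : ℝ), ENNReal.ofReal (r ^ n) * (Set.Iio (1 : ℝ)).indicator 1 r

lemma radialMass_eq (n : ℕ) : radialMass n = ENNReal.ofReal (1 / (n + 1)) := by
  have h1 : radialMass n = ∫⁻ r in Set.Ioo (0 : ℝ) 1, ENNReal.ofReal (r ^ n) := by
    have : ∀ r : ℝ, ENNReal.ofReal (r ^ n) * (Set.Iio (1 : ℝ)).indicator 1 r
        = (Set.Iio (1 : ℝ)).indicator (fun r => ENNReal.ofReal (r ^ n)) r := by
      intro r
      by_cases h : r ∈ Set.Iio (1 : ℝ) <;> simp [h]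
    simp_rw [radialMass, this]
    rw [setLIntegral_indicator measurableSet_Iio, Set.inter_comm, Set.Ioi_inter_Iio]
  rw [h1, ← ofReal_integral_eq_lintegral_ofReal]
  · rw [← integral_Ioc_eq_integral_Ioo, ← intervalIntegral.integral_of_le zero_le_one, integral_pow]
    simp
  · exact (continuous_pow n).integrableOn_Icc.mono_set Set.Ioo_subset_Icc_self
  · filter_upwards [ae_restrict_mem measurableSet_Ioo] with r hr
    exact pow_nonneg hr.1.le n

lemma radialMass_ne_zero (n : ℕ) : radialMass n ≠ 0 := by
  rw [radialMass_eq, Ne, ENNReal.ofReal_eq_zero, not_le]; positivity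

lemma radialMass_ne_top (n : ℕ) : radialMass n ≠ ⊤ := by
  rw [radialMass_eq]; exact ENNReal.ofReal_ne_top

/-- An integral over the sphere, as an integral over the unit ball. -/
lemma lintegral_ball_eq {E : Type*} [NormedAddCommGroup E] [NormedSpace ℝ E]
    [MeasurableSpace E] [BorelSpace E] [FiniteDimensional ℝ E] [Nontrivial E] (μ : Measure E)
    [μ.IsAddHaarMeasure] {g : E → ENNReal} (hg : Measurable g) :
    ∫⁻ x, g (‖x‖⁻¹ • x) * (Set.Iio (1 : ℝ)).indicator 1 ‖x‖ ∂μ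
      = radialMass (finrank ℝ E - 1) * ∫⁻ v, g v ∂μ.toSphere := by
  have hind : Measurable ((Set.Iio (1 : ℝ)).indicator (1 : ℝ → ENNReal)) :=
    measurable_one.indicator measurableSet_Iio
  rw [lintegral_eq_lintegral_toSphere μ (by fun_prop), ← lintegral_const_mul _ (by fun_prop)]
  refine lintegral_congr fun v => ?_
  have hv : ‖(v : E)‖ = 1 := by simp
  rw [radialMass, ← lintegral_mul_const _ (by fun_prop)]
  refine setLIntegral_congr_fun measurableSet_Ioi fun r hr => ?_
  have hr' : 0 < r := hr
  have h1 : ‖r • (v : E)‖ = r := by rw [norm_smul, hv, mul_one, Real.norm_of_nonneg hr'.le]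
  simp only [h1, smul_smul, inv_mul_cancel₀ hr'.ne', one_smul]
  ring

/-- The surface measure is invariant under linear isometries. -/
lemma lintegral_toSphere_comp_isometry {d : ℕ} [NeZero d] (T : Vec d ≃ₗᵢ[ℝ] Vec d)
    {g : Vec d → ENNReal} (hg : Measurable g) :
    ∫⁻ v, g (T v) ∂(volume : Measure (Vec d)).toSphere
      = ∫⁻ v, g v ∂(volume : Measure (Vec d)).toSphere := by
  have hT : Measurable T := T.continuous.measurable
  have hind : Measurable ((Set.Iio (1 : ℝ)).indicator (1 : ℝ → ENNReal)) :=
    measurable_one.indicator measurableSet_Iio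
  have h1 := lintegral_ball_eq (volume : Measure (Vec d)) hg
  have h2 := lintegral_ball_eq (volume : Measure (Vec d)) (hg.comp hT)
  have h3 := T.measurePreserving.lintegral_comp
    (f := fun x => g (‖x‖⁻¹ • x) * (Set.Iio (1 : ℝ)).indicator 1 ‖x‖) (by fun_prop)
  simp only [T.norm_map, ← map_smul] at h3
  simp only [Function.comp] at h2
  rw [h3, h1] at h2
  exact ((ENNReal.mul_right_inj (radialMass_ne_zero _) (radialMass_ne_top _)).1 h2).symm

/-- The splitting `x = t u + y` of a Euclidean space with respect to a unit vector `u`. -/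
lemma lintegral_eq_lintegral_orthogonal {d : ℕ} {u : Vec d} (hu : ‖u‖ = 1) {F : Vec d → ENNReal}
    (hF : Measurable F) :
    ∫⁻ x, F x = ∫⁻ t : ℝ, ∫⁻ y : (ℝ ∙ u)ᗮ, F (t • u + (y : Vec d)) := by
  have h1 := (WithLp.volume_preserving_ofLp (ℝ ∙ u) (ℝ ∙ u)ᗮ).comp
    (ℝ ∙ u).orthogonalDecomposition.measurePreserving
  have h2 := (LinearIsometryEquiv.toSpanUnitSingleton u hu).measurePreserving
  have h3 := h1.lintegral_comp (f := fun p : (ℝ ∙ u) × (ℝ ∙ u)ᗮ => F ((p.1 : Vec d) + p.2))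
    (by fun_prop)
  have h4 : ∀ x : Vec d, F x = F ((((WithLp.ofLp ∘ (ℝ ∙ u).orthogonalDecomposition) x).1 : Vec d)
      + (((WithLp.ofLp ∘ (ℝ ∙ u).orthogonalDecomposition) x).2 : Vec d)) := by
    intro x
    congr 1
    simp
  calc ∫⁻ x, F x = _ := lintegral_congr h4
    _ = _ := h3
    _ = ∫⁻ t : (ℝ ∙ u), ∫⁻ y : (ℝ ∙ u)ᗮ, F ((t : Vec d) + (y : Vec d)) := by
      rw [Measure.volume_eq_prod, lintegral_prod _ (by fun_prop)]
    _ = _ := by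
      rw [← h2.lintegral_comp (Measurable.lintegral_prod_right' (f := fun p : (ℝ ∙ u) × (ℝ ∙ u)ᗮ =>
        F ((p.1 : Vec d) + p.2)) (by fun_prop))]
      rfl

/-- The total mass of the surface measure of the sphere in the hyperplane orthogonal to `u`. -/
noncomputable def equatorMass {d : ℕ} (u : Vec d) : ENNReal :=
  (volume : Measure (ℝ ∙ u)ᗮ).toSphere Set.univ

/-- The law of one coordinate of a uniform point on the sphere in dimension `n + 2`: it is
`cos φ` where `φ` has a density proportional to `sin φ ^ n` on `(0, π)`. -/
lemma lintegral_toSphere_inner {n : ℕ} {u : Vec (n + 2)} (hu : ‖u‖ = 1) {g : ℝ → ENNReal}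
    (hg : Measurable g) :
    ∫⁻ v, g (inner ℝ (v : Vec (n + 2)) u) ∂(volume : Measure (Vec (n + 2))).toSphere
      = equatorMass u * ∫⁻ φ in Set.Ioo 0 Real.pi,
          ENNReal.ofReal (Real.sin φ ^ n) * g (Real.cos φ) := by
  have hind : Measurable ((Set.Iio (1 : ℝ)).indicator (1 : ℝ → ENNReal)) :=
    measurable_one.indicator measurableSet_Iio
  have hu0 : u ≠ 0 := by rintro rfl; simp at hu
  have hrank : finrank ℝ (ℝ ∙ u)ᗮ = n + 1 := by
    have : Fact (finrank ℝ (Vec (n + 2)) = (n + 1) + 1) := ⟨by simp⟩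
    exact Submodule.finrank_orthogonal_span_singleton hu0
  have : Nontrivial (ℝ ∙ u)ᗮ := Module.nontrivial_of_finrank_pos (R := ℝ) (by rw [hrank]; omega)
  set G : ℝ × ℝ → ENNReal := fun p => g ((√(p.1 ^ 2 + p.2 ^ 2))⁻¹ * p.1)
    * (Set.Iio (1 : ℝ)).indicator 1 √(p.1 ^ 2 + p.2 ^ 2) with hG
  have hGm : Measurable G := by fun_prop
  have h1 := lintegral_ball_eq (volume : Measure (Vec (n + 2)))
    (g := fun v => g (inner ℝ v u)) (by fun_prop)
  have h2 : ∫⁻ x : Vec (n + 2), g (inner ℝ (‖x‖⁻¹ • x) u) * (Set.Iio (1 : ℝ)).indicator 1 ‖x‖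
      = ∫⁻ t : ℝ, ∫⁻ y : (ℝ ∙ u)ᗮ, G (t, ‖y‖) := by
    rw [lintegral_eq_lintegral_orthogonal hu (by fun_prop)]
    refine lintegral_congr fun t => lintegral_congr fun y => ?_
    have hy : inner ℝ (y : Vec (n + 2)) u = 0 := by
      rw [real_inner_comm]
      exact Submodule.mem_orthogonal_singleton_iff_inner_right.1 y.2
    have hnorm : ‖t • u + (y : Vec (n + 2))‖ = √(t ^ 2 + ‖y‖ ^ 2) := by
      rw [← Real.sqrt_sq (norm_nonneg (t • u + (y : Vec (n + 2)))), norm_add_sq_real,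
        real_inner_smul_left, real_inner_comm, hy, norm_smul, hu, mul_one, Real.norm_eq_abs, sq_abs]
      simp
    have hin : inner ℝ (t • u + (y : Vec (n + 2))) u = t := by
      rw [inner_add_left, hy, real_inner_smul_left, real_inner_self_eq_norm_sq, hu]; ring
    simp only [hG, real_inner_smul_left, hin, hnorm]
  have h3 : ∀ t, ∫⁻ y : (ℝ ∙ u)ᗮ, G (t, ‖y‖)
      = equatorMass u * ∫⁻ s in Set.Ioi (0 : ℝ), ENNReal.ofReal (s ^ n) * G (t, s) := by
    intro t
    rw [lintegral_eq_lintegral_toSphere _ (by fun_prop), hrank]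
    have : ∀ v : Metric.sphere (0 : (ℝ ∙ u)ᗮ) 1, ∫⁻ r in Set.Ioi (0 : ℝ),
        ENNReal.ofReal (r ^ (n + 1 - 1)) * G (t, ‖r • (v : (ℝ ∙ u)ᗮ)‖)
        = ∫⁻ s in Set.Ioi (0 : ℝ), ENNReal.ofReal (s ^ n) * G (t, s) := by
      intro v
      refine setLIntegral_congr_fun measurableSet_Ioi fun r hr => ?_
      have hr' : 0 < r := hr
      have hv : ‖(v : (ℝ ∙ u)ᗮ)‖ = 1 := by simp
      simp only [norm_smul, hv, mul_one, Real.norm_of_nonneg hr'.le, Nat.add_sub_cancel]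
    simp_rw [this]
    rw [lintegral_const, mul_comm, equatorMass]
  have h4 : ∫⁻ t : ℝ, ∫⁻ s in Set.Ioi (0 : ℝ), ENNReal.ofReal (s ^ n) * G (t, s)
      = radialMass (n + 1) * ∫⁻ φ in Set.Ioo 0 Real.pi,
          ENNReal.ofReal (Real.sin φ ^ n) * g (Real.cos φ) := by
    set H : ℝ × ℝ → ENNReal := fun p =>
      (Set.Ioi (0 : ℝ)).indicator (fun s => ENNReal.ofReal (s ^ n) * G (p.1, s)) p.2 with hH
    have hHm : Measurable H := by
      have : H = (Prod.snd ⁻¹' Set.Ioi (0 : ℝ)).indicator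
          (fun p : ℝ × ℝ => ENNReal.ofReal (p.2 ^ n) * G p) := by
        ext p; simp [hH, Set.indicator]
      rw [this]
      exact Measurable.indicator (by fun_prop) (measurable_snd measurableSet_Ioi)
    have e1 : ∫⁻ t : ℝ, ∫⁻ s in Set.Ioi (0 : ℝ), ENNReal.ofReal (s ^ n) * G (t, s)
        = ∫⁻ p : ℝ × ℝ, H p := by
      rw [Measure.volume_eq_prod, lintegral_prod _ hHm.aemeasurable]
      refine lintegral_congr fun t => ?_
      rw [← lintegral_indicator measurableSet_Ioi]
    have e2 : ∀ p ∈ polarCoord.target, ENNReal.ofReal p.1 • H (polarCoord.symm p)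
        = (ENNReal.ofReal (p.1 ^ (n + 1)) * (Set.Iio (1 : ℝ)).indicator 1 p.1)
          * (Set.Ioo 0 Real.pi).indicator
            (fun φ => ENNReal.ofReal (Real.sin φ ^ n) * g (Real.cos φ)) p.2 := by
      rintro ⟨ρ, φ⟩ ⟨hρ, hφ⟩
      have hρ' : 0 < ρ := hρ
      simp only [polarCoord_symm_apply, hH, smul_eq_mul]
      by_cases hs : φ ∈ Set.Ioo 0 Real.pi
      · have hsin := Real.sin_pos_of_mem_Ioo hs
        rw [Set.indicator_of_mem (show ρ * Real.sin φ ∈ Set.Ioi (0 : ℝ) from mul_pos hρ' hsin),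
          Set.indicator_of_mem hs]
        have hn : √((ρ * Real.cos φ) ^ 2 + (ρ * Real.sin φ) ^ 2) = ρ := by
          rw [show (ρ * Real.cos φ) ^ 2 + (ρ * Real.sin φ) ^ 2 = ρ ^ 2 by
            nlinarith [Real.sin_sq_add_cos_sq φ], Real.sqrt_sq hρ'.le]
        simp only [hG, hn]
        rw [← mul_assoc ρ⁻¹, inv_mul_cancel₀ hρ'.ne', one_mul, mul_pow,
          ENNReal.ofReal_mul (by positivity), pow_succ, ENNReal.ofReal_mul (by positivity)]
        ring
      · have hsin : ¬ (0 < Real.sin φ) := by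
          intro h
          apply hs
          refine ⟨?_, hφ.2⟩
          by_contra h0
          exact absurd (Real.sin_nonpos_of_nonpos_of_neg_pi_le (not_lt.1 h0) hφ.1.le) (not_le.2 h)
        rw [Set.indicator_of_notMem hs, Set.indicator_of_notMem, mul_zero, mul_zero]
        intro h
        exact hsin ((mul_pos_iff_of_pos_left hρ').1 h)
    rw [e1, ← lintegral_comp_polarCoord_symm,
      setLIntegral_congr_fun polarCoord.open_target.measurableSet e2, polarCoord_target,
      Measure.volume_eq_prod, ← Measure.prod_restrict, lintegral_prod_mul
        (f := fun ρ => ENNReal.ofReal (ρ ^ (n + 1)) * (Set.Iio (1 : ℝ)).indicator 1 ρ)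
        (g := (Set.Ioo 0 Real.pi).indicator
          (fun φ => ENNReal.ofReal (Real.sin φ ^ n) * g (Real.cos φ))) (by fun_prop)
        (Measurable.indicator (by fun_prop) measurableSet_Ioo).aemeasurable]
    congr 1
    rw [setLIntegral_indicator measurableSet_Ioo, Set.inter_eq_left.2]
    exact Set.Ioo_subset_Ioo_left (by linarith [Real.pi_pos])
  rw [h2] at h1
  simp_rw [h3] at h1
  rw [lintegral_const_mul _ (Measurable.lintegral_prod_right' (f := fun p : ℝ × ℝ =>
    ENNReal.ofReal (p.2 ^ n) * G p) (by fun_prop)), h4] at h1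
  have hr2 : finrank ℝ (Vec (n + 2)) - 1 = n + 1 := by simp
  rw [hr2, ← mul_assoc, mul_comm (equatorMass u), mul_assoc] at h1
  exact ((ENNReal.mul_right_inj (radialMass_ne_zero _) (radialMass_ne_top _)).1 h1).symm

end Sphere

/-! ### The normalizing constant of PrivUnit -/

section Scale

/-- The incomplete beta function with equal half-integer parameters, as a trigonometric
integral: substitute `s = (1 + cos φ) / 2`. -/
lemma incBeta_eq {n : ℕ} {φ₀ : ℝ} (h0 : 0 ≤ φ₀) (h1 : φ₀ ≤ Real.pi) :
    incBeta ((1 + Real.cos φ₀) / 2) (((n : ℝ) + 1) / 2) (((n : ℝ) + 1) / 2)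
      = (∫ φ in φ₀..Real.pi, Real.sin φ ^ n) / 2 ^ n := by
  have hθ : 0 ≤ (1 + Real.cos φ₀) / 2 := by linarith [Real.neg_one_le_cos φ₀]
  have himage : (fun φ => (1 + Real.cos φ) / 2) '' Set.Ioo φ₀ Real.pi
      = Set.Ioo 0 ((1 + Real.cos φ₀) / 2) := by
    ext s
    constructor
    · rintro ⟨φ, ⟨ha, hb⟩, rfl⟩
      have c1 : Real.cos φ < Real.cos φ₀ :=
        Real.strictAntiOn_cos ⟨h0, h1⟩ ⟨h0.trans ha.le, hb.le⟩ ha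
      have c2 : Real.cos Real.pi < Real.cos φ :=
        Real.strictAntiOn_cos ⟨h0.trans ha.le, hb.le⟩ ⟨Real.pi_pos.le, le_rfl⟩ hb
      rw [Real.cos_pi] at c2
      constructor
      · show 0 < (1 + Real.cos φ) / 2; linarith
      · show (1 + Real.cos φ) / 2 < _; linarith
    · rintro ⟨ha, hb⟩
      have e1 : 2 * s - 1 < Real.cos φ₀ := by linarith
      have e2 : Real.cos φ₀ ≤ 1 := Real.cos_le_one _
      have e3 : Real.cos (Real.arccos (2 * s - 1)) = 2 * s - 1 :=
        Real.cos_arccos (by linarith) (by linarith)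
      refine ⟨Real.arccos (2 * s - 1), ⟨?_, ?_⟩, ?_⟩
      · by_contra h
        have := Real.strictAntiOn_cos.antitoneOn
          ⟨Real.arccos_nonneg (2 * s - 1), Real.arccos_le_pi _⟩ ⟨h0, h1⟩ (not_lt.1 h)
        linarith
      · refine lt_of_le_of_ne (Real.arccos_le_pi _) fun h => ?_
        rw [h, Real.cos_pi] at e3
        linarith
      · simp only [e3]; ring
  have hinj : Set.InjOn (fun φ => (1 + Real.cos φ) / 2) (Set.Ioo φ₀ Real.pi) := by
    intro x hx y hy hxy
    refine Real.injOn_cos ⟨h0.trans hx.1.le, hx.2.le⟩ ⟨h0.trans hy.1.le, hy.2.le⟩ ?_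
    simp only at hxy
    linarith
  have hderiv : ∀ φ ∈ Set.Ioo φ₀ Real.pi, HasDerivWithinAt (fun φ => (1 + Real.cos φ) / 2)
      (-Real.sin φ / 2) (Set.Ioo φ₀ Real.pi) φ := fun φ _ =>
    (((Real.hasDerivAt_cos φ).const_add 1).div_const 2).hasDerivWithinAt
  rw [incBeta, intervalIntegral.integral_of_le hθ, integral_Ioc_eq_integral_Ioo, ← himage,
    integral_image_eq_integral_abs_deriv_smul measurableSet_Ioo hderiv hinj,
    intervalIntegral.integral_of_le h1, integral_Ioc_eq_integral_Ioo, ← integral_div]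
  refine setIntegral_congr_fun measurableSet_Ioo fun φ hφ => ?_
  have hsin : 0 < Real.sin φ := Real.sin_pos_of_pos_of_lt_pi (h0.trans_lt hφ.1) hφ.2
  have c1 : Real.cos φ < 1 := by
    nlinarith [Real.sin_sq_add_cos_sq φ, Real.cos_le_one φ, mul_pos hsin hsin]
  have c2 : -1 < Real.cos φ := by
    nlinarith [Real.sin_sq_add_cos_sq φ, Real.neg_one_le_cos φ, mul_pos hsin hsin]
  simp only [smul_eq_mul]
  rw [← Real.mul_rpow (by linarith) (by linarith)]
  have e1 : (1 + Real.cos φ) / 2 * (1 - (1 + Real.cos φ) / 2) = (Real.sin φ / 2) ^ (2 : ℝ) := by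
    rw [Real.rpow_two]
    nlinarith [Real.sin_sq_add_cos_sq φ]
  rw [e1, ← Real.rpow_mul (by positivity), neg_div, abs_neg, abs_of_pos (by positivity),
    show (2 : ℝ) * (((n : ℝ) + 1) / 2 - 1) = (n : ℝ) - 1 by ring,
    Real.rpow_sub_one (by positivity), Real.rpow_natCast, ← div_pow]
  field_simp

lemma intervalIntegrable_sin_pow (n : ℕ) (a b : ℝ) :
    IntervalIntegrable (fun φ => Real.sin φ ^ n) volume a b :=
  (Real.continuous_sin.pow n).intervalIntegrable a b

lemma integral_sin_pow_mul_cos_eq (n : ℕ) (φ₀ : ℝ) :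
    ∫ φ in (0 : ℝ)..φ₀, Real.sin φ ^ n * Real.cos φ = Real.sin φ₀ ^ (n + 1) / (n + 1) := by
  have h : ∀ φ ∈ Set.uIcc 0 φ₀, HasDerivAt (fun φ => Real.sin φ ^ (n + 1) / (n + 1))
      (Real.sin φ ^ n * Real.cos φ) φ := by
    intro φ _
    refine (((Real.hasDerivAt_sin φ).pow (n + 1)).div_const ((n : ℝ) + 1)).congr_deriv ?_
    have : (n : ℝ) + 1 ≠ 0 := by positivity
    push_cast
    field_simp
  rw [intervalIntegral.integral_eq_sub_of_hasDerivAt h (Continuous.intervalIntegrable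
    (by fun_prop) _ _)]
  simp

/-- The normalizing constant in terms of the angle `φ₀ = arccos γ`. -/
lemma privUnitScale_eq {n : ℕ} (ε₀ : ℝ) {φ₀ : ℝ} (h0 : 0 ≤ φ₀) (h1 : φ₀ ≤ Real.pi) :
    privUnitScale (n + 2) ε₀ (Real.cos φ₀) = Real.sin φ₀ ^ (n + 1) / (n + 1) *
      (capProb ε₀ / (∫ φ in (0 : ℝ)..φ₀, Real.sin φ ^ n)
        - (1 - capProb ε₀) / ∫ φ in φ₀..Real.pi, Real.sin φ ^ n) := by
  have hα : (((n + 2 : ℕ) : ℝ) - 1) / 2 = ((n : ℝ) + 1) / 2 := by push_cast; ring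
  have hs0 : 0 ≤ Real.sin φ₀ := Real.sin_nonneg_of_nonneg_of_le_pi h0 h1
  have hone : incBeta 1 (((n : ℝ) + 1) / 2) (((n : ℝ) + 1) / 2)
      = (∫ φ in (0 : ℝ)..Real.pi, Real.sin φ ^ n) / 2 ^ n := by
    rw [← incBeta_eq le_rfl Real.pi_pos.le, Real.cos_zero]; norm_num
  have hsplit := intervalIntegral.integral_add_adjacent_intervals
    (intervalIntegrable_sin_pow n 0 φ₀) (intervalIntegrable_sin_pow n φ₀ Real.pi)
  have hpow : (1 - Real.cos φ₀ ^ 2) ^ (((n : ℝ) + 1) / 2) = Real.sin φ₀ ^ (n + 1) := by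
    rw [← Real.sin_sq, ← Real.rpow_natCast (Real.sin φ₀) 2, ← Real.rpow_mul hs0,
      ← Real.rpow_natCast]
    congr 1
    push_cast
    ring
  have h2 : (2 : ℝ) ^ (((n + 2 : ℕ) : ℝ) - 2) = 2 ^ n := by
    rw [show ((n + 2 : ℕ) : ℝ) - 2 = (n : ℝ) by push_cast; ring, Real.rpow_natCast]
  simp only [privUnitScale]
  rw [hα, incBeta_eq h0 h1, hone, ← hsplit, hpow, h2]
  set C := ∫ φ in (0 : ℝ)..φ₀, Real.sin φ ^ n
  set D := ∫ φ in φ₀..Real.pi, Real.sin φ ^ n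
  have h3 : (C + D) / 2 ^ n - D / 2 ^ n = C / 2 ^ n := by ring
  have h4 : ((n + 2 : ℕ) : ℝ) - 1 = n + 1 := by push_cast; ring
  rw [h3, h4, div_div_eq_mul_div, div_div_eq_mul_div]
  field_simp

/-- The Wallis integrals are at most of order `1 / √n`. -/
lemma integral_sin_pow_sq_le (n : ℕ) :
    ((n : ℝ) + 1) * (∫ φ in (0 : ℝ)..Real.pi, Real.sin φ ^ n) ^ 2 ≤ 4 * Real.pi := by
  set Z : ℕ → ℝ := fun n => ∫ φ in (0 : ℝ)..Real.pi, Real.sin φ ^ n with hZ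
  have hpos : ∀ n, 0 < Z n := fun n => integral_sin_pow_pos n
  have hrec : ∀ n, Z (n + 2) = ((n : ℝ) + 1) / (n + 2) * Z n := by
    intro n
    simp only [hZ]
    rw [integral_sin_pow]
    simp
  have hwallis : ∀ n : ℕ, ((n : ℝ) + 1) * (Z n * Z (n + 1)) = 2 * Real.pi := by
    intro n
    induction n with
    | zero => simp [hZ]; norm_num; ring
    | succ n ih =>
      rw [hrec n, ← ih]
      push_cast
      field_simp
      ring
  have h1 : Z (n + 2) ≤ Z (n + 1) := integral_sin_pow_antitone (by omega)
  have h2 : Z n ≤ 2 * Z (n + 1) := by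
    have h3 : 1 / 2 ≤ ((n : ℝ) + 1) / (n + 2) := by
      rw [div_le_div_iff₀ (by norm_num) (by positivity)]
      have : (0 : ℝ) ≤ n := by positivity
      linarith
    have h4 := mul_le_mul_of_nonneg_right h3 (hpos n).le
    rw [← hrec n] at h4
    linarith
  calc ((n : ℝ) + 1) * Z n ^ 2 = ((n : ℝ) + 1) * (Z n * Z n) := by ring
    _ ≤ ((n : ℝ) + 1) * (Z n * (2 * Z (n + 1))) := by
        have := hpos n
        gcongr
    _ = 4 * Real.pi := by linear_combination 2 * hwallis n

/-- The central part of the mass, between the latitudes `γ` and `0`. -/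
lemma cos_mul_sin_pow_le_integral (n : ℕ) {φ₀ : ℝ} (h0 : 0 ≤ φ₀) (h1 : φ₀ ≤ Real.pi / 2) :
    Real.cos φ₀ * Real.sin φ₀ ^ n ≤ ∫ φ in φ₀..Real.pi / 2, Real.sin φ ^ n := by
  have hs0 : 0 ≤ Real.sin φ₀ :=
    Real.sin_nonneg_of_nonneg_of_le_pi h0 (by linarith [Real.pi_pos])
  have h2 : ∫ φ in φ₀..Real.pi / 2, Real.sin φ₀ ^ n ≤ ∫ φ in φ₀..Real.pi / 2, Real.sin φ ^ n := by
    refine intervalIntegral.integral_mono_on h1 (by simp) (intervalIntegrable_sin_pow n _ _) ?_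
    intro φ hφ
    exact pow_le_pow_left₀ hs0 (Real.sin_le_sin_of_le_of_le_pi_div_two
      (by linarith [Real.pi_pos]) hφ.2 hφ.1) n
  rw [intervalIntegral.integral_const, smul_eq_mul] at h2
  refine le_trans ?_ h2
  gcongr
  rw [← Real.sin_pi_div_two_sub]
  exact Real.sin_le (by linarith)

lemma half_le_sin_pow {n : ℕ} {φ₀ : ℝ} (h : Real.cos φ₀ ^ 2 * (n + 2) ≤ 1 / 2) : 1 / 2 ≤ Real.sin φ₀ ^ (2 * (n + 1)) := by
  have h3 : Real.sin φ₀ ^ 2 = 1 + -(Real.cos φ₀ ^ 2) := by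
    linarith [Real.sin_sq_add_cos_sq φ₀]
  rw [pow_mul, h3]
  have h4 := one_add_mul_le_pow (a := -(Real.cos φ₀ ^ 2))
    (by nlinarith [Real.cos_sq_le_one φ₀]) (n + 1)
  refine le_trans ?_ h4
  push_cast
  nlinarith [sq_nonneg (Real.cos φ₀)]

/-- The normalizing constant is at least of the order of the threshold. If `γ ≲ 1/√d`, then the
mean of the cap is of order `1/√d`, and the masses of the cap and its complement differ by a
fraction of order `γ √d`; if `γ ≳ 1/√d`, then the mean of the cap is at least `γ`, and its share
of the total mass is bounded away from `1/2`. -/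
lemma le_privUnitScale {n : ℕ} {ε₀ γ : ℝ} (hε : 0 < ε₀) (h0 : 0 < γ) (h1 : γ < 1) :
    γ / 16 ≤ privUnitScale (n + 2) ε₀ γ := by
  obtain ⟨φ₀, hφ₀⟩ : ∃ φ₀, φ₀ = Real.arccos γ := ⟨_, rfl⟩
  have hcos : Real.cos φ₀ = γ := by rw [hφ₀]; exact Real.cos_arccos (by linarith) h1.le
  have hpos : 0 < φ₀ := by rw [hφ₀]; exact Real.arccos_pos.2 h1
  have hle : φ₀ ≤ Real.pi / 2 := by rw [hφ₀]; exact Real.arccos_le_pi_div_two.2 h0.le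
  have hpi := Real.pi_pos
  have hle' : φ₀ ≤ Real.pi := by linarith
  have hsin : 0 < Real.sin φ₀ := Real.sin_pos_of_pos_of_lt_pi hpos (by linarith)
  have hsin1 := Real.sin_le_one φ₀
  rw [← hcos, privUnitScale_eq ε₀ hpos.le hle']
  set I := Real.sin φ₀ ^ (n + 1) / ((n : ℝ) + 1) with hI
  set C := ∫ φ in (0 : ℝ)..φ₀, Real.sin φ ^ n with hC
  set D := ∫ φ in φ₀..Real.pi, Real.sin φ ^ n with hD
  set B := ∫ φ in φ₀..Real.pi / 2, Real.sin φ ^ n with hB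
  set Z := ∫ φ in (0 : ℝ)..Real.pi, Real.sin φ ^ n with hZ
  have hI0 : 0 < I := by positivity
  have hZ0 : 0 < Z := integral_sin_pow_pos n
  have hZsq : ((n : ℝ) + 1) * Z ^ 2 ≤ 4 * Real.pi := integral_sin_pow_sq_le n
  have hC0 : 0 < C := intervalIntegral.intervalIntegral_pos_of_pos_on
    (intervalIntegrable_sin_pow n _ _) (fun φ hφ => pow_pos
      (Real.sin_pos_of_pos_of_lt_pi hφ.1 (by linarith [hφ.2])) n) hpos
  have hD0 : 0 < D := intervalIntegral.intervalIntegral_pos_of_pos_on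
    (intervalIntegrable_sin_pow n _ _) (fun φ hφ => pow_pos
      (Real.sin_pos_of_pos_of_lt_pi (hpos.trans hφ.1) hφ.2) n) (by linarith)
  have hCD : C + D = Z := intervalIntegral.integral_add_adjacent_intervals
    (intervalIntegrable_sin_pow n _ _) (intervalIntegrable_sin_pow n _ _)
  have hB0 : Real.cos φ₀ * Real.sin φ₀ ^ n ≤ B := cos_mul_sin_pow_le_integral n hpos.le hle
  have hDC : D - C = 2 * B := by
    have e1 : C + B = ∫ φ in (0 : ℝ)..Real.pi / 2, Real.sin φ ^ n :=
      intervalIntegral.integral_add_adjacent_intervals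
        (intervalIntegrable_sin_pow n _ _) (intervalIntegrable_sin_pow n _ _)
    have e2 : B + ∫ φ in Real.pi / 2..Real.pi, Real.sin φ ^ n = D :=
      intervalIntegral.integral_add_adjacent_intervals
        (intervalIntegrable_sin_pow n _ _) (intervalIntegrable_sin_pow n _ _)
    have e3 : ∫ φ in Real.pi / 2..Real.pi, Real.sin φ ^ n
        = ∫ φ in (0 : ℝ)..Real.pi / 2, Real.sin φ ^ n := by
      have := intervalIntegral.integral_comp_sub_left (a := 0) (b := Real.pi / 2)
        (fun φ => Real.sin φ ^ n) Real.pi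
      simp only [Real.sin_pi_sub] at this
      rw [this]
      congr 1 <;> ring
    linarith
  have hBnn : 0 < B := lt_of_lt_of_le (by rw [hcos]; positivity) hB0
  -- since `p ≥ 1/2`, the constant is at least its value for `p = 1/2`
  have hp : 1 / 2 ≤ capProb ε₀ := by
    unfold capProb
    have : 1 ≤ Real.exp ε₀ := Real.one_le_exp hε.le
    rw [div_le_div_iff₀ (by norm_num) (by positivity)]
    linarith
  have hm : I * B / (C * D) ≤ I * (capProb ε₀ / C - (1 - capProb ε₀) / D) := by
    have e1 : I * B / (C * D) = I * ((1 / 2) / C - (1 - 1 / 2) / D) := by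
      have : B = (D - C) / 2 := by linarith
      rw [this]
      field_simp
      ring
    rw [e1]
    gcongr
  refine le_trans ?_ hm
  by_cases hsmall : Real.cos φ₀ ^ 2 * (n + 2) ≤ 1 / 2
  · have e1 : C * D ≤ Z ^ 2 / 4 := by rw [← hCD]; nlinarith [sq_nonneg (C - D)]
    have e2 := half_le_sin_pow hsmall
    have e3 : Real.cos φ₀ / 2 ≤ ((n : ℝ) + 1) * (I * B) := by
      have e4 : ((n : ℝ) + 1) * (I * B) = Real.sin φ₀ ^ (n + 1) * B := by
        rw [hI]; field_simp
      rw [e4]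
      calc Real.cos φ₀ / 2 ≤ Real.cos φ₀ * Real.sin φ₀ ^ (2 * (n + 1)) := by
            rw [hcos]
            have := mul_le_mul_of_nonneg_left e2 h0.le
            linarith
        _ = Real.sin φ₀ ^ (n + 1) * (Real.cos φ₀ * Real.sin φ₀ ^ n) * Real.sin φ₀ := by ring
        _ ≤ Real.sin φ₀ ^ (n + 1) * B * 1 := by gcongr
        _ = _ := mul_one _
    rw [le_div_iff₀ (by positivity)]
    have hn : (0 : ℝ) < (n : ℝ) + 1 := by positivity
    have e5 : ((n : ℝ) + 1) * (C * D) ≤ Real.pi := by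
      have := mul_le_mul_of_nonneg_left e1 hn.le
      linarith
    have e6 : ((n : ℝ) + 1) * (Real.cos φ₀ / 16 * (C * D)) ≤ ((n : ℝ) + 1) * (I * B) := by
      refine le_trans ?_ e3
      have := mul_le_mul_of_nonneg_left (e5.trans Real.pi_le_four)
        (by rw [hcos]; positivity : 0 ≤ Real.cos φ₀ / 16)
      linarith
    exact le_of_mul_le_mul_left e6 hn
  · have hcap : Real.cos φ₀ * C ≤ I := by
      rw [hI, ← integral_sin_pow_mul_cos_eq, hC, ← intervalIntegral.integral_const_mul]
      refine intervalIntegral.integral_mono_on hpos.le (Continuous.intervalIntegrable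
        (by fun_prop) _ _) (Continuous.intervalIntegrable (by fun_prop) _ _) ?_
      intro φ hφ
      have c1 : Real.cos φ₀ ≤ Real.cos φ := Real.cos_le_cos_of_nonneg_of_le_pi hφ.1 hle' hφ.2
      have c2 : 0 ≤ Real.sin φ :=
        Real.sin_nonneg_of_nonneg_of_le_pi hφ.1 (by linarith [hφ.2])
      rw [mul_comm]
      gcongr
    -- compare with the threshold `1 / √(2 d)`
    set γ₁ := √(1 / (2 * ((n : ℝ) + 2))) with hγ₁
    have hγsq : γ₁ ^ 2 = 1 / (2 * ((n : ℝ) + 2)) := Real.sq_sqrt (by positivity)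
    have hγ₁0 : 0 < γ₁ := by positivity
    have hn0 : (0 : ℝ) ≤ n := by positivity
    have hγle : γ₁ ≤ γ := by
      refine (sq_le_sq₀ hγ₁0.le h0.le).1 ?_
      rw [hγsq, div_le_iff₀ (by positivity)]
      rw [hcos] at hsmall
      linarith
    have hc1 : Real.cos (Real.arccos γ₁) = γ₁ := Real.cos_arccos (by linarith) (by linarith)
    have hφ1 : φ₀ ≤ Real.arccos γ₁ := by rw [hφ₀]; exact Real.antitone_arccos hγle
    have hφ2 : Real.arccos γ₁ ≤ Real.pi / 2 := Real.arccos_le_pi_div_two.2 hγ₁0.le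
    have hB1 : γ₁ / 2 ≤ B := by
      have e1 := cos_mul_sin_pow_le_integral n (Real.arccos_nonneg γ₁) hφ2
      have e2 := half_le_sin_pow (n := n) (φ₀ := Real.arccos γ₁) (by
        rw [hc1, hγsq]; field_simp; norm_num)
      have e3 : Real.sin (Real.arccos γ₁) ^ (2 * (n + 1)) ≤ Real.sin (Real.arccos γ₁) ^ n :=
        pow_le_pow_of_le_one (Real.sin_nonneg_of_nonneg_of_le_pi (Real.arccos_nonneg γ₁)
          (Real.arccos_le_pi γ₁)) (Real.sin_le_one _) (by omega)
      have e4 : ∫ φ in Real.arccos γ₁..Real.pi / 2, Real.sin φ ^ n ≤ B := by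
        rw [hB, ← intervalIntegral.integral_add_adjacent_intervals
          (intervalIntegrable_sin_pow n φ₀ (Real.arccos γ₁)) (intervalIntegrable_sin_pow n _ _)]
        have : 0 ≤ ∫ φ in φ₀..Real.arccos γ₁, Real.sin φ ^ n :=
          intervalIntegral.integral_nonneg hφ1 fun φ hφ => pow_nonneg
            (Real.sin_nonneg_of_nonneg_of_le_pi (hpos.le.trans hφ.1) (by linarith [hφ.2])) n
        linarith
      rw [hc1] at e1
      have := mul_le_mul_of_nonneg_left (e2.trans e3) hγ₁0.le
      linarith
    have hBZ : Z / 16 ≤ B := by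
      refine le_trans ?_ hB1
      refine (sq_le_sq₀ (by positivity) (by positivity)).1 ?_
      rw [div_pow, div_pow, hγsq]
      have e1 : Z ^ 2 * (n + 2) ≤ 8 * Real.pi := by
        have := mul_nonneg hn0 (sq_nonneg Z)
        linarith
      have e2 : Z ^ 2 * (n + 2) ≤ 32 := by linarith [Real.pi_le_four]
      rw [div_div, div_le_div_iff₀ (by positivity) (by positivity)]
      linarith
    rw [le_div_iff₀ (by positivity)]
    have hDZ : D ≤ Z := by linarith
    calc Real.cos φ₀ / 16 * (C * D) ≤ Real.cos φ₀ / 16 * (C * Z) := by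
          have : 0 ≤ Real.cos φ₀ / 16 := by rw [hcos]; positivity
          gcongr
      _ = (Real.cos φ₀ * C) * (Z / 16) := by ring
      _ ≤ I * B := by gcongr

end Scale

/-! ### PrivUnit -/

section PrivUnit

open Module

/-- The surface measure of the unit sphere, as a measure on the ambient space. -/
noncomputable def surface (d : ℕ) : Measure (Vec d) :=
  (volume : Measure (Vec d)).toSphere.map Subtype.val

instance isFiniteMeasure_surface (d : ℕ) : IsFiniteMeasure (surface d) :=
  Measure.isFiniteMeasure_map _ _

/-- The half-space that cuts the cap of height `γ` around `u` out of the sphere. -/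
def cap {d : ℕ} (γ : ℝ) (u : Vec d) : Set (Vec d) := {x | γ ≤ inner ℝ x u}

lemma measurableSet_cap {d : ℕ} (γ : ℝ) (u : Vec d) : MeasurableSet (cap γ u) :=
  measurableSet_le measurable_const (by fun_prop)

lemma lintegral_surface {d : ℕ} {g : Vec d → ENNReal} (hg : Measurable g) :
    ∫⁻ x, g x ∂surface d = ∫⁻ v, g v ∂(volume : Measure (Vec d)).toSphere :=
  lintegral_map hg measurable_subtype_coe

lemma ae_surface_norm (d : ℕ) : ∀ᵐ x ∂surface d, ‖x‖ = 1 := by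
  rw [surface, ae_map_iff (by fun_prop) (measurableSet_eq_fun (by fun_prop) (by fun_prop))]
  exact Filter.Eventually.of_forall fun v => by simp

lemma map_surface {d : ℕ} [NeZero d] (T : Vec d ≃ₗᵢ[ℝ] Vec d) :
    MeasurePreserving T (surface d) (surface d) := by
  have hT : Measurable T := T.continuous.measurable
  refine ⟨hT, Measure.ext_of_lintegral _ fun g hg => ?_⟩
  rw [lintegral_map hg hT, lintegral_surface (g := fun x => g (T x)) (hg.comp hT), lintegral_surface hg]
  exact lintegral_toSphere_comp_isometry T hg

lemma integrable_id_surface (d : ℕ) : Integrable (fun x : Vec d => x) (surface d) :=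
  Integrable.of_bound (by fun_prop) 1 ((ae_surface_norm d).mono fun x hx => hx.le)

lemma uniformOnSphere_eq {d : ℕ} {A : Set (Vec d)} (hA : MeasurableSet A) :
    uniformOnSphere {v : Metric.sphere (0 : Vec d) 1 | (v : Vec d) ∈ A}
      = (surface d A)⁻¹ • (surface d).restrict A := by
  have h1 : {v : Metric.sphere (0 : Vec d) 1 | (v : Vec d) ∈ A} = Subtype.val ⁻¹' A := rfl
  rw [uniformOnSphere, ProbabilityTheory.cond, Measure.map_smul, h1, surface,
    Measure.restrict_map measurable_subtype_coe hA, Measure.map_apply measurable_subtype_coe hA]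

lemma uniformOnSphere_cap {d : ℕ} (γ : ℝ) (u : Vec d) :
    uniformOnSphere {v : Metric.sphere (0 : Vec d) 1 | γ ≤ inner ℝ (v : Vec d) u}
      = (surface d (cap γ u))⁻¹ • (surface d).restrict (cap γ u) := by
  rw [← uniformOnSphere_eq (measurableSet_cap γ u)]
  congr 1

lemma uniformOnSphere_compl_cap {d : ℕ} (γ : ℝ) (u : Vec d) :
    uniformOnSphere {v : Metric.sphere (0 : Vec d) 1 | inner ℝ (v : Vec d) u < γ}
      = (surface d (cap γ u)ᶜ)⁻¹ • (surface d).restrict (cap γ u)ᶜ := by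
  rw [← uniformOnSphere_eq (measurableSet_cap γ u).compl]
  congr 1
  ext v
  simp [cap]

section Cap

variable {n : ℕ} {u : Vec (n + 2)}

lemma equatorMass_ne_zero (hu : ‖u‖ = 1) : equatorMass u ≠ 0 := by
  have hu0 : u ≠ 0 := by rintro rfl; simp at hu
  have hrank : finrank ℝ (ℝ ∙ u)ᗮ = n + 1 := by
    have : Fact (finrank ℝ (Vec (n + 2)) = (n + 1) + 1) := ⟨by simp⟩
    exact Submodule.finrank_orthogonal_span_singleton hu0
  have : Nontrivial (ℝ ∙ u)ᗮ := Module.nontrivial_of_finrank_pos (R := ℝ) (by rw [hrank]; omega)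
  rw [equatorMass, Measure.measure_univ_ne_zero]
  exact Measure.toSphere_ne_zero _

lemma equatorMass_ne_top : equatorMass u ≠ ⊤ := measure_ne_top _ _

lemma lintegral_Ioc_ofReal {a b : ℝ} (hab : a ≤ b) {h : ℝ → ℝ} (hc : Continuous h)
    (h0 : ∀ x ∈ Set.Ioc a b, 0 ≤ h x) :
    ∫⁻ x in Set.Ioc a b, ENNReal.ofReal (h x) = ENNReal.ofReal (∫ x in a..b, h x) := by
  rw [intervalIntegral.integral_of_le hab, ofReal_integral_eq_lintegral_ofReal]
  · exact hc.integrableOn_Icc.mono_set Set.Ioc_subset_Icc_self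
  · filter_upwards [ae_restrict_mem measurableSet_Ioc] with x hx using h0 x hx

variable {φ₀ : ℝ}

lemma le_cos_iff (h0 : 0 ≤ φ₀) (h1 : φ₀ ≤ Real.pi) {φ : ℝ} (hφ : φ ∈ Set.Ioo 0 Real.pi) :
    Real.cos φ₀ ≤ Real.cos φ ↔ φ ≤ φ₀ :=
  Real.strictAntiOn_cos.le_iff_ge ⟨h0, h1⟩ ⟨hφ.1.le, hφ.2.le⟩

lemma surface_cap (hu : ‖u‖ = 1) (h0 : 0 ≤ φ₀) (h1 : φ₀ < Real.pi) :
    surface (n + 2) (cap (Real.cos φ₀) u)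
      = equatorMass u * ENNReal.ofReal (∫ φ in (0 : ℝ)..φ₀, Real.sin φ ^ n) := by
  have hm : Measurable ((Set.Ici (Real.cos φ₀)).indicator (1 : ℝ → ENNReal)) :=
    measurable_one.indicator measurableSet_Ici
  have e1 : surface (n + 2) (cap (Real.cos φ₀) u) = ∫⁻ x, (Set.Ici (Real.cos φ₀)).indicator 1
      (inner ℝ x u) ∂surface (n + 2) := by
    rw [← lintegral_indicator_one (measurableSet_cap _ _)]
    rfl
  rw [e1, lintegral_surface (by fun_prop), lintegral_toSphere_inner hu hm]
  congr 1
  have e2 : ∀ φ ∈ Set.Ioo 0 Real.pi, ENNReal.ofReal (Real.sin φ ^ n)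
      * (Set.Ici (Real.cos φ₀)).indicator 1 (Real.cos φ)
      = (Set.Iic φ₀).indicator (fun φ => ENNReal.ofReal (Real.sin φ ^ n)) φ := by
    intro φ hφ
    have := le_cos_iff h0 h1.le hφ
    simp only [Set.indicator, Set.mem_Ici, Set.mem_Iic, this]
    split_ifs <;> simp
  rw [setLIntegral_congr_fun measurableSet_Ioo e2, setLIntegral_indicator measurableSet_Iic]
  have e3 : Set.Iic φ₀ ∩ Set.Ioo 0 Real.pi = Set.Ioc 0 φ₀ := by
    ext φ
    simp only [Set.mem_inter_iff, Set.mem_Iic, Set.mem_Ioo, Set.mem_Ioc]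
    constructor
    · rintro ⟨a, b, c⟩; exact ⟨b, a⟩
    · rintro ⟨a, b⟩; exact ⟨b, a, b.trans_lt h1⟩
  rw [e3, lintegral_Ioc_ofReal h0 (by fun_prop)]
  intro φ hφ
  exact pow_nonneg (Real.sin_nonneg_of_nonneg_of_le_pi hφ.1.le (by linarith [hφ.2])) n

lemma surface_compl_cap (hu : ‖u‖ = 1) (h0 : 0 ≤ φ₀) (h1 : φ₀ < Real.pi) :
    surface (n + 2) (cap (Real.cos φ₀) u)ᶜ
      = equatorMass u * ENNReal.ofReal (∫ φ in φ₀..Real.pi, Real.sin φ ^ n) := by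
  have hm : Measurable ((Set.Iio (Real.cos φ₀)).indicator (1 : ℝ → ENNReal)) :=
    measurable_one.indicator measurableSet_Iio
  have e1 : surface (n + 2) (cap (Real.cos φ₀) u)ᶜ = ∫⁻ x, (Set.Iio (Real.cos φ₀)).indicator 1
      (inner ℝ x u) ∂surface (n + 2) := by
    rw [← lintegral_indicator_one (measurableSet_cap _ _).compl]
    refine lintegral_congr fun x => ?_
    simp [Set.indicator, cap]
  rw [e1, lintegral_surface (by fun_prop), lintegral_toSphere_inner hu hm]
  congr 1
  have e2 : ∀ φ ∈ Set.Ioo 0 Real.pi, ENNReal.ofReal (Real.sin φ ^ n)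
      * (Set.Iio (Real.cos φ₀)).indicator 1 (Real.cos φ)
      = (Set.Ioi φ₀).indicator (fun φ => ENNReal.ofReal (Real.sin φ ^ n)) φ := by
    intro φ hφ
    have := not_congr (le_cos_iff h0 h1.le hφ)
    simp only [not_le] at this
    simp only [Set.indicator, Set.mem_Iio, Set.mem_Ioi, this]
    split_ifs <;> simp
  rw [setLIntegral_congr_fun measurableSet_Ioo e2, setLIntegral_indicator measurableSet_Ioi]
  have e3 : Set.Ioi φ₀ ∩ Set.Ioo 0 Real.pi = Set.Ioo φ₀ Real.pi := by
    ext φ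
    simp only [Set.mem_inter_iff, Set.mem_Ioi, Set.mem_Ioo]
    constructor
    · rintro ⟨a, b, c⟩; exact ⟨a, c⟩
    · rintro ⟨a, b⟩; exact ⟨a, h0.trans_lt a, b⟩
  rw [e3, setLIntegral_congr Ioo_ae_eq_Ioc, lintegral_Ioc_ofReal h1.le (by fun_prop)]
  intro φ hφ
  exact pow_nonneg (Real.sin_nonneg_of_nonneg_of_le_pi (h0.trans hφ.1.le) hφ.2) n

lemma setIntegral_cap_inner (hu : ‖u‖ = 1) (h0 : 0 ≤ φ₀) (h1 : φ₀ ≤ Real.pi / 2) :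
    ∫ x in cap (Real.cos φ₀) u, inner ℝ x u ∂surface (n + 2)
      = (equatorMass u).toReal * (Real.sin φ₀ ^ (n + 1) / (n + 1)) := by
  have hpi := Real.pi_pos
  have hcos0 : 0 ≤ Real.cos φ₀ := Real.cos_nonneg_of_neg_pi_div_two_le_of_le (by linarith) h1
  set G : ℝ → ENNReal := (Set.Ici (Real.cos φ₀)).indicator ENNReal.ofReal with hG
  have hm : Measurable G := ENNReal.measurable_ofReal.indicator measurableSet_Ici
  have e1 : ∫⁻ x in cap (Real.cos φ₀) u, ENNReal.ofReal (inner ℝ x u) ∂surface (n + 2)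
      = equatorMass u * ENNReal.ofReal (Real.sin φ₀ ^ (n + 1) / (n + 1)) := by
    rw [← lintegral_indicator (measurableSet_cap _ _)]
    have : ∀ x : Vec (n + 2), (cap (Real.cos φ₀) u).indicator
        (fun x => ENNReal.ofReal (inner ℝ x u)) x = G (inner ℝ x u) := fun x => rfl
    simp_rw [this]
    rw [lintegral_surface (by fun_prop), lintegral_toSphere_inner hu hm]
    congr 1
    have e2 : ∀ φ ∈ Set.Ioo 0 Real.pi, ENNReal.ofReal (Real.sin φ ^ n) * G (Real.cos φ)
        = (Set.Iic φ₀).indicator (fun φ => ENNReal.ofReal (Real.sin φ ^ n * Real.cos φ)) φ := by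
      intro φ hφ
      have := le_cos_iff h0 (by linarith) hφ
      simp only [hG, Set.indicator, Set.mem_Ici, Set.mem_Iic, this]
      split_ifs
      · rw [ENNReal.ofReal_mul]
        exact pow_nonneg (Real.sin_pos_of_mem_Ioo hφ).le n
      · simp
    rw [setLIntegral_congr_fun measurableSet_Ioo e2, setLIntegral_indicator measurableSet_Iic]
    have e3 : Set.Iic φ₀ ∩ Set.Ioo 0 Real.pi = Set.Ioc 0 φ₀ := by
      ext φ
      simp only [Set.mem_inter_iff, Set.mem_Iic, Set.mem_Ioo, Set.mem_Ioc]
      constructor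
      · rintro ⟨a, b, c⟩; exact ⟨b, a⟩
      · rintro ⟨a, b⟩; exact ⟨b, a, by linarith⟩
    rw [e3, lintegral_Ioc_ofReal h0 (by fun_prop), integral_sin_pow_mul_cos_eq]
    intro φ hφ
    exact mul_nonneg (pow_nonneg (Real.sin_nonneg_of_nonneg_of_le_pi hφ.1.le
      (by linarith [hφ.2])) n) (Real.cos_nonneg_of_neg_pi_div_two_le_of_le
        (by linarith [hφ.1]) (by linarith [hφ.2]))
  rw [integral_eq_lintegral_of_nonneg_ae, e1, ENNReal.toReal_mul, ENNReal.toReal_ofReal]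
  · exact div_nonneg (pow_nonneg (Real.sin_nonneg_of_nonneg_of_le_pi h0 (by linarith)) _)
      (by positivity)
  · filter_upwards [ae_restrict_mem (measurableSet_cap _ _)] with x hx
    exact hcos0.trans hx
  · fun_prop

/-- By symmetry with respect to the axis `ℝ u`, the mean of the cap is a multiple of `u`. -/
lemma setIntegral_cap (γ : ℝ) (hu : ‖u‖ = 1) :
    ∫ x in cap γ u, x ∂surface (n + 2)
      = (∫ x in cap γ u, inner ℝ x u ∂surface (n + 2)) • u := by
  have hint : Integrable (fun x => x) ((surface (n + 2)).restrict (cap γ u)) :=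
    (integrable_id_surface _).integrableOn
  set T := (ℝ ∙ u).reflection with hT
  have hTu : T u = u :=
    Submodule.reflection_mem_subspace_eq_self (Submodule.mem_span_singleton_self u)
  have hpre : T ⁻¹' cap γ u = cap γ u := by
    ext x
    have : inner ℝ (T x) u = inner ℝ x u := by
      conv_lhs => rw [← hTu]
      exact T.inner_map_map x u
    simp [cap, this]
  have h1 := (map_surface T).setIntegral_preimage_emb T.toHomeomorph.measurableEmbedding
    (fun x => x) (cap γ u)
  rw [hpre] at h1
  have h2 : T (∫ x in cap γ u, x ∂surface (n + 2)) = ∫ x in cap γ u, x ∂surface (n + 2) := by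
    refine Eq.trans ?_ h1
    exact (ContinuousLinearMap.integral_comp_comm (T : Vec (n + 2) →L[ℝ] Vec (n + 2)) hint).symm
  rw [hT, Submodule.reflection_eq_self_iff, Submodule.mem_span_singleton] at h2
  obtain ⟨a, ha⟩ := h2
  have h3 : ∫ x in cap γ u, inner ℝ x u ∂surface (n + 2) = a := by
    have h4 : ∫ x in cap γ u, inner ℝ x u ∂surface (n + 2)
        = inner ℝ u (∫ x in cap γ u, x ∂surface (n + 2)) := by
      rw [← integral_inner hint u]
      exact integral_congr_ae (Filter.Eventually.of_forall fun x => real_inner_comm u x)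
    rw [h4, ← ha, real_inner_smul_right, real_inner_self_eq_norm_sq, hu]
    ring
  rw [h3, ha]

lemma setIntegral_compl_cap (γ : ℝ) (u : Vec (n + 2)) :
    ∫ x in (cap γ u)ᶜ, x ∂surface (n + 2) = -∫ x in cap γ u, x ∂surface (n + 2) := by
  have h1 : ∫ x, x ∂surface (n + 2) = 0 := by
    have h := (map_surface (LinearIsometryEquiv.neg ℝ (E := Vec (n + 2)))).integral_comp
      (LinearIsometryEquiv.neg ℝ (E := Vec (n + 2))).toHomeomorph.measurableEmbedding (fun x => x)
    have h' : -∫ x : Vec (n + 2), x ∂surface (n + 2) = ∫ x, x ∂surface (n + 2) := by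
      have e := integral_neg (μ := surface (n + 2)) (fun x : Vec (n + 2) => x)
      exact e.symm.trans h
    have h2 : (2 : ℝ) • ∫ x : Vec (n + 2), x ∂surface (n + 2) = 0 := by
      rw [two_smul]
      nth_rewrite 1 [← h']
      exact neg_add_cancel _
    exact (smul_eq_zero.1 h2).resolve_left two_ne_zero
  have h2 := integral_add_compl (measurableSet_cap γ u) (integrable_id_surface (n + 2))
  rw [h1] at h2
  exact eq_neg_of_add_eq_zero_right h2

end Cap

variable {n : ℕ} {u : Vec (n + 2)} {ε₀ γ : ℝ}

lemma capProb_mem (ε₀ : ℝ) : 0 ≤ capProb ε₀ ∧ 0 ≤ 1 - capProb ε₀ := by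
  have := Real.exp_pos ε₀
  unfold capProb
  refine ⟨by positivity, ?_⟩
  rw [sub_nonneg, div_le_one (by positivity)]
  linarith

lemma surface_cap_pos (hu : ‖u‖ = 1) (h0 : 0 < γ) (h1 : γ < 1) :
    surface (n + 2) (cap γ u) ≠ 0 ∧ surface (n + 2) (cap γ u)ᶜ ≠ 0 := by
  obtain ⟨φ₀, hφ₀⟩ : ∃ φ₀, φ₀ = Real.arccos γ := ⟨_, rfl⟩
  have hcos : Real.cos φ₀ = γ := by rw [hφ₀]; exact Real.cos_arccos (by linarith) h1.le
  have hpos : 0 < φ₀ := by rw [hφ₀]; exact Real.arccos_pos.2 h1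
  have hle : φ₀ ≤ Real.pi / 2 := by rw [hφ₀]; exact Real.arccos_le_pi_div_two.2 h0.le
  have hpi := Real.pi_pos
  have hC0 : 0 < ∫ φ in (0 : ℝ)..φ₀, Real.sin φ ^ n :=
    intervalIntegral.intervalIntegral_pos_of_pos_on
    (intervalIntegrable_sin_pow n _ _) (fun φ hφ => pow_pos
      (Real.sin_pos_of_pos_of_lt_pi hφ.1 (by linarith [hφ.2])) n) hpos
  have hD0 : 0 < ∫ φ in φ₀..Real.pi, Real.sin φ ^ n :=
    intervalIntegral.intervalIntegral_pos_of_pos_on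
    (intervalIntegrable_sin_pow n _ _) (fun φ hφ => pow_pos
      (Real.sin_pos_of_pos_of_lt_pi (hpos.trans hφ.1) hφ.2) n) (by linarith)
  rw [← hcos, surface_cap hu hpos.le (by linarith), surface_compl_cap hu hpos.le (by linarith)]
  exact ⟨mul_ne_zero (equatorMass_ne_zero hu) (by simpa using hC0),
    mul_ne_zero (equatorMass_ne_zero hu) (by simpa using hD0)⟩

lemma isProbabilityMeasure_privUnit (hu : ‖u‖ = 1) (h0 : 0 < γ) (h1 : γ < 1) :
    IsProbabilityMeasure (privUnit ε₀ γ u) := by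
  obtain ⟨hc, hd⟩ := surface_cap_pos hu h0 h1
  obtain ⟨hp, hp'⟩ := capProb_mem ε₀
  refine ⟨?_⟩
  rw [privUnit, Measure.map_apply (by fun_prop) .univ, uniformOnSphere_cap,
    uniformOnSphere_compl_cap]
  simp only [Set.preimage_univ, Measure.add_apply, Measure.smul_apply, Measure.restrict_apply_univ,
    smul_eq_mul]
  rw [ENNReal.inv_mul_cancel hc (measure_ne_top _ _), ENNReal.inv_mul_cancel hd (measure_ne_top _ _),
    mul_one, mul_one, ← ENNReal.ofReal_add hp hp']
  simp

lemma ae_privUnit_norm (hm : 0 < privUnitScale (n + 2) ε₀ γ) :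
    ∀ᵐ z ∂privUnit ε₀ γ u, privUnitScale (n + 2) ε₀ γ * ‖z‖ = 1 := by
  rw [privUnit, uniformOnSphere_cap, uniformOnSphere_compl_cap, ae_map_iff (by fun_prop)
    (measurableSet_eq_fun (by fun_prop) (by fun_prop)), ae_add_measure_iff]
  have h : ∀ x : Vec (n + 2), ‖x‖ = 1 → privUnitScale (n + 2) ε₀ γ
      * ‖(1 / privUnitScale (n + 2) ε₀ γ) • x‖ = 1 := by
    intro x hx
    rw [norm_smul, hx, mul_one, Real.norm_of_nonneg (by positivity)]
    field_simp
  have h2 : ∀ A, ∀ᵐ x ∂(surface (n + 2)).restrict A, privUnitScale (n + 2) ε₀ γ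
      * ‖(1 / privUnitScale (n + 2) ε₀ γ) • x‖ = 1 := fun A =>
    (ae_restrict_of_ae (ae_surface_norm (n + 2))).mono h
  exact ⟨Measure.ae_smul_measure (Measure.ae_smul_measure (h2 _) _) _,
    Measure.ae_smul_measure (Measure.ae_smul_measure (h2 _) _) _⟩

lemma integral_privUnit_eq (hu : ‖u‖ = 1) (h0 : 0 < γ) (h1 : γ < 1) :
    ∫ z, z ∂privUnit ε₀ γ u
      = (((∫ x in cap γ u, inner ℝ x u ∂surface (n + 2)) / privUnitScale (n + 2) ε₀ γ)
        * (capProb ε₀ / (surface (n + 2) (cap γ u)).toReal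
          - (1 - capProb ε₀) / (surface (n + 2) (cap γ u)ᶜ).toReal)) • u := by
  obtain ⟨hc, hd⟩ := surface_cap_pos hu h0 h1
  obtain ⟨hp, hp'⟩ := capProb_mem ε₀
  have hint : ∀ A, Integrable (fun x : Vec (n + 2) =>
      (1 / privUnitScale (n + 2) ε₀ γ) • x) ((surface (n + 2)).restrict A) := fun A =>
    ((integrable_id_surface (n + 2)).integrableOn (s := A)).smul
      (1 / privUnitScale (n + 2) ε₀ γ)
  rw [privUnit, integral_map (by fun_prop) (by fun_prop), uniformOnSphere_cap,
    uniformOnSphere_compl_cap, integral_add_measure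
      (((hint _).smul_measure (ENNReal.inv_ne_top.2 hc)).smul_measure ENNReal.ofReal_ne_top)
      (((hint _).smul_measure (ENNReal.inv_ne_top.2 hd)).smul_measure ENNReal.ofReal_ne_top)]
  simp only [integral_smul_measure]
  rw [integral_smul, integral_smul, setIntegral_compl_cap, setIntegral_cap γ hu]
  simp only [ENNReal.toReal_inv, ENNReal.toReal_ofReal hp, ENNReal.toReal_ofReal hp', smul_neg,
    smul_smul]
  rw [← sub_eq_add_neg, ← sub_smul]
  congr 1
  ring

/-- PrivUnit is unbiased: the normalizing constant is the mean of `⟨V, u⟩`. -/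
lemma integral_privUnit (hu : ‖u‖ = 1) (hε : 0 < ε₀) (h0 : 0 < γ) (h1 : γ < 1) :
    ∫ z, z ∂privUnit ε₀ γ u = u := by
  have hm0 : 0 < privUnitScale (n + 2) ε₀ γ :=
    lt_of_lt_of_le (by positivity) (le_privUnitScale hε h0 h1)
  obtain ⟨φ₀, hφ₀⟩ : ∃ φ₀, φ₀ = Real.arccos γ := ⟨_, rfl⟩
  have hcos : Real.cos φ₀ = γ := by rw [hφ₀]; exact Real.cos_arccos (by linarith) h1.le
  have hpos : 0 < φ₀ := by rw [hφ₀]; exact Real.arccos_pos.2 h1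
  have hle : φ₀ ≤ Real.pi / 2 := by rw [hφ₀]; exact Real.arccos_le_pi_div_two.2 h0.le
  have hpi := Real.pi_pos
  have hscale := privUnitScale_eq (n := n) ε₀ hpos.le (by linarith : φ₀ ≤ Real.pi)
  have hS := setIntegral_cap_inner hu hpos.le hle
  have hA := surface_cap hu hpos.le (by linarith : φ₀ < Real.pi)
  have hB := surface_compl_cap hu hpos.le (by linarith : φ₀ < Real.pi)
  rw [hcos] at hscale hS hA hB
  have hC0 : 0 ≤ ∫ φ in (0 : ℝ)..φ₀, Real.sin φ ^ n :=
    intervalIntegral.integral_nonneg hpos.le fun φ hφ => pow_nonneg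
      (Real.sin_nonneg_of_nonneg_of_le_pi hφ.1 (by linarith [hφ.2])) n
  have hD0 : 0 ≤ ∫ φ in φ₀..Real.pi, Real.sin φ ^ n :=
    intervalIntegral.integral_nonneg (by linarith) fun φ hφ => pow_nonneg
      (Real.sin_nonneg_of_nonneg_of_le_pi (hpos.le.trans hφ.1) hφ.2) n
  have hq : 0 < (equatorMass u).toReal :=
    ENNReal.toReal_pos (equatorMass_ne_zero hu) equatorMass_ne_top
  rw [integral_privUnit_eq hu h0 h1, hA, hB, hS]
  simp only [ENNReal.toReal_mul, ENNReal.toReal_ofReal hC0, ENNReal.toReal_ofReal hD0]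
  have e : ∀ Q s p C D m : ℝ, Q ≠ 0 → Q * s / m * (p / (Q * C) - (1 - p) / (Q * D))
      = s * (p / C - (1 - p) / D) / m := by
    intro Q s p C D m hQ
    rw [div_mul_eq_div_div, div_mul_eq_div_div]
    field_simp
  rw [e _ _ _ _ _ _ hq.ne', ← hscale, div_self hm0.ne', one_smul]

lemma measurable_privUnit {α : Type*} [MeasurableSpace α] {d : ℕ} {g : α → Vec d}
    (hg : Measurable g) : Measurable fun a => privUnit ε₀ γ (g a) := by
  have hB : MeasurableSet {p : α × Vec d | γ ≤ inner ℝ p.2 (g p.1)} :=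
    measurableSet_le measurable_const (by fun_prop)
  have key : ∀ {B : Set (α × Vec d)}, MeasurableSet B →
      Measurable fun a => (surface d (Prod.mk a ⁻¹' B))⁻¹ • (surface d).restrict (Prod.mk a ⁻¹' B) := by
    intro B hB
    refine Measure.measurable_of_measurable_coe _ fun s hs => ?_
    simp only [Measure.smul_apply, smul_eq_mul, Measure.restrict_apply hs]
    refine (measurable_measure_prodMk_left hB).inv.mul ?_
    exact measurable_measure_prodMk_left ((measurable_snd hs).inter hB)
  have h1 := key hB
  have h2 := key hB.compl
  have h3 : Measurable fun a => ENNReal.ofReal (capProb ε₀) •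
      uniformOnSphere {v : Metric.sphere (0 : Vec d) 1 | γ ≤ inner ℝ (v : Vec d) (g a)}
    + ENNReal.ofReal (1 - capProb ε₀) •
      uniformOnSphere {v : Metric.sphere (0 : Vec d) 1 | inner ℝ (v : Vec d) (g a) < γ} := by
    refine Measure.measurable_of_measurable_coe _ fun s hs => ?_
    simp only [uniformOnSphere_cap, uniformOnSphere_compl_cap, Measure.add_apply,
      Measure.smul_apply (ENNReal.ofReal _), smul_eq_mul]
    exact (((Measure.measurable_coe hs).comp h1).const_mul _).add
      (((Measure.measurable_coe hs).comp h2).const_mul _)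
  exact (Measure.measurable_map _ (by fun_prop)).comp h3

end PrivUnit

/-! ### The PrivUnit mechanism -/

section Direction

variable {d : ℕ} {e Δ : Vec d}

lemma norm_direction (he : ‖e‖ = 1) (Δ : Vec d) : ‖direction e Δ‖ = 1 := by
  unfold direction
  split_ifs with h
  · exact he
  · rw [norm_smul, Real.norm_of_nonneg (by positivity), one_div,
      inv_mul_cancel₀ (norm_ne_zero_iff.2 h)]

lemma norm_smul_direction (e Δ : Vec d) : ‖Δ‖ • direction e Δ = Δ := by
  unfold direction
  split_ifs with h
  · simp [h]
  · rw [smul_smul, mul_one_div, div_self (norm_ne_zero_iff.2 h), one_smul]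

lemma measurable_direction (e : Vec d) : Measurable (direction e) := by
  unfold direction
  exact Measurable.ite (measurableSet_eq_fun measurable_id measurable_const) measurable_const
    (by fun_prop)

end Direction

section Estimate

variable {d : ℕ} {C ε₀ γ ε₂ : ℝ}

lemma measurable_recoveredNorm :
    Measurable (recoveredNorm C ε₀ γ ε₂ : Vec d → ℝ) := by
  unfold recoveredNorm
  refine Measurable.ite ?_ (by fun_prop) (by fun_prop)
  have h : Measurable fun c : Vec d =>
    privUnitScale d ε₀ γ * ‖c‖ / scalarA C ε₂ + scalarB ε₂ := by fun_prop
  exact h (Set.countable_range (Int.cast : ℤ → ℝ)).measurableSet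

lemma measurable_sqNormEstimate :
    Measurable (sqNormEstimate C ε₀ γ ε₂ : Vec d → ℝ) := by
  have := measurable_recoveredNorm (d := d) (C := C) (ε₀ := ε₀) (γ := γ) (ε₂ := ε₂)
  unfold sqNormEstimate
  fun_prop

/-- The server recovers `r̂` from the message `r̂ z`, because `‖z‖ = 1 / m`. -/
lemma sqNormEstimate_smul (hε : 0 < ε₂) (hC : 0 < C)
    (hb : ∀ n : ℤ, (scalarK ε₂ : ℝ) * (scalarK ε₂ + 1) / (Real.exp ε₂ + scalarK ε₂) ≠ n)
    (l : ℕ) {z : Vec d} (hz : privUnitScale d ε₀ γ * ‖z‖ = 1) :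
    sqNormEstimate C ε₀ γ ε₂ ((scalarA C ε₂ * ((l : ℝ) - scalarB ε₂)) • z)
      = sqEstimate C ε₂ (scalarA C ε₂ * ((l : ℝ) - scalarB ε₂)) := by
  have h := sign_recovery hε hC hb l
  set ρ := scalarA C ε₂ * ((l : ℝ) - scalarB ε₂)
  have h1 : privUnitScale d ε₀ γ * ‖ρ • z‖ = |ρ| := by
    rw [norm_smul, mul_left_comm, hz, mul_one, Real.norm_eq_abs]
  have h2 : recoveredNorm C ε₀ γ ε₂ (ρ • z) = ρ := by
    unfold recoveredNorm
    simp only [h1, h]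
    split_ifs with h3
    · exact abs_of_nonneg h3
    · rw [abs_of_neg (not_le.1 h3), neg_neg]
  rw [sqNormEstimate, h2, sqEstimate]

end Estimate

section Mechanism

variable {n : ℕ} {C ε₀ γ ε₂ : ℝ} {e Δ : Vec (n + 2)}

lemma isProbabilityMeasure_privUnitMechanism (hC : 0 < C) (h0 : 0 < γ) (h1 : γ < 1)
    (he : ‖e‖ = 1) (hΔ : ‖Δ‖ ≤ C) :
    IsProbabilityMeasure (privUnitMechanism C ε₀ γ ε₂ e Δ) := by
  have := isProbabilityMeasure_scalarDP (ε := ε₂) hC (norm_nonneg Δ) hΔ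
  have := isProbabilityMeasure_privUnit (ε₀ := ε₀) (norm_direction he Δ) h0 h1
  exact Measure.isProbabilityMeasure_map (by fun_prop)

lemma measurable_privUnitMechanism (hC : 0 < C) (h0 : 0 < γ) (h1 : γ < 1) (he : ‖e‖ = 1)
    {h : Vec (n + 2) → Vec (n + 2)} (hh : Measurable h) (hle : ∀ w, ‖h w‖ ≤ C) :
    Measurable fun w => privUnitMechanism C ε₀ γ ε₂ e (h w) := by
  have := fun w => isProbabilityMeasure_scalarDP (ε := ε₂) hC (norm_nonneg (h w)) (hle w)
  have := fun w => isProbabilityMeasure_privUnit (ε₀ := ε₀) (norm_direction he (h w)) h0 h1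
  have hm : Measurable fun x : ℝ × Vec (n + 2) => x.1 • x.2 := by fun_prop
  exact (Measure.measurable_map _ hm).comp
    (measurable_measure_prod (measurable_scalarDP.comp hh.norm)
      (measurable_privUnit ((measurable_direction e).comp hh)))

lemma ae_prod_scalarDP_privUnit (hm : 0 < privUnitScale (n + 2) ε₀ γ) {r : ℝ}
    {u : Vec (n + 2)} {p : ℝ × Vec (n + 2) → Prop}
    (hp : ∀ l ≤ scalarK ε₂, ∀ z : Vec (n + 2), privUnitScale (n + 2) ε₀ γ * ‖z‖ = 1 →
      p (scalarA C ε₂ * ((l : ℝ) - scalarB ε₂), z)) :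
    ∀ᵐ x ∂(scalarDP C ε₂ r).prod (privUnit ε₀ γ u), p x := by
  have h1 : ∀ᵐ ρ ∂scalarDP C ε₂ r, ∃ l ≤ scalarK ε₂, ρ = scalarA C ε₂ * ((l : ℝ) - scalarB ε₂) :=
    ae_scalarDP fun l hl => ⟨l, hl, rfl⟩
  have h2 := ae_privUnit_norm (u := u) hm
  filter_upwards [Measure.quasiMeasurePreserving_fst.ae h1,
    Measure.quasiMeasurePreserving_snd.ae h2] with x hx1 hx2
  obtain ⟨l, hl, hρ⟩ := hx1
  have := hp l hl x.2 hx2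
  rw [← hρ] at this
  exact this

lemma ae_privUnitMechanism_norm_le (hε : 0 < ε₂) (hC : 0 < C)
    (hm : 0 < privUnitScale (n + 2) ε₀ γ) :
    ∀ᵐ x ∂privUnitMechanism C ε₀ γ ε₂ e Δ,
      ‖x‖ ≤ (1 + normC₁ ε₂) * C / privUnitScale (n + 2) ε₀ γ := by
  rw [privUnitMechanism, ae_map_iff (by fun_prop)
    (measurableSet_le (by fun_prop) measurable_const)]
  refine ae_prod_scalarDP_privUnit hm fun l hl z hz => ?_
  rw [norm_smul, le_div_iff₀ hm, mul_assoc, mul_comm ‖z‖, hz, mul_one]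
  exact abs_scalar_value_le hε hC hl

lemma integral_privUnitMechanism (hε₀ : 0 < ε₀) (hε : 0 < ε₂) (hC : 0 < C) (h0 : 0 < γ)
    (h1 : γ < 1) (he : ‖e‖ = 1) (hΔ : ‖Δ‖ ≤ C) :
    ∫ x, x ∂privUnitMechanism C ε₀ γ ε₂ e Δ = Δ := by
  have := isProbabilityMeasure_scalarDP (ε := ε₂) hC (norm_nonneg Δ) hΔ
  have := isProbabilityMeasure_privUnit (ε₀ := ε₀) (norm_direction he Δ) h0 h1
  have h := integral_prod_smul (μ := scalarDP C ε₂ ‖Δ‖) (ν := privUnit ε₀ γ (direction e Δ))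
    (fun x : ℝ => x) (fun z : Vec (n + 2) => z)
  rw [privUnitMechanism, integral_map (by fun_prop) (by fun_prop), h,
    integral_scalarDP hC (norm_nonneg Δ), scalarExp_value hε hC (norm_nonneg Δ) hΔ,
    integral_privUnit (norm_direction he Δ) hε₀ h0 h1, norm_smul_direction]

lemma lintegral_exp_sqNormEstimate_le {κ : ℝ} (hκ : 0 < κ) (hε : κ ≤ ε₂) (hC : 0 < C)
    (h0 : 0 < γ) (h1 : γ < 1) (hm : 0 < privUnitScale (n + 2) ε₀ γ)
    (hb : ∀ n : ℤ, (scalarK ε₂ : ℝ) * (scalarK ε₂ + 1) / (Real.exp ε₂ + scalarK ε₂) ≠ n)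
    (he : ‖e‖ = 1) (hΔ : ‖Δ‖ ≤ C) :
    ∫⁻ x, ENNReal.ofReal (Real.exp (1 / (104 * scalarBound κ ^ 2 * C ^ 2)
      * (sqNormEstimate C ε₀ γ ε₂ x - 2 * ‖Δ‖ ^ 2))) ∂privUnitMechanism C ε₀ γ ε₂ e Δ ≤ 1 := by
  have := isProbabilityMeasure_scalarDP (ε := ε₂) hC (norm_nonneg Δ) hΔ
  have := isProbabilityMeasure_privUnit (ε₀ := ε₀) (norm_direction he Δ) h0 h1
  have hms := measurable_sqNormEstimate (d := n + 2) (C := C) (ε₀ := ε₀) (γ := γ) (ε₂ := ε₂)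
  have hmS : Measurable fun ρ => sqEstimate C ε₂ ρ := by unfold sqEstimate; fun_prop
  rw [privUnitMechanism, lintegral_map (by fun_prop) (by fun_prop)]
  have hae := ae_prod_scalarDP_privUnit (C := C) (ε₂ := ε₂) (r := ‖Δ‖) (u := direction e Δ)
    (p := fun x => ENNReal.ofReal (Real.exp (1 / (104 * scalarBound κ ^ 2 * C ^ 2)
      * (sqNormEstimate C ε₀ γ ε₂ (x.1 • x.2) - 2 * ‖Δ‖ ^ 2)))
      = ENNReal.ofReal (Real.exp (1 / (104 * scalarBound κ ^ 2 * C ^ 2)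
      * (sqEstimate C ε₂ x.1 - 2 * ‖Δ‖ ^ 2)))) hm fun l _ z hz => by
        rw [sqNormEstimate_smul (hκ.trans_le hε) hC hb l hz]
  have hF : Measurable fun ρ => Real.exp (1 / (104 * scalarBound κ ^ 2 * C ^ 2)
      * (sqEstimate C ε₂ ρ - 2 * ‖Δ‖ ^ 2)) := by fun_prop
  have hfst := (measurePreserving_fst (μ := scalarDP C ε₂ ‖Δ‖)
    (ν := privUnit ε₀ γ (direction e Δ))).lintegral_comp hF.ennreal_ofReal
  rw [lintegral_congr_ae hae, hfst, lintegral_ofReal_scalarDP hC (norm_nonneg Δ) hF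
    fun _ => (Real.exp_pos _).le]
  exact ENNReal.ofReal_le_one.2 (scalarExp_exp_le hκ hε hC (norm_nonneg Δ) hΔ)

end Mechanism

/-! ### Concentration for PrivUnit -/

section Bounded

open ProbabilityTheory

variable {d : ℕ}

/-- The one-step estimate of `lintegral_exp_norm_add_sum_le` for bounded centred noise, by
Hoeffding's lemma for its component along `s`. -/
lemma lintegral_exp_norm_sq_le_of_bounded {μ : Measure (Vec d)} [IsProbabilityMeasure μ]
    {m : Vec d} {R : ℝ} (hR : 0 < R) (hb : ∀ᵐ x ∂μ, ‖x - m‖ ≤ R) (hm : ∫ x, x ∂μ = m) (s : Vec d)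
    {A : ℝ} (hA : 0 < A) :
    ∫⁻ x, ENNReal.ofReal (Real.exp (‖s + (x - m)‖ ^ 2 / (2 * R ^ 2 * (A + 1)))) ∂μ
      ≤ ENNReal.ofReal (Real.exp (1 / 2 / A + ‖s‖ ^ 2 / (2 * R ^ 2 * A))) := by
  set X : Vec d → ℝ := fun x => inner ℝ s (x - m) with hX
  have hint : Integrable (fun x : Vec d => x - m) μ := Integrable.of_bound (by fun_prop) R hb
  have hmean : ∫ x, X x ∂μ = 0 := by
    have hid : Integrable (fun x : Vec d => x) μ := by
      exact (hint.add (integrable_const m)).congr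
        (Filter.Eventually.of_forall fun x => sub_add_cancel x m)
    rw [hX, integral_inner hint s, integral_sub hid (integrable_const m), hm]
    simp
  have hXb : ∀ᵐ x ∂μ, X x ∈ Set.Icc (-(R * ‖s‖)) (R * ‖s‖) := by
    filter_upwards [hb] with x hx
    have h1 : |X x| ≤ R * ‖s‖ := (abs_real_inner_le_norm s (x - m)).trans (by
      rw [mul_comm]; gcongr)
    exact abs_le.1 h1
  have hsub := hasSubgaussianMGF_of_mem_Icc_of_integral_eq_zero (μ := μ) (X := X)
    (by fun_prop) hXb hmean
  set t := 1 / (R ^ 2 * (A + 1)) with ht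
  have h2 := hsub.mgf_le t
  have hc : (((‖R * ‖s‖ - -(R * ‖s‖)‖₊ / 2) ^ 2 : NNReal) : ℝ) = R ^ 2 * ‖s‖ ^ 2 := by
    push_cast
    rw [sub_neg_eq_add, ← two_mul, norm_mul, Real.norm_of_nonneg (by positivity : 0 ≤ R * ‖s‖)]
    norm_num
    ring
  rw [hc, mgf] at h2
  have h3 : ∫⁻ x, ENNReal.ofReal (Real.exp (t * X x)) ∂μ
      ≤ ENNReal.ofReal (Real.exp (R ^ 2 * ‖s‖ ^ 2 * t ^ 2 / 2)) := by
    rw [← ofReal_integral_eq_lintegral_ofReal (hsub.integrable_exp_mul t)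
      (Filter.Eventually.of_forall fun _ => (Real.exp_pos _).le)]
    exact ENNReal.ofReal_le_ofReal h2
  have h4 : ∀ᵐ x ∂μ, ENNReal.ofReal (Real.exp (‖s + (x - m)‖ ^ 2 / (2 * R ^ 2 * (A + 1))))
      ≤ ENNReal.ofReal (Real.exp ((‖s‖ ^ 2 + R ^ 2) / (2 * R ^ 2 * (A + 1))))
        * ENNReal.ofReal (Real.exp (t * X x)) := by
    filter_upwards [hb] with x hx
    rw [← ENNReal.ofReal_mul (Real.exp_pos _).le, ← Real.exp_add]
    refine ENNReal.ofReal_le_ofReal (Real.exp_le_exp.2 ?_)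
    have h5 : t * X x = 2 * X x / (2 * R ^ 2 * (A + 1)) := by rw [ht]; field_simp
    rw [h5, ← add_div, norm_add_sq_real]
    refine div_le_div_of_nonneg_right ?_ (by positivity)
    have h6 : ‖x - m‖ ^ 2 ≤ R ^ 2 := by gcongr
    simp only [hX]
    linarith
  refine (lintegral_mono_ae h4).trans ?_
  rw [lintegral_const_mul _ (by fun_prop)]
  refine (mul_le_mul_right h3 _).trans ?_
  rw [← ENNReal.ofReal_mul (Real.exp_pos _).le, ← Real.exp_add]
  refine ENNReal.ofReal_le_ofReal (Real.exp_le_exp.2 ?_)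
  have e1 : (‖s‖ ^ 2 + R ^ 2) / (2 * R ^ 2 * (A + 1)) + R ^ 2 * ‖s‖ ^ 2 * t ^ 2 / 2
      = 1 / 2 / (A + 1) + ‖s‖ ^ 2 / (2 * R ^ 2) * (1 / (A + 1) + 1 / (A + 1) ^ 2) := by
    rw [ht]; field_simp; ring
  have e2 : ‖s‖ ^ 2 / (2 * R ^ 2 * A) = ‖s‖ ^ 2 / (2 * R ^ 2) * (1 / A) := by field_simp
  have e3 : 1 / (A + 1) + 1 / (A + 1) ^ 2 ≤ 1 / A := by
    rw [div_add_div _ _ (by positivity) (by positivity), div_le_div_iff₀ (by positivity) hA]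
    nlinarith [pow_pos hA 2]
  rw [e1, e2]
  gcongr
  linarith

end Bounded

section Rounds

variable {n M : ℕ} {C ε₀ γ ε₂ κ : ℝ} {e : Vec (n + 2)}

lemma privUnitMechanism_mean (hM : 0 < M) (hε₀ : 0 < ε₀) (hκ : 0 < κ) (hε : κ ≤ ε₂) (hC : 0 < C)
    (h0 : 0 < γ) (h1 : γ < 1) (he : ‖e‖ = 1) (Δ : Fin M → Vec (n + 2)) (hΔ : ∀ i, ‖Δ i‖ ≤ C)
    (t : ℝ) :
    Measure.pi (fun i => privUnitMechanism C ε₀ γ ε₂ e (Δ i))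
      {x | 4 * (scalarBound κ * C / privUnitScale (n + 2) ε₀ γ + C) ^ 2 * (1 / 2 + t) / M
        < ‖mean x - mean Δ‖ ^ 2} ≤ ENNReal.ofReal (Real.exp (-t)) := by
  have hm : 0 < privUnitScale (n + 2) ε₀ γ :=
    lt_of_lt_of_le (by positivity) (le_privUnitScale hε₀ h0 h1)
  have hε' := hκ.trans_le hε
  have hH := scalarBound_pos hκ
  have := fun i => isProbabilityMeasure_privUnitMechanism (ε₀ := ε₀) (ε₂ := ε₂) hC h0 h1 he (hΔ i)
  refine measure_norm_mean_sub_le hM (by positivity) (by norm_num) _ Δ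
    (fun i s A hA => lintegral_exp_norm_sq_le_of_bounded (by positivity) ?_
      (integral_privUnitMechanism hε₀ hε' hC h0 h1 he (hΔ i)) s hA) t
  filter_upwards [ae_privUnitMechanism_norm_le (e := e) (Δ := Δ i) hε' hC hm] with x hx
  refine (norm_sub_le _ _).trans (add_le_add (hx.trans ?_) (hΔ i))
  have h2 := normC₁_le hκ hε
  have h3 := normC₁_pos hε'
  gcongr
  linarith

lemma privUnitMechanism_sq (hM : 0 < M) (hε₀ : 0 < ε₀) (hκ : 0 < κ) (hε : κ ≤ ε₂) (hC : 0 < C)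
    (h0 : 0 < γ) (h1 : γ < 1) (he : ‖e‖ = 1)
    (hb : ∀ n : ℤ, (scalarK ε₂ : ℝ) * (scalarK ε₂ + 1) / (Real.exp ε₂ + scalarK ε₂) ≠ n)
    (Δ : Fin M → Vec (n + 2)) (hΔ : ∀ i, ‖Δ i‖ ≤ C) (t : ℝ) :
    Measure.pi (fun i => privUnitMechanism C ε₀ γ ε₂ e (Δ i))
      {x | 2 * average (fun i => ‖Δ i‖ ^ 2) + 104 * scalarBound κ ^ 2 * C ^ 2 * t / M
        < average (fun i => sqNormEstimate C ε₀ γ ε₂ (x i))} ≤ ENNReal.ofReal (Real.exp (-t)) := by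
  have hm : 0 < privUnitScale (n + 2) ε₀ γ :=
    lt_of_lt_of_le (by positivity) (le_privUnitScale hε₀ h0 h1)
  have hM' : (0 : ℝ) < M := by positivity
  have hH := scalarBound_pos hκ
  have hms := measurable_sqNormEstimate (d := n + 2) (C := C) (ε₀ := ε₀) (γ := γ) (ε₂ := ε₂)
  have := fun i => isProbabilityMeasure_privUnitMechanism (ε₀ := ε₀) (ε₂ := ε₂) hC h0 h1 he (hΔ i)
  set W := 104 * scalarBound κ ^ 2 * C ^ 2 with hW
  have hW0 : 0 < W := by positivity
  have hall : ∫⁻ x, ENNReal.ofReal (Real.exp (∑ i, 1 / W * (sqNormEstimate C ε₀ γ ε₂ (x i)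
      - 2 * ‖Δ i‖ ^ 2))) ∂Measure.pi (fun i => privUnitMechanism C ε₀ γ ε₂ e (Δ i))
      ≤ ENNReal.ofReal (Real.exp 0) := by
    simp_rw [Real.exp_sum, ENNReal.ofReal_prod_of_nonneg fun i _ => (Real.exp_pos _).le]
    rw [lintegral_pi_prod (fun i => privUnitMechanism C ε₀ γ ε₂ e (Δ i)) (F := fun i x =>
      ENNReal.ofReal (Real.exp (1 / W * (sqNormEstimate C ε₀ γ ε₂ x - 2 * ‖Δ i‖ ^ 2))))
      fun i => by fun_prop]
    refine (Finset.prod_le_one' fun i _ =>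
      lintegral_exp_sqNormEstimate_le hκ hε hC h0 h1 hm hb he (hΔ i)).trans (by simp)
  refine (measure_mono ?_).trans (measure_lt_le_of_lintegral_exp (by fun_prop) hall t)
  intro x hx
  simp only [Set.mem_ofPred_eq] at hx ⊢
  have hsum : ∑ i, 1 / W * (sqNormEstimate C ε₀ γ ε₂ (x i) - 2 * ‖Δ i‖ ^ 2)
      = M / W * (average (fun i => sqNormEstimate C ε₀ γ ε₂ (x i))
        - 2 * average (fun i => ‖Δ i‖ ^ 2)) := by
    simp only [average, ← Finset.mul_sum, Finset.sum_sub_distrib]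
    field_simp
  rw [hsum]
  have h2 : (M : ℝ) / W * (W * t / M) = t := by field_simp
  have h3 := mul_lt_mul_of_pos_left (by linarith : W * t / M
    < average (fun i => sqNormEstimate C ε₀ γ ε₂ (x i)) - 2 * average (fun i => ‖Δ i‖ ^ 2))
    (by positivity : 0 < (M : ℝ) / W)
  linarith

end Rounds

/-! ### Convergence with PrivUnit -/

section Threshold

variable {d : ℕ} {ε₁ : ℝ}

/-- The threshold `√(ε₁ / (4 d))` satisfies the second admissibility condition when `ε₁ ≥ 8`. -/
lemma admissibleThreshold_sqrt (hd : 2 ≤ d) (h8 : 8 ≤ ε₁) (hεd : ε₁ ≤ d) :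
    AdmissibleThreshold d ε₁ √(ε₁ / (4 * d)) := by
  have hd' : (2 : ℝ) ≤ d := by exact_mod_cast hd
  have hd0 : (0 : ℝ) < d := by linarith
  set x := ε₁ / (4 * d) with hx
  have hx0 : 0 < x := by positivity
  have hx1 : x ≤ 1 / 4 := by
    rw [hx, div_le_iff₀ (by positivity)]; linarith
  have hxd : d * x = ε₁ / 4 := by rw [hx]; field_simp
  refine ⟨Real.sqrt_nonneg _, (Real.sqrt_lt' one_pos).2 (by linarith), Or.inr ⟨?_, ?_⟩⟩
  · rw [Real.sq_sqrt hx0.le, Real.log_sqrt hx0.le]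
    have h1 : Real.log d + Real.log x = Real.log (ε₁ / 4) := by
      rw [← Real.log_mul hd0.ne' hx0.ne', hxd]
    have h2 := Real.log_le_sub_one_of_pos (by positivity : 0 < ε₁ / 4)
    have h3 := Real.log_le_sub_one_of_pos (by norm_num : (0 : ℝ) < 6)
    have h4 : -Real.log (1 - x) ≤ 4 / 3 * x := by
      rw [← Real.log_inv]
      refine (Real.log_le_sub_one_of_pos (inv_pos.2 (by linarith))).trans ?_
      rw [sub_le_iff_le_add, inv_le_iff_one_le_mul₀ (by linarith)]
      nlinarith
    have h5 := mul_le_mul_of_nonneg_left h4 (by linarith : 0 ≤ ((d : ℝ) - 1) / 2)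
    nlinarith
  · apply Real.sqrt_le_sqrt
    rw [hx, div_le_div_iff₀ hd0 (by positivity)]
    nlinarith

/-- Since `1 / d ≤ π / (2 (d - 1))`, the first admissibility condition holds at this threshold for
every `ε₁ ≥ κ`. -/
lemma admissibleThreshold_tanh (hd : 2 ≤ d) {κ : ℝ} (hκ : 0 < κ) (hε : κ ≤ ε₁) :
    AdmissibleThreshold d ε₁ ((Real.exp κ - 1) / (Real.exp κ + 1) * √(1 / d)) := by
  have hd' : (2 : ℝ) ≤ d := by exact_mod_cast hd
  have h1 := exp_pos_sub_one hκ
  have h2 := Real.exp_pos κ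
  have h3 : Real.exp κ ≤ Real.exp ε₁ := Real.exp_le_exp.2 hε
  have h4 : √(1 / (d : ℝ)) ≤ 1 := by
    rw [Real.sqrt_le_one, div_le_one (by linarith)]; linarith
  refine ⟨by positivity, ?_, Or.inl ?_⟩
  · have h5 : (Real.exp κ - 1) / (Real.exp κ + 1) < 1 := by
      rw [div_lt_one (by positivity)]; linarith
    exact (mul_le_of_le_one_right (by positivity) h4).trans_lt h5
  · apply mul_le_mul _ _ (Real.sqrt_nonneg _) (div_nonneg (by linarith) (by positivity))
    · rw [div_le_div_iff₀ (by positivity) (by positivity)]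
      nlinarith
    · apply Real.sqrt_le_sqrt
      rw [div_le_div_iff₀ (by linarith) (by linarith)]
      nlinarith [Real.pi_gt_three]

/-- A near-optimal admissible threshold is at least of order `√(ε₁ / d)`. -/
lemma sq_threshold_ge (hd : 2 ≤ d) {κ θ γ : ℝ} (hκ : 0 < κ) (hθ : 0 < θ) (hε : κ ≤ ε₁)
    (hεd : ε₁ ≤ d) (hγ : ∀ γ', AdmissibleThreshold d ε₁ γ' → θ * γ' ≤ γ) :
    0 < γ ∧ θ ^ 2 * ((Real.exp κ - 1) / (Real.exp κ + 1)) ^ 2 / 8 * (ε₁ / d) ≤ γ ^ 2 := by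
  have hd' : (2 : ℝ) ≤ d := by exact_mod_cast hd
  have hd0 : (0 : ℝ) < d := by linarith
  have hκ1 := exp_pos_sub_one hκ
  have hκ2 := Real.exp_pos κ
  have hε0 : 0 < ε₁ := hκ.trans_le hε
  set ρ := (Real.exp κ - 1) / (Real.exp κ + 1) with hρ
  have hρ0 : 0 < ρ := by positivity
  have hρ1 : ρ ≤ 1 := by
    rw [hρ, div_le_one (by positivity)]; linarith
  have hsd : 0 < √(1 / (d : ℝ)) := by positivity
  have h1 := hγ _ (admissibleThreshold_tanh hd hκ hε)
  have hγ0 : 0 < γ := lt_of_lt_of_le (by positivity) h1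
  refine ⟨hγ0, ?_⟩
  -- for `ε₁ < 8` the quantities `ε₁ / d` and `1 / d` are comparable
  rcases le_or_gt 8 ε₁ with h8 | h8
  · have h2 := pow_le_pow_left₀ (by positivity) (hγ _ (admissibleThreshold_sqrt hd h8 hεd)) 2
    rw [mul_pow, Real.sq_sqrt (by positivity)] at h2
    refine le_trans ?_ h2
    have h3 : ρ ^ 2 ≤ 1 := pow_le_one₀ hρ0.le hρ1
    calc θ ^ 2 * ρ ^ 2 / 8 * (ε₁ / d) ≤ θ ^ 2 * 1 / 4 * (ε₁ / d) := by gcongr; norm_num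
      _ = θ ^ 2 * (ε₁ / (4 * d)) := by field_simp
  · have h2 := pow_le_pow_left₀ (by positivity) h1 2
    rw [mul_pow, mul_pow, Real.sq_sqrt (by positivity)] at h2
    refine le_trans ?_ h2
    calc θ ^ 2 * ρ ^ 2 / 8 * (ε₁ / d) ≤ θ ^ 2 * ρ ^ 2 / 8 * (8 / d) := by gcongr
      _ = θ ^ 2 * (ρ ^ 2 * (1 / d)) := by field_simp

end Threshold

lemma sq_le_mul_privUnitVariance {d : ℕ} {C ε₁ : ℝ} (hε : 0 < ε₁) (hεd : ε₁ ≤ d) :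
    C ^ 2 * (d / ε₁) ≤ d * privUnitVariance C ε₁ ∧ C ^ 2 ≤ d * privUnitVariance C ε₁ := by
  have h1 : C ^ 2 * (d / ε₁) ≤ d * privUnitVariance C ε₁ := by
    rw [privUnitVariance]
    calc C ^ 2 * (d / ε₁) = d * (C ^ 2 * (1 / ε₁)) := by ring
      _ ≤ _ := by gcongr; exact le_max_left _ _
  refine ⟨h1, le_trans ?_ h1⟩
  exact le_mul_of_one_le_right (sq_nonneg C) ((one_le_div hε).2 hεd)

/-- The messages of PrivUnit have norm of order `√d σ`, because `m` is of order
`√(ε₁ / d)` at least. -/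
lemma sq_message_bound_le {n : ℕ} {κ θ γ ε₀ ε₁ C H : ℝ} (hκ : 0 < κ) (hθ : 0 < θ) (hε : κ ≤ ε₁)
    (hεd : ε₁ ≤ (n + 2 : ℕ)) (hε₀ : 0 < ε₀) (h1 : γ < 1)
    (hγ : ∀ γ', AdmissibleThreshold (n + 2) ε₁ γ' → θ * γ' ≤ γ) :
    (H * C / privUnitScale (n + 2) ε₀ γ + C) ^ 2
      ≤ (4096 * H ^ 2 / (θ ^ 2 * ((Real.exp κ - 1) / (Real.exp κ + 1)) ^ 2) + 2)
        * ((n + 2 : ℕ) * privUnitVariance C ε₁) := by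
  obtain ⟨h0, h2⟩ := sq_threshold_ge (by omega) hκ hθ hε hεd hγ
  have hε1 : 0 < ε₁ := hκ.trans_le hε
  have hm := le_privUnitScale (n := n) hε₀ h0 h1
  obtain ⟨h3, h4⟩ := sq_le_mul_privUnitVariance (C := C) hε1 hεd
  have hκ1 := exp_pos_sub_one hκ
  have hκ2 := Real.exp_pos κ
  have hρ0 : 0 < (Real.exp κ - 1) / (Real.exp κ + 1) := by positivity
  set ρ := (Real.exp κ - 1) / (Real.exp κ + 1)
  set m := privUnitScale (n + 2) ε₀ γ
  set d : ℝ := ((n + 2 : ℕ) : ℝ) with hd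
  have hd0 : 0 < d := by rw [hd]; positivity
  have hm0 : 0 < m := lt_of_lt_of_le (by positivity) hm
  have h5 : (γ / 16) ^ 2 ≤ m ^ 2 := by gcongr
  have h6 : 1 / m ^ 2 ≤ 2048 / (θ ^ 2 * ρ ^ 2) * (d / ε₁) := by
    have h7 : θ ^ 2 * ρ ^ 2 / 2048 * (ε₁ / d) ≤ m ^ 2 := by linarith
    calc 1 / m ^ 2 ≤ 1 / (θ ^ 2 * ρ ^ 2 / 2048 * (ε₁ / d)) :=
          one_div_le_one_div_of_le (by positivity) h7
      _ = _ := by field_simp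
  have h8 : (H * C / m + C) ^ 2 ≤ 2 * H ^ 2 * C ^ 2 * (1 / m ^ 2) + 2 * C ^ 2 := by
    have e : H * C / m = H * C * (1 / m) := by ring
    have e2 : 2 * H ^ 2 * C ^ 2 * (1 / m ^ 2) = 2 * (H * C / m) ^ 2 := by ring
    rw [e2]
    nlinarith [sq_nonneg (H * C / m - C)]
  calc (H * C / m + C) ^ 2 ≤ 2 * H ^ 2 * C ^ 2 * (1 / m ^ 2) + 2 * C ^ 2 := h8
    _ ≤ 2 * H ^ 2 * C ^ 2 * (2048 / (θ ^ 2 * ρ ^ 2) * (d / ε₁)) + 2 * C ^ 2 := by gcongr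
    _ = 4096 * H ^ 2 / (θ ^ 2 * ρ ^ 2) * (C ^ 2 * (d / ε₁)) + 2 * C ^ 2 := by ring
    _ ≤ 4096 * H ^ 2 / (θ ^ 2 * ρ ^ 2) * (d * privUnitVariance C ε₁)
        + 2 * (d * privUnitVariance C ε₁) := by gcongr
    _ = _ := by ring

/-- Convergence with PrivUnit: both `N` and `N'` are of order `q² σ² d / M`. -/
theorem privUnit_convergence : ∃ c : ℝ, 0 < c ∧ ∀ κ κ' θ : ℝ, 0 < κ → 0 < κ' → 0 < θ →
    ∃ K : ℝ, 0 < K ∧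
      ∀ (d M τ T : ℕ) (f : Fin M → FedEXP.Vec d → ℝ) (L G σg Fstar η ε₀ ε₁ ε₂ γ q : ℝ)
        (w0 e : FedEXP.Vec d),
        2 ≤ d → 1 ≤ τ → 1 ≤ T →
        FedEXP.ClientAssumptions f L G σg →
        IsGLB (Set.range (FedEXP.objective f)) Fstar →
        κ / (L * τ) ≤ η → η < 1 / (24 * L * τ) →
        0 < ε₀ → κ' ≤ ε₁ → ε₁ ≤ d → κ' ≤ ε₂ →
        (∀ n : ℤ, (FedEXP.scalarK ε₂ : ℝ) * (FedEXP.scalarK ε₂ + 1) /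
          (Real.exp ε₂ + FedEXP.scalarK ε₂) ≠ n) →
        FedEXP.AdmissibleThreshold d ε₁ γ →
        (∀ γ' : ℝ, FedEXP.AdmissibleThreshold d ε₁ γ' → θ * γ' ≤ γ) →
        ‖e‖ = 1 → 1 ≤ q → q ≤ √(M : ℝ) →
        1 - T * Real.exp (-c * q ^ 2) ≤
          (FedEXP.transcriptLaw f η τ (η * τ * G)
              (FedEXP.privUnitMechanism (η * τ * G) ε₀ γ ε₂ e)
              (FedEXP.privUnitStep (η * τ * G) ε₀ γ ε₂) w0 T).real
            {m | (⨅ t : Fin T, ‖gradient (FedEXP.objective f)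
                    (FedEXP.model (FedEXP.privUnitStep (η * τ * G) ε₀ γ ε₂) w0 m t)‖ ^ 2) ≤
                K * ((FedEXP.objective f w0 - Fstar) /
                      ((∑ t ∈ Finset.range T,
                          FedEXP.privUnitStep (η * τ * G) ε₀ γ ε₂ (m t)) * η * τ)
                  + η ^ 2 * L ^ 2 * τ * ((τ : ℝ) - 1) * σg ^ 2
                  + η * L * τ * σg ^ 2
                  + L * FedEXP.privUnitVariance (η * τ * G) ε₁ * q ^ 2 / (η * τ) *
                      ((d : ℝ) / M + √(1 / (M : ℝ))))} := by
  refine ⟨1, one_pos, fun κ κ' θ hκ hκ' hθ => ?_⟩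
  have hH := scalarBound_pos hκ'
  set H := scalarBound κ' with hHdef
  obtain ⟨W, hW⟩ : ∃ W, W = 4096 * H ^ 2
    / (θ ^ 2 * ((Real.exp κ' - 1) / (Real.exp κ' + 1)) ^ 2) + 2 := ⟨_, rfl⟩
  have hW0 : 0 < W := by rw [hW]; positivity
  refine ⟨20 + 4 * (2 / κ + 1) * (10 * W + 208 * H ^ 2), by positivity, ?_⟩
  intro d M τ T f L G σg Fstar η ε₀ ε₁ ε₂ γ q w0 e hd hτ hT hA hF hη1 hη2 hε₀ hε₁ hεd hε₂ hb hadm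
    hγ he hq hqM
  obtain ⟨n, rfl⟩ : ∃ n, d = n + 2 := ⟨d - 2, by omega⟩
  have hL := hA.L_pos
  have hG := hA.G_pos
  have hτ' : (0 : ℝ) < τ := by exact_mod_cast hτ
  have hη : 0 < η := lt_of_lt_of_le (by positivity) hη1
  have hM : 0 < M := by
    rcases Nat.eq_zero_or_pos M with rfl | h
    · simp at hqM; linarith
    · exact h
  have hM' : (0 : ℝ) < M := by positivity
  have hq2 : 1 ≤ q ^ 2 := by nlinarith
  obtain ⟨h0, -⟩ := sq_threshold_ge hd hκ' hθ hε₁ hεd hγ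
  have h1 : γ < 1 := hadm.2.1
  have hε1 : 0 < ε₁ := hκ'.trans_le hε₁
  obtain ⟨C, hC⟩ : ∃ C, C = η * τ * G := ⟨_, rfl⟩
  have hC0 : 0 < C := by rw [hC]; positivity
  have hbound := sq_message_bound_le (C := C) (H := H) hκ' hθ hε₁ hεd hε₀ h1 hγ
  rw [← hW] at hbound
  have hC2 := (sq_le_mul_privUnitVariance (C := C) hε1 hεd).2
  have hν : 0 ≤ privUnitVariance C ε₁ := by
    have : 0 ≤ 1 / ε₁ := by positivity
    exact mul_nonneg (sq_nonneg C) (this.trans (le_max_left _ _))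
  set ν := privUnitVariance C ε₁ with hνdef
  set R := H * C / privUnitScale (n + 2) ε₀ γ + C with hR
  have hs : 0 ≤ √(1 / (M : ℝ)) := Real.sqrt_nonneg _
  have hN : 4 * R ^ 2 * (1 / 2 + 2 * q ^ 2) / M
      ≤ 10 * W * (ν * q ^ 2) * (((n + 2 : ℕ) : ℝ) / M + √(1 / (M : ℝ))) := by
    calc 4 * R ^ 2 * (1 / 2 + 2 * q ^ 2) / M
        ≤ 4 * (W * (((n + 2 : ℕ) : ℝ) * ν)) * (q ^ 2 / 2 + 2 * q ^ 2) / M := by gcongr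
      _ = 10 * W * (ν * q ^ 2) * (((n + 2 : ℕ) : ℝ) / M + 0) := by ring
      _ ≤ _ := by gcongr
  have hN' : 104 * H ^ 2 * C ^ 2 * (2 * q ^ 2) / M
      ≤ 208 * H ^ 2 * (ν * q ^ 2) * (((n + 2 : ℕ) : ℝ) / M + √(1 / (M : ℝ))) := by
    calc 104 * H ^ 2 * C ^ 2 * (2 * q ^ 2) / M
        ≤ 104 * H ^ 2 * (((n + 2 : ℕ) : ℝ) * ν) * (2 * q ^ 2) / M := by gcongr
      _ = 208 * H ^ 2 * (ν * q ^ 2) * (((n + 2 : ℕ) : ℝ) / M + 0) := by ring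
      _ ≤ _ := by gcongr
  subst hC
  have hms := measurable_sqNormEstimate (d := n + 2) (C := η * τ * G) (ε₀ := ε₀) (γ := γ) (ε₂ := ε₂)
  refine le_trans ?_ (convergence_of_round_bounds (R := privUnitMechanism (η * τ * G) ε₀ γ ε₂ e)
    (a := fun c => average (fun i => sqNormEstimate (η * τ * G) ε₀ γ ε₂ (c i)))
    (step := privUnitStep (η * τ * G) ε₀ γ ε₂) hM hτ hT hA hF hκ hη1 hη2
    (N := 4 * R ^ 2 * (1 / 2 + 2 * q ^ 2) / M)
    (N' := 104 * H ^ 2 * (η * τ * G) ^ 2 * (2 * q ^ 2) / M)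
    (by positivity) (by unfold average; fun_prop)
    (fun h hh hle => measurable_privUnitMechanism hC0 h0 h1 he hh hle)
    (fun Δ hΔ => isProbabilityMeasure_privUnitMechanism hC0 h0 h1 he hΔ)
    (Real.exp_pos (-(2 * q ^ 2))).le
    (fun Δ hΔ => privUnitMechanism_mean hM hε₀ hκ' hε₂ hC0 h0 h1 he Δ hΔ _)
    (fun Δ hΔ => privUnitMechanism_sq hM hε₀ hκ' hε₂ hC0 h0 h1 he hb Δ hΔ _) rfl w0
    (fun m => by
      have := convergence_bound_le (σg := σg) (κ := κ)
        (A := objective f w0 - Fstar)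
        (S := ∑ t ∈ Finset.range T, privUnitStep (η * τ * G) ε₀ γ ε₂ (m t))
        hτ hL hη hκ (sub_nonneg.2 (hF.1 ⟨_, rfl⟩))
        (Finset.sum_nonneg fun t _ => zero_le_one.trans (le_max_left _ _)) rfl hN hN'
        (by positivity) (by positivity) (by positivity) (by positivity)
      rw [← mul_assoc L] at this
      exact this))
  have := mul_le_mul_of_nonneg_left (two_mul_exp_le hq) (by positivity : (0 : ℝ) ≤ T)
  linarith

end FedEXP

theorem theorem1 :
    -- Gaussian mechanism
    (∃ c : ℝ, 0 < c ∧ ∀ κ : ℝ, 0 < κ → ∃ K : ℝ, 0 < K ∧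
      ∀ (d M τ T : ℕ) (f : Fin M → FedEXP.Vec d → ℝ) (L G σg Fstar η σ q : ℝ)
        (w0 : FedEXP.Vec d),
        1 ≤ τ → 1 ≤ T →
        FedEXP.ClientAssumptions f L G σg →
        IsGLB (Set.range (FedEXP.objective f)) Fstar →
        κ / (L * τ) ≤ η → η < 1 / (24 * L * τ) →
        0 < σ → 1 ≤ q → q ≤ √(M : ℝ) →
        1 - T * Real.exp (-c * q ^ 2) ≤
          (FedEXP.transcriptLaw f η τ (η * τ * G) (FedEXP.gaussianMechanism σ)
              (FedEXP.gaussianStep σ) w0 T).real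
            {m | (⨅ t : Fin T, ‖gradient (FedEXP.objective f)
                    (FedEXP.model (FedEXP.gaussianStep σ) w0 m t)‖ ^ 2) ≤
                K * ((FedEXP.objective f w0 - Fstar) /
                      ((∑ t ∈ Finset.range T, FedEXP.gaussianStep σ (m t)) * η * τ)
                  + η ^ 2 * L ^ 2 * τ * ((τ : ℝ) - 1) * σg ^ 2
                  + η * L * τ * σg ^ 2
                  + L * σ ^ 2 * q ^ 2 / (η * τ) * ((d : ℝ) / M + √((d : ℝ) / M)))}) ∧
    -- PrivUnit
    (∃ c : ℝ, 0 < c ∧ ∀ κ κ' θ : ℝ, 0 < κ → 0 < κ' → 0 < θ → ∃ K : ℝ, 0 < K ∧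
      ∀ (d M τ T : ℕ) (f : Fin M → FedEXP.Vec d → ℝ) (L G σg Fstar η ε₀ ε₁ ε₂ γ q : ℝ)
        (w0 e : FedEXP.Vec d),
        2 ≤ d → 1 ≤ τ → 1 ≤ T →
        FedEXP.ClientAssumptions f L G σg →
        IsGLB (Set.range (FedEXP.objective f)) Fstar →
        κ / (L * τ) ≤ η → η < 1 / (24 * L * τ) →
        0 < ε₀ → κ' ≤ ε₁ → ε₁ ≤ d → κ' ≤ ε₂ →
        -- the sign of the privatized norm can be recovered from its absolute value
        (∀ n : ℤ, (FedEXP.scalarK ε₂ : ℝ) * (FedEXP.scalarK ε₂ + 1) /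
          (Real.exp ε₂ + FedEXP.scalarK ε₂) ≠ n) →
        -- the threshold is admissible, and of the order of the largest admissible one
        FedEXP.AdmissibleThreshold d ε₁ γ →
        (∀ γ' : ℝ, FedEXP.AdmissibleThreshold d ε₁ γ' → θ * γ' ≤ γ) →
        ‖e‖ = 1 → 1 ≤ q → q ≤ √(M : ℝ) →
        1 - T * Real.exp (-c * q ^ 2) ≤
          (FedEXP.transcriptLaw f η τ (η * τ * G)
              (FedEXP.privUnitMechanism (η * τ * G) ε₀ γ ε₂ e)
              (FedEXP.privUnitStep (η * τ * G) ε₀ γ ε₂) w0 T).real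
            {m | (⨅ t : Fin T, ‖gradient (FedEXP.objective f)
                    (FedEXP.model (FedEXP.privUnitStep (η * τ * G) ε₀ γ ε₂) w0 m t)‖ ^ 2) ≤
                K * ((FedEXP.objective f w0 - Fstar) /
                      ((∑ t ∈ Finset.range T,
                          FedEXP.privUnitStep (η * τ * G) ε₀ γ ε₂ (m t)) * η * τ)
                  + η ^ 2 * L ^ 2 * τ * ((τ : ℝ) - 1) * σg ^ 2
                  + η * L * τ * σg ^ 2
                  + L * FedEXP.privUnitVariance (η * τ * G) ε₁ * q ^ 2 / (η * τ) *
                      ((d : ℝ) / M + √(1 / (M : ℝ))))}) := ⟨FedEXP.gaussian_convergence, FedEXP.privUnit_convergence⟩
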